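/- **Setting.** Let $r\ge 3$ be an integer, $q=e^{i\pi/r}$, $[n]=\frac{q^n-q^{-n}}{q-q^{-1}}$, $[n]!=[1][2]\cdots[n]$, $L=\{0,\tfrac12,1,\dots,\tfrac{r-2}{2}\}$, $\dim_q(j)=(-1)^{2j}[2j+1]$ and $N=\sum_{l\in L}\dim_q(l)^2$. A triple $(i,j,k)\in L^3$ is *admissible* if $i\le j+k$, $j\le i+k$, $k\le i+j$, $i+j+k\in\mathbb Z$ and $i+j+k\le r-2$; put $N_{i,j,k}=1$ if it is admissible and $N_{i,j,k}=0$ otherwise. Let $M$ be a compact 3-manifold, possibly with boundary, triangulated as a finite simplicial complex in which the link of each vertex is a 2-sphere or a disc. Fix a labelling $\beta$ of the edges of $\partial M$ by $L$ (the empty labelling if $M$ is closed). A *state* $S$ is a labelling of all edges by elements of $L$ that extends $\beta$ and is admissible on the three edges of every triangle. Its weight is $$w(S)=\prod_{v}N^{-1}\ \prod_{e}\dim_q(S_e)\ \prod_{f}\theta_S(f)^{-1}\ \prod_{t}\mathrm{Tet}_S(t),$$ the products being over vertices, edges, triangles and tetrahedra, where the factor of every vertex, edge or triangle in $\partial M$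 is replaced by its (principal) square root. Here $\theta$ and $\mathrm{Tet}$ are the Kauffman bracket evaluations of the theta and tetrahedral networks: for a triangle with labels $a,b,c$ and $s=a+b+c$, $$\theta=(-1)^s\frac{[s+1]!\,[s-2a]!\,[s-2b]!\,[s-2c]!}{[2a]!\,[2b]!\,[2c]!},$$ and for a tetrahedron $t$, with $a_f$ the sum of the labels on the edges of the face $f$ and $b_Q$ the sum of the labels on the quadrilateral $Q$ (the four edges left after removing a pair of opposite edges), $$\mathrm{Tet}=\frac{\prod_{f,Q}[b_Q-a_f]!}{\prod_{e\subset t}[2S_e]!}\sum_{\max_f a_f\le s\le\min_Q b_Q}\frac{(-1)^s[s+1]!}{\prod_f[s-a_f]!\,\prod_Q[b_Q-s]!}.$$ Let $Z(M)=\sum_S w(S)$, the sum being over all states. An *observable* is a tuple $\mathcal O=(e_1,\dots,e_n)$ of distinct edges not contained in $\partial M$, each of which meets $\partial M$ in at most one point, a vertex. For labels $j_1,\dots,j_n\in L$ let $Z(M,\mathcal O)[j_1,\dots,j_n]$ be the same sum restricted to the states with $S_{e_k}=j_k$ for all $k$. If $Z(M)\neq0$, put $W(M,\mathcal O)[j_1,\dots,j_n]=Z(M,\mathcal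 O)[j_1,\dots,j_n]/Z(M)$. **Theorem (triangle observable).** Let $Z(M)\ne0$ and let $\mathcal O$ be an observable consisting of the three edges of a triangle (a 2-simplex) of the triangulation. Then for all $i,j,c\in L$ $$W(M,\mathcal O)[i,j,c]=\frac{1}{N^2}\,\dim_q(i)\,\dim_q(j)\,\dim_q(c)\,N_{i,j,c}.$$ In particular, the value depends only on $r,i,j,c$, and not on $M$, its triangulation, the labelling of the boundary or the triangle. -/

import Mathlib

namespace TuraevViro

noncomputable section

open scoped Classical

/-! ### Quantum `SU(2)` data at the root of unity `q = exp (iπ / r)` -/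

/-- The root of unity `q = exp (iπ / r)`. -/
def q (r : ℕ) : ℂ := Complex.exp (Complex.I * (Real.pi : ℂ) / (r : ℂ))

/-- The quantum integer `[n]_q = (q ^ n - q ^ (-n)) / (q - q ^ (-1))`. -/
def qInt (r n : ℕ) : ℂ := (q r ^ n - (q r)⁻¹ ^ n) / (q r - (q r)⁻¹)

/-- The quantum factorial `[n]! = [1][2]⋯[n]`, with `[0]! = 1`. -/
def qFact (r n : ℕ) : ℂ := ∏ k ∈ Finset.Icc 1 n, qInt r k

/-- The label set `L = {0, 1/2, 1, …, (r-2)/2}`. The element `a = 0, …, r - 2` of `Fin (r - 1)`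
stands for the spin `a / 2`, so that all labels below are doubled spins. -/
abbrev Spin (r : ℕ) : Type := Fin (r - 1)

/-- `dim_q(j) = (-1)^{2j} [2j+1]_q`, in terms of the doubled spin `a = 2j`. -/
def qDim (r : ℕ) (a : Spin r) : ℂ := (-1) ^ (a : ℕ) * qInt r ((a : ℕ) + 1)

/-- `N = ∑_{l ∈ L} dim_q(l)²`. -/
def normN (r : ℕ) : ℂ := ∑ l : Spin r, qDim r l ^ 2

/-- Admissibility of a triple of spins: the triangle inequalities, the sum of the spins is an
integer, and it is at most `r - 2`. -/
def Admissible (r : ℕ) (a b c : Spin r) : Prop :=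
  (a : ℕ) ≤ b + c ∧ (b : ℕ) ≤ a + c ∧ (c : ℕ) ≤ a + b ∧
    Even ((a : ℕ) + b + c) ∧ (a : ℕ) + b + c ≤ 2 * (r - 2)

/-- `N_{a,b,c}`: equal to `1` if the triple is admissible and to `0` otherwise. -/
def intertwinerDim (r : ℕ) (a b c : Spin r) : ℕ := if Admissible r a b c then 1 else 0

/-! ### Finite simplicial complexes and triangulated 3-manifolds -/

section Complexes

variable {V : Type*} [Fintype V] [DecidableEq V]

/-- The `k`-dimensional simplices of `K`. -/
def simplices (K : PreAbstractSimplicialComplex V) (k : ℕ) : Finset (Finset V) :=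
  Finset.univ.filter fun s => s ∈ K.faces ∧ s.card = k + 1

/-- The link of the vertex `v`. -/
def link (K : PreAbstractSimplicialComplex V) (v : V) : PreAbstractSimplicialComplex V where
  faces := {s | s.Nonempty ∧ v ∉ s ∧ insert v s ∈ K.faces}
  isRelLowerSet_faces := by
    rintro s ⟨hs, hv, hK⟩
    refine ⟨hs, fun t hts ht => ⟨ht, fun h => hv (hts h), ?_⟩⟩
    exact (K.isRelLowerSet_faces hK).2 (Finset.insert_subset_insert v hts)
      (Finset.insert_nonempty v t)

/-- `K` is nonempty and any two of its vertices are joined by a path of edges. -/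
def IsConnected (K : PreAbstractSimplicialComplex V) : Prop :=
  (∃ v, {v} ∈ K.faces) ∧
    ∀ u v, {u} ∈ K.faces → {v} ∈ K.faces →
      Relation.ReflTransGen (fun x y : V => ({x, y} : Finset V) ∈ K.faces) u v

/-- Every simplex of `K` is a face of a `d`-dimensional simplex of `K`. -/
def IsPure (K : PreAbstractSimplicialComplex V) (d : ℕ) : Prop :=
  ∀ s ∈ K.faces, ∃ t ∈ simplices K d, s ⊆ t

/-- `K` is a triangulated circle: a connected graph all of whose vertices have degree two. -/
def IsCircle (K : PreAbstractSimplicialComplex V) : Prop :=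
  IsConnected K ∧ IsPure K 1 ∧ ∀ v, {v} ∈ K.faces → (simplices (link K v) 0).card = 2

/-- `K` is a triangulated closed arc: a connected graph with an edge, all of whose vertices have
degree at most two, and which has an end point. -/
def IsArc (K : PreAbstractSimplicialComplex V) : Prop :=
  IsConnected K ∧ IsPure K 1 ∧ (∀ v, {v} ∈ K.faces → (simplices (link K v) 0).card ≤ 2) ∧
    ∃ v, {v} ∈ K.faces ∧ (simplices (link K v) 0).card = 1

/-- The Euler characteristic of a complex of dimension at most two. -/
def eulerChar (K : PreAbstractSimplicialComplex V) : ℤ :=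
  ((simplices K 0).card : ℤ) - (simplices K 1).card + (simplices K 2).card

/-- `K` is a triangulated 2-sphere: a connected closed surface of Euler characteristic `2`. -/
def IsSphere (K : PreAbstractSimplicialComplex V) : Prop :=
  IsConnected K ∧ IsPure K 2 ∧ (∀ v, {v} ∈ K.faces → IsCircle (link K v)) ∧ eulerChar K = 2

/-- `K` is a triangulated closed disc: a connected compact surface with nonempty boundary and
Euler characteristic `1`. -/
def IsDisc (K : PreAbstractSimplicialComplex V) : Prop :=
  IsConnected K ∧ IsPure K 2 ∧
    (∀ v, {v} ∈ K.faces → IsCircle (link K v) ∨ IsArc (link K v)) ∧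
    (∃ v, {v} ∈ K.faces ∧ IsArc (link K v)) ∧ eulerChar K = 1

/-- `K` is a triangulated compact 3-manifold, possibly with boundary: the link of every vertex is
a 2-sphere (for interior vertices) or a disc (for boundary vertices). -/
def IsThreeManifold (K : PreAbstractSimplicialComplex V) : Prop :=
  IsPure K 3 ∧ ∀ v, {v} ∈ K.faces → IsSphere (link K v) ∨ IsDisc (link K v)

/-- The simplex `s` lies in the boundary, the subcomplex generated by the triangles that belong
to exactly one tetrahedron. -/
def InBoundary (K : PreAbstractSimplicialComplex V) (s : Finset V) : Prop :=
  ∃ f ∈ simplices K 2, ((simplices K 3).filter fun t => f ⊆ t).card = 1 ∧ s ⊆ f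

/-- The edges of the triangulation. -/
abbrev Edge (K : PreAbstractSimplicialComplex V) : Type _ := {e : Finset V // e ∈ simplices K 1}

/-- The edges in the boundary. -/
abbrev BoundaryEdge (K : PreAbstractSimplicialComplex V) : Type _ :=
  {e : Edge K // InBoundary K e.1}

/-- `a`, `b`, `c` are the three distinct edges of a triangle (a 2-simplex) of `K`. -/
def IsTriangle (K : PreAbstractSimplicialComplex V) (a b c : Edge K) : Prop :=
  a ≠ b ∧ b ≠ c ∧ a ≠ c ∧ ∃ f ∈ simplices K 2, a.1 ⊆ f ∧ b.1 ⊆ f ∧ c.1 ⊆ f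

/-- `(e_1, …, e_n)` is an observable: distinct interior edges, each of which meets the boundary in
at most one point, a vertex. -/
def IsObservable (K : PreAbstractSimplicialComplex V) {n : ℕ} (e : Fin n → Edge K) : Prop :=
  Function.Injective e ∧ ∀ k, ¬ InBoundary K (e k).1 ∧
    ∀ u ∈ (e k).1, ∀ v ∈ (e k).1, InBoundary K {u} → InBoundary K {v} → u = v

/-! ### The state sum -/

variable (K : PreAbstractSimplicialComplex V) (r : ℕ)

/-- The edges of the simplex `s`. -/
def edgesOf (s : Finset V) : Finset (Edge K) := Finset.univ.filter fun e => e.1 ⊆ s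

/-- The triangles that are faces of `t`. -/
def trianglesOf (t : Finset V) : Finset (Finset V) := (simplices K 2).filter fun f => f ⊆ t

/-- The three quadrilaterals of the tetrahedron `t`, each as its set of four edges: the edges
that are neither equal nor opposite to a given edge `e`. -/
def quadsOf (t : Finset V) : Finset (Finset (Edge K)) :=
  (edgesOf K t).image fun e => (edgesOf K t).filter fun e' => (e'.1 ∩ e.1).card = 1

variable {K} {r}

/-- The sum of the spins (half the sum of the doubled spins) over a set of edges. It is used only
for triangles and quadrilaterals, where it is an integer when the state is admissible, and, as
a bound, for tetrahedra. -/
def spinSum (S : Edge K → Spin r) (Q : Finset (Edge K)) : ℕ := (∑ e ∈ Q, (S e : ℕ)) / 2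

/-- The Kauffman bracket evaluation of the theta network whose edges carry the labels
`a`, `b`, `c` of the triangle `f`: with `s = (a + b + c) / 2`,
`θ(a,b,c) = (-1)^s [s+1]! [s-a]! [s-b]! [s-c]! / ([a]! [b]! [c]!)`. -/
def theta (S : Edge K → Spin r) (f : Finset V) : ℂ :=
  (-1) ^ spinSum S (edgesOf K f) * qFact r (spinSum S (edgesOf K f) + 1) *
    ∏ e ∈ edgesOf K f, qFact r (spinSum S (edgesOf K f) - S e) / qFact r (S e)

/-- The range of summation in the formula for the tetrahedral network. -/
def tetRange (S : Edge K → Spin r) (t : Finset V) : Finset ℕ :=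
  (Finset.range (spinSum S (edgesOf K t) + 1)).filter fun s =>
    (∀ f ∈ trianglesOf K t, spinSum S (edgesOf K f) ≤ s) ∧ ∀ Q ∈ quadsOf K t, s ≤ spinSum S Q

/-- The Kauffman bracket evaluation of the tetrahedral network whose six edges carry the labels of
the edges of `t` and whose four vertices correspond to the triangles of `t`. With `a_f` and `b_Q`
the sums of the spins over the triangles and over the quadrilaterals, it is
`(∏_{f,Q} [b_Q - a_f]! / ∏_e [S e]!)
  * ∑_{max a ≤ s ≤ min b} (-1)^s [s+1]! / (∏_f [s - a_f]! ∏_Q [b_Q - s]!)`. -/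
def tet (S : Edge K → Spin r) (t : Finset V) : ℂ :=
  (∏ f ∈ trianglesOf K t, ∏ Q ∈ quadsOf K t, qFact r (spinSum S Q - spinSum S (edgesOf K f))) /
      (∏ e ∈ edgesOf K t, qFact r (S e)) *
    ∑ s ∈ tetRange S t, (-1) ^ s * qFact r (s + 1) /
      ((∏ f ∈ trianglesOf K t, qFact r (s - spinSum S (edgesOf K f))) *
        ∏ Q ∈ quadsOf K t, qFact r (spinSum S Q - s))

/-- The state `S` is admissible and restricts to the given labelling of the boundary. -/
def IsState (β : BoundaryEdge K → Spin r) (S : Edge K → Spin r) : Prop :=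
  (∀ a b c : Edge K, IsTriangle K a b c → Admissible r (S a) (S b) (S c)) ∧
    ∀ e : BoundaryEdge K, S e.1 = β e

/-- A factor of the state sum attached to the simplex `s`: simplices in the boundary enter with
the square root of the weight of an interior one. -/
def halved (K : PreAbstractSimplicialComplex V) (s : Finset V) (x : ℂ) : ℂ :=
  if InBoundary K s then x ^ (1 / 2 : ℂ) else x

/-- The weight of a state: a factor `1 / N` for each vertex, `dim_q` for each edge, `1 / θ` for
each triangle and `Tet` for each tetrahedron. -/
def weight (S : Edge K → Spin r) : ℂ :=
  (∏ v ∈ simplices K 0, halved K v (1 / normN r)) *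
    (∏ e : Edge K, halved K e.1 (qDim r (S e))) *
    (∏ f ∈ simplices K 2, halved K f (1 / theta S f)) *
    ∏ t ∈ simplices K 3, tet S t

variable (K) (r)

/-- The Turaev-Viro partition function of `K` with boundary labelling `β` (the empty labelling if
`K` is closed). -/
def partitionFunction (β : BoundaryEdge K → Spin r) : ℂ :=
  ∑ S : Edge K → Spin r with IsState β S, weight S

/-- The partition function with the labels of the edges `e_1, …, e_n` kept fixed to
`j_1, …, j_n`. -/
def observableSum (β : BoundaryEdge K → Spin r) {n : ℕ} (e : Fin n → Edge K)
    (j : Fin n → Spin r) : ℂ :=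
  ∑ S : Edge K → Spin r with IsState β S ∧ ∀ k, S (e k) = j k, weight S

/-- The expectation value `W = Z(O)[j_1, …, j_n] / Z`. -/
def expectation (β : BoundaryEdge K → Spin r) {n : ℕ} (e : Fin n → Edge K)
    (j : Fin n → Spin r) : ℂ :=
  observableSum K r β e j / partitionFunction K r β

end Complexes

end

end TuraevViro

/-! Let `v` be an interior vertex of the triangle and let its opposite edge `{p, s}` carry the label
`z`. With all labels away from `v` kept fixed, the sum over the labels of the edges at `v` is a
state sum on the link of `v`, a triangulated sphere: a vertex of the link stands for an edge at `v`
and carries `dim_q`, an edge of the link carries `1/θ`, a triangle carries `Tet`. The main claim,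
`partialSum_eq_of_admissible`, is that apart from the factor `dim_q(x) dim_q(y)` of the two edges
`{v, p}` and `{v, s}` this sum does not depend on their labels `x`, `y`, as long as `(x, y, z)` is
admissible.

The claim is proved by moving labels by spin 1/2. The kernel `stepKernel` joins the doubled spins
`(a, b)` at the ends of an edge of the link to `(a ± 1, b ± 1)`. It obeys two local laws. It slides
through a tetrahedron (`tetWeight_relation`, a Biedenharn-Elliott identity with one label equal to
spin 1/2, which rests on contiguity relations of the Racah sum). It is orthogonal when an edge is
run through forth and back (`stepKernel_orthogonality`). Now grow a disc in the link from the edge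
`{p, s}`, triangle by triangle, until it contains all triangles, and then fold its boundary walk
back onto `{p, s}`, summing over the labels of the vertices that disappear. The product of the
kernels along the walk commutes with both operations, so the resulting amplitude `X` satisfies `X a
b = X a' b'` whenever the kernel does not vanish. The admissible pairs are connected by such steps,
hence `X` is constant on them.

So for given `z` the sum with three fixed labels is proportional to `dim_q(x) dim_q(y) N_{x,y,z}`.
The fusion rule `∑ dim_q(a) N_{a,b,c} = dim_q(b) dim_q(c)` determines the constant in terms of the
sum with the single label `z` fixed (`triangleSum_mul_normN`). An observable has at most one vertex
of the triangle on the boundary, so a second vertex, an end of the third edge, is interior as well.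
The same formula at that vertex, summed over the other labels, gives `dim_q(z)² Z / N` for the sum
with one fixed label (`edgeSum_mul_normN`), and the two results combine. -/

namespace TuraevViro

noncomputable section

open scoped Classical

/-! ### Quantum integers and factorials with integer arguments -/

/-- The quantum integer `[n]` for an integer `n`. -/
def qBr (r : ℕ) (n : ℤ) : ℂ := (q r ^ n - q r ^ (-n)) / (q r - (q r)⁻¹)

/-- `1 / [n]!`, extended by zero to negative `n`. -/
def qInvFact (r : ℕ) (n : ℤ) : ℂ := if n < 0 then 0 else (qFact r n.toNat)⁻¹

theorem q_ne_zero (r : ℕ) : q r ≠ 0 := Complex.exp_ne_zero _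

theorem qInt_eq_qBr (r n : ℕ) : qInt r n = qBr r n := by
  simp [qInt, qBr, zpow_neg]

/-- `q ^ n = q ^ (-n)` means `(q²) ^ n = 1`, and `q²` is a primitive `r`-th root of unity. -/
theorem q_zpow_sub_eq_zero_iff {r : ℕ} (hr : 3 ≤ r) (n : ℤ) :
    q r ^ n - q r ^ (-n) = 0 ↔ (r : ℤ) ∣ n := by
  have hp : IsPrimitiveRoot (q r ^ 2) r := by
    have h := Complex.isPrimitiveRoot_exp r (by omega)
    have e : q r ^ 2 = Complex.exp (2 * Real.pi * Complex.I / r) := by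
      rw [q, ← Complex.exp_nat_mul]
      congr 1
      push_cast
      ring
    rwa [e]
  rw [← hp.zpow_eq_one_iff_dvd n, sub_eq_zero, zpow_neg,
    ← mul_eq_one_iff_eq_inv₀ (zpow_ne_zero _ (q_ne_zero r)), ← mul_zpow, ← sq]

theorem q_sub_inv_ne_zero {r : ℕ} (hr : 3 ≤ r) : q r - (q r)⁻¹ ≠ 0 := by
  have h := (q_zpow_sub_eq_zero_iff hr 1).not
  simp only [zpow_one, zpow_neg] at h
  refine h.2 fun h1 => ?_
  have := Int.le_of_dvd one_pos h1
  omega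

theorem qBr_eq_zero_iff {r : ℕ} (hr : 3 ≤ r) (n : ℤ) : qBr r n = 0 ↔ (r : ℤ) ∣ n := by
  rw [qBr, div_eq_zero_iff, or_iff_left (q_sub_inv_ne_zero hr), q_zpow_sub_eq_zero_iff hr]

theorem qBr_ne_zero {r : ℕ} (hr : 3 ≤ r) {n : ℤ} (h0 : 0 < n) (h1 : n < r) : qBr r n ≠ 0 := by
  rw [Ne, qBr_eq_zero_iff hr]
  intro h
  have := Int.le_of_dvd h0 h
  omega

@[simp] theorem qBr_zero (r : ℕ) : qBr r 0 = 0 := by simp [qBr]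

theorem qBr_self {r : ℕ} (hr : 3 ≤ r) : qBr r r = 0 := (qBr_eq_zero_iff hr _).2 dvd_rfl

theorem qBr_one {r : ℕ} (hr : 3 ≤ r) : qBr r 1 = 1 := by
  simp [qBr, div_self (q_sub_inv_ne_zero hr)]

theorem qFact_succ (r n : ℕ) : qFact r (n + 1) = qBr r (n + 1) * qFact r n := by
  rw [qFact, Finset.prod_Icc_succ_top (by omega), mul_comm, qInt_eq_qBr]
  simp [qFact]

theorem qFact_ne_zero {r : ℕ} (hr : 3 ≤ r) {n : ℕ} (h : n < r) : qFact r n ≠ 0 := by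
  rw [qFact, Finset.prod_ne_zero_iff]
  intro k hk
  rw [Finset.mem_Icc] at hk
  rw [qInt_eq_qBr]
  exact qBr_ne_zero hr (by omega) (by omega)

theorem qFact_eq_zero {r : ℕ} (hr : 3 ≤ r) {n : ℕ} (h : r ≤ n) : qFact r n = 0 := by
  rw [qFact]
  refine Finset.prod_eq_zero (i := r) (Finset.mem_Icc.2 ⟨by omega, h⟩) ?_
  rw [qInt_eq_qBr, qBr_self hr]

theorem qInvFact_of_neg (r : ℕ) {n : ℤ} (h : n < 0) : qInvFact r n = 0 := if_pos h

theorem qInvFact_natCast (r n : ℕ) : qInvFact r n = (qFact r n)⁻¹ := by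
  simp [qInvFact]

/-- For `n ≤ 0` both sides vanish, by the extension by zero and by `[0] = 0`. The upper bound is
sharp: at `n = r` the right side is `0` because `[r] = 0`, while `1 / [r-1]!` is not. Hence the
range hypotheses `hb` of the contiguity relations. -/
theorem qInvFact_pred {r : ℕ} (hr : 3 ≤ r) {n : ℤ} (h : n ≤ r - 1) :
    qInvFact r (n - 1) = qBr r n * qInvFact r n := by
  rcases lt_trichotomy n 0 with h0 | rfl | h0
  · rw [qInvFact_of_neg r (by omega), qInvFact_of_neg r h0, mul_zero]
  · rw [qInvFact_of_neg r (by omega), qBr_zero, zero_mul]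
  · obtain ⟨m, rfl⟩ : ∃ m : ℕ, n = m + 1 := ⟨(n - 1).toNat, by omega⟩
    have e : ((m : ℤ) + 1) = ((m + 1 : ℕ) : ℤ) := by push_cast; ring
    rw [add_sub_cancel_right, e, qInvFact_natCast, qInvFact_natCast, qFact_succ, mul_inv,
      ← mul_assoc]
    push_cast
    rw [mul_inv_cancel₀ (qBr_ne_zero hr h0 (by omega)), one_mul]

theorem qFact_toNat_succ (r : ℕ) {n : ℤ} (h : 0 ≤ n) :
    qFact r (n + 1).toNat = qBr r (n + 1) * qFact r n.toNat := by
  obtain ⟨m, rfl⟩ := Int.eq_ofNat_of_zero_le h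
  exact qFact_succ r m

/-! ### The Racah sum and its contiguity relations -/

/-- The summand of the Racah sum in the formula for the tetrahedral network. -/
def racahTerm (r : ℕ) (f₀ f₁ f₂ f₃ g₁ g₂ g₃ s : ℤ) : ℂ :=
  (-1) ^ s * qFact r (s + 1).toNat *
    (qInvFact r (s - f₀) * qInvFact r (s - f₁) * qInvFact r (s - f₂) * qInvFact r (s - f₃)) *
    (qInvFact r (g₁ - s) * qInvFact r (g₂ - s) * qInvFact r (g₃ - s))

/-- The Racah sum with lower bounds `fᵢ` and upper bounds `gᵢ`. -/
def racahSum (r : ℕ) (f₀ f₁ f₂ f₃ g₁ g₂ g₃ : ℤ) : ℂ :=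
  ∑ᶠ s : ℤ, racahTerm r f₀ f₁ f₂ f₃ g₁ g₂ g₃ s

theorem racahTerm_eq_zero (r : ℕ) {f₀ f₁ f₂ f₃ g₁ g₂ g₃ s : ℤ}
    (h : s < f₀ ∨ s < f₁ ∨ s < f₂ ∨ s < f₃ ∨ g₁ < s ∨ g₂ < s ∨ g₃ < s) :
    racahTerm r f₀ f₁ f₂ f₃ g₁ g₂ g₃ s = 0 := by
  rcases h with h | h | h | h | h | h | h <;>
    simp [racahTerm, qInvFact_of_neg r (sub_neg.2 h)]

theorem finite_support_of_Icc {F : ℤ → ℂ} (m n : ℤ) (h : ∀ s, s < m ∨ n < s → F s = 0) :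
    F.support.Finite := by
  refine (Set.finite_Icc m n).subset fun s hs => ?_
  by_contra hc
  rw [Set.mem_Icc, not_and_or, not_le, not_le] at hc
  exact hs (h s hc)

theorem racahTerm_finite_support (r : ℕ) (f₀ f₁ f₂ f₃ g₁ g₂ g₃ : ℤ) :
    (racahTerm r f₀ f₁ f₂ f₃ g₁ g₂ g₃).support.Finite :=
  finite_support_of_Icc f₀ g₁ fun s hs => racahTerm_eq_zero r (by tauto)

theorem racahSum_eq_zero (r : ℕ) {f₀ f₁ f₂ f₃ g₁ g₂ g₃ : ℤ}
    (h : ∀ s, f₀ ≤ s → f₁ ≤ s → f₂ ≤ s → f₃ ≤ s → s ≤ g₁ → s ≤ g₂ → s ≤ g₃ → False) :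
    racahSum r f₀ f₁ f₂ f₃ g₁ g₂ g₃ = 0 := by
  rw [racahSum, ← finsum_zero (α := ℤ)]
  congr 1
  ext s
  refine racahTerm_eq_zero r ?_
  by_contra hc
  push Not at hc
  obtain ⟨h0, h1, h2, h3, h4, h5, h6⟩ := hc
  exact h s h0 h1 h2 h3 h4 h5 h6

/-- Every remaining summand has the factor `[s+1]!`, which contains `[r] = 0`. -/
theorem racahSum_eq_zero_of_le {r : ℕ} (hr : 3 ≤ r) {f₀ f₁ f₂ f₃ g₁ g₂ g₃ : ℤ}
    (h : ∀ s, f₀ ≤ s → f₁ ≤ s → f₂ ≤ s → f₃ ≤ s → (r : ℤ) ≤ s + 1) :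
    racahSum r f₀ f₁ f₂ f₃ g₁ g₂ g₃ = 0 := by
  rw [racahSum, ← finsum_zero (α := ℤ)]
  congr 1
  ext s
  by_cases hc : s < f₀ ∨ s < f₁ ∨ s < f₂ ∨ s < f₃
  · exact racahTerm_eq_zero r (by tauto)
  · push Not at hc
    have := h s hc.1 hc.2.1 hc.2.2.1 hc.2.2.2
    rw [racahTerm, qFact_eq_zero hr (by omega)]
    ring

theorem finsum_telescope {G : ℤ → ℂ} (hG : G.support.Finite) :
    ∑ᶠ s : ℤ, (G s - G (s + 1)) = 0 := by
  have h1 : ∑ᶠ s : ℤ, G (s + 1) = ∑ᶠ s : ℤ, G s :=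
    finsum_comp_equiv (Equiv.addRight (1 : ℤ)) (f := G)
  have h2 : (fun s : ℤ => G (s + 1)).support.Finite :=
    hG.preimage (f := fun s : ℤ => s + 1) (Set.injOn_of_injective (add_left_injective 1))
  rw [finsum_sub_distrib hG h2, h1, sub_self]

/-- Summation of a three-term relation with telescoping right hand side. -/
theorem three_term_of_telescope {t₁ t₂ t₃ G : ℤ → ℂ} (h₁ : t₁.support.Finite)
    (h₂ : t₂.support.Finite) (h₃ : t₃.support.Finite) (hG : G.support.Finite) (A B D : ℂ)
    (h : ∀ s, A * t₁ s - B * t₂ s + D * t₃ s = G s - G (s + 1)) :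
    A * ∑ᶠ s, t₁ s = B * ∑ᶠ s, t₂ s - D * ∑ᶠ s, t₃ s := by
  have m : ∀ (x : ℂ) {t : ℤ → ℂ}, t.support.Finite → (fun s => x * t s).support.Finite :=
    fun x t ht => ht.subset fun s hs h0 => hs (by simp only [h0, mul_zero])
  have h' := finsum_telescope hG
  simp_rw [← h] at h'
  rw [finsum_add_distrib ((m A h₁ |>.union (m B h₂)).subset (Function.support_sub _ _)) (m D h₃),
    finsum_sub_distrib (m A h₁) (m B h₂), ← mul_finsum t₁ A, ← mul_finsum t₂ B,
    ← mul_finsum t₃ D] at h'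
  linear_combination h'

theorem qBr_eq_div (r : ℕ) (n : ℤ) :
    qBr r n = (q r ^ n - (q r ^ n)⁻¹) / (q r - (q r)⁻¹) := by
  rw [qBr, zpow_neg]

/-- The certificate for the telescoping in `racahSum_up_up`: what remains of the relation between
summands once their common factor is divided out. After elimination of `g₃` it is an identity of
Laurent polynomials in independent powers of `q`. The next two identities play the same role. -/
theorem qBr_identity_up_up {r : ℕ} (f₀ f₁ f₂ f₃ g₁ g₂ g₃ s : ℤ)
    (h : g₁ + g₂ + g₃ = f₀ + f₁ + f₂ + f₃) :
    qBr r (f₂ + f₃ - g₃ + 1) * qBr r (g₃ - f₀) * qBr r (s + 1) * qBr r (s - f₁ + 1) -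
      qBr r (g₁ - f₁ + 1) * qBr r (g₂ - f₁ + 1) * qBr r (s + 1) * qBr r (g₃ - s) -
      qBr r (f₂ + 1) * qBr r (f₃ + 1) * qBr r (s - f₀) * qBr r (s - f₁ + 1) =
    -(qBr r (s - f₀) * qBr r (s - f₁ + 1) * qBr r (s - f₂) * qBr r (s - f₃) +
      qBr r (s + 1) * qBr r (g₁ - s) * qBr r (g₂ - s) * qBr r (g₃ - s)) := by
  obtain rfl : g₃ = f₀ + f₁ + f₂ + f₃ - g₁ - g₂ := by omega
  have hq := q_ne_zero r
  simp only [qBr_eq_div, zpow_add₀ hq, zpow_sub₀ hq, zpow_one]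
  have h0 := zpow_ne_zero f₀ hq
  have h1 := zpow_ne_zero f₁ hq
  have h2 := zpow_ne_zero f₂ hq
  have h3 := zpow_ne_zero f₃ hq
  have h4 := zpow_ne_zero g₁ hq
  have h5 := zpow_ne_zero g₂ hq
  have h6 := zpow_ne_zero s hq
  generalize q r ^ f₀ = x₀ at *
  generalize q r ^ f₁ = x₁ at *
  generalize q r ^ f₂ = x₂ at *
  generalize q r ^ f₃ = x₃ at *
  generalize q r ^ g₁ = y₁ at *
  generalize q r ^ g₂ = y₂ at *
  generalize q r ^ s = z at *
  -- Every term is a product of four quantum integers, so both sides have the denominator `(q -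
  -- q⁻¹)⁴` and only the numerators need to be compared.
  simp only [div_mul_div_comm, ← sub_div, ← add_div, ← neg_div]
  congr 1
  field_simp
  ring

theorem qBr_identity_down_down {r : ℕ} (f₀ f₁ f₂ f₃ g₁ g₂ g₃ s : ℤ)
    (h : g₁ + g₂ + g₃ = f₀ + f₁ + f₂ + f₃) :
    -(qBr r (f₂ + f₃ - g₃ + 1) * qBr r (f₁ + 2)) * qBr r (s - f₀ + 1) * qBr r (g₃ - s + 1) +
      qBr r (g₂ - f₀ + 1) * qBr r (g₁ - f₀ + 1) * qBr r (s + 2) * qBr r (g₃ - s + 1) +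
      qBr r (g₃ - f₃ + 1) * qBr r (g₃ - f₂ + 1) * qBr r (s - f₀ + 1) * qBr r (s - f₁) =
    qBr r (s - f₀ + 1) * qBr r (s - f₁) * qBr r (s - f₂) * qBr r (s - f₃) +
      qBr r (s + 2) * qBr r (g₁ - s) * qBr r (g₂ - s) * qBr r (g₃ - s + 1) := by
  obtain rfl : g₃ = f₀ + f₁ + f₂ + f₃ - g₁ - g₂ := by omega
  have hq := q_ne_zero r
  simp only [qBr_eq_div, zpow_add₀ hq, zpow_sub₀ hq, zpow_ofNat]
  have h0 := zpow_ne_zero f₀ hq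
  have h1 := zpow_ne_zero f₁ hq
  have h2 := zpow_ne_zero f₂ hq
  have h3 := zpow_ne_zero f₃ hq
  have h4 := zpow_ne_zero g₁ hq
  have h5 := zpow_ne_zero g₂ hq
  have h6 := zpow_ne_zero s hq
  generalize q r ^ f₀ = x₀ at *
  generalize q r ^ f₁ = x₁ at *
  generalize q r ^ f₂ = x₂ at *
  generalize q r ^ f₃ = x₃ at *
  generalize q r ^ g₁ = y₁ at *
  generalize q r ^ g₂ = y₂ at *
  generalize q r ^ s = z at *
  simp only [div_mul_div_comm, ← add_div, ← neg_div]
  congr 1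
  field_simp
  ring

theorem qBr_identity_up_down {r : ℕ} (f₀ f₁ f₂ f₃ g₁ g₂ g₃ s : ℤ)
    (h : g₁ + g₂ + g₃ = f₀ + f₁ + f₂ + f₃) :
    qBr r (f₂ + f₃ - g₃ + 1) * qBr r (g₂ - f₃) * qBr r (s - f₂ + 1) * qBr r (g₁ - s + 1) -
      qBr r (g₁ - f₁ + 1) * qBr r (g₁ - f₀ + 1) * qBr r (s - f₂ + 1) * qBr r (s - f₃) -
      qBr r (f₂ + 1) * qBr r (g₃ - f₂ + 1) * qBr r (g₁ - s + 1) * qBr r (g₂ - s) =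
    -(qBr r (s - f₀) * qBr r (s - f₁) * qBr r (s - f₂ + 1) * qBr r (s - f₃) +
      qBr r (s + 2) * qBr r (g₁ - s + 1) * qBr r (g₂ - s) * qBr r (g₃ - s)) := by
  obtain rfl : g₃ = f₀ + f₁ + f₂ + f₃ - g₁ - g₂ := by omega
  have hq := q_ne_zero r
  simp only [qBr_eq_div, zpow_add₀ hq, zpow_sub₀ hq, zpow_ofNat]
  have h0 := zpow_ne_zero f₀ hq
  have h1 := zpow_ne_zero f₁ hq
  have h2 := zpow_ne_zero f₂ hq
  have h3 := zpow_ne_zero f₃ hq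
  have h4 := zpow_ne_zero g₁ hq
  have h5 := zpow_ne_zero g₂ hq
  have h6 := zpow_ne_zero s hq
  generalize q r ^ f₀ = x₀ at *
  generalize q r ^ f₁ = x₁ at *
  generalize q r ^ f₂ = x₂ at *
  generalize q r ^ f₃ = x₃ at *
  generalize q r ^ g₁ = y₁ at *
  generalize q r ^ g₂ = y₂ at *
  generalize q r ^ s = z at *
  simp only [div_mul_div_comm, ← sub_div, ← add_div, ← neg_div]
  congr 1
  field_simp
  ring

/-- Creative telescoping: the combination of the three summands equals `G s - G (s + 1)` for an
explicit `G` of finite support, so its sum over all integers vanishes. The sum on the left belongs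
to the target of a step that raises both `a` and `b`. -/
theorem racahSum_up_up {r : ℕ} (hr : 3 ≤ r) {f₀ f₁ f₂ f₃ g₁ g₂ g₃ : ℤ}
    (h : g₁ + g₂ + g₃ = f₀ + f₁ + f₂ + f₃) (h0 : 0 ≤ f₀)
    (hb : ∀ s, f₀ ≤ s → f₁ - 1 ≤ s → f₂ ≤ s → f₃ ≤ s → s ≤ g₁ → s ≤ g₂ → s ≤ g₃ →
      s - f₀ ≤ r - 1 ∧ s - f₁ + 1 ≤ r - 1 ∧ s - f₂ ≤ r - 1 ∧ s - f₃ ≤ r - 1 ∧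
        g₁ - s ≤ r - 1 ∧ g₂ - s ≤ r - 1 ∧ g₃ - s ≤ r - 1) :
    qBr r (f₂ + f₃ - g₃ + 1) * qBr r (g₃ - f₀) * racahSum r f₀ f₁ f₂ f₃ g₁ g₂ g₃ =
      qBr r (g₁ - f₁ + 1) * qBr r (g₂ - f₁ + 1) *
        racahSum r f₀ (f₁ - 1) f₂ f₃ g₁ g₂ (g₃ - 1) -
      qBr r (f₂ + 1) * qBr r (f₃ + 1) *
        racahSum r f₀ (f₁ - 1) (f₂ - 1) (f₃ - 1) (g₁ - 1) (g₂ - 1) (g₃ - 1) := by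
  -- The arguments are chosen so that `G s`, `G (s + 1)` and the three summands are all multiples of
  -- one product `W` by quantum integers.
  set G : ℤ → ℂ := fun s => -((-1) ^ s * qFact r s.toNat *
    (qInvFact r (s - f₀ - 1) * qInvFact r (s - f₁) * qInvFact r (s - f₂ - 1) *
      qInvFact r (s - f₃ - 1)) *
    (qInvFact r (g₁ - s) * qInvFact r (g₂ - s) * qInvFact r (g₃ - s))) with hG
  -- In the third sum every bound except `f₀` is lower by one, so its term at `s - 1` matches the
  -- other two at `s`.
  have hshift : racahSum r f₀ (f₁ - 1) (f₂ - 1) (f₃ - 1) (g₁ - 1) (g₂ - 1) (g₃ - 1) =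
      ∑ᶠ s : ℤ, racahTerm r f₀ (f₁ - 1) (f₂ - 1) (f₃ - 1) (g₁ - 1) (g₂ - 1) (g₃ - 1) (s - 1) :=
    (finsum_comp_equiv (Equiv.subRight (1 : ℤ))).symm
  rw [hshift, racahSum, racahSum]
  refine three_term_of_telescope (G := G) (racahTerm_finite_support ..)
    (racahTerm_finite_support ..)
    (finite_support_of_Icc f₀ g₁ fun s hs => racahTerm_eq_zero r (by omega))
    (finite_support_of_Icc f₀ g₁ fun s hs => ?_) _ _ _ fun s => ?_
  · rcases hs with hs | hs
    · simp [hG, qInvFact_of_neg r (show s - f₀ - 1 < 0 by omega)]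
    · simp [hG, qInvFact_of_neg r (show g₁ - s < 0 by omega)]
  by_cases hs : f₀ ≤ s ∧ f₁ - 1 ≤ s ∧ f₂ ≤ s ∧ f₃ ≤ s ∧ s ≤ g₁ ∧ s ≤ g₂ ∧ s ≤ g₃
  · obtain ⟨s0, s1, s2, s3, s4, s5, s6⟩ := hs
    obtain ⟨b0, b1, b2, b3, b4, b5, b6⟩ := hb s s0 s1 s2 s3 s4 s5 s6
    have e0 := qInvFact_pred hr b0
    have e1 := qInvFact_pred hr b1
    have e2 := qInvFact_pred hr b2
    have e3 := qInvFact_pred hr b3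
    have e4 := qInvFact_pred hr b4
    have e5 := qInvFact_pred hr b5
    have e6 := qInvFact_pred hr b6
    have e7 := qFact_toNat_succ r (show 0 ≤ s by omega)
    set W : ℂ := (-1) ^ s * qFact r s.toNat *
      (qInvFact r (s - f₀) * qInvFact r (s - f₁ + 1) * qInvFact r (s - f₂) * qInvFact r (s - f₃)) *
      (qInvFact r (g₁ - s) * qInvFact r (g₂ - s) * qInvFact r (g₃ - s)) with hW
    have t1 : racahTerm r f₀ f₁ f₂ f₃ g₁ g₂ g₃ s = qBr r (s + 1) * qBr r (s - f₁ + 1) * W := by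
      rw [racahTerm, show s - f₁ = s - f₁ + 1 - 1 by ring, e1, e7, hW]
      ring_nf
    have t2 : racahTerm r f₀ (f₁ - 1) f₂ f₃ g₁ g₂ (g₃ - 1) s =
        qBr r (s + 1) * qBr r (g₃ - s) * W := by
      rw [racahTerm, show s - (f₁ - 1) = s - f₁ + 1 by ring, show g₃ - 1 - s = g₃ - s - 1 by ring,
        e6, e7, hW]
      ring_nf
    have t3 : racahTerm r f₀ (f₁ - 1) (f₂ - 1) (f₃ - 1) (g₁ - 1) (g₂ - 1) (g₃ - 1) (s - 1) =
        -(qBr r (s - f₀) * qBr r (s - f₁ + 1) * W) := by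
      rw [racahTerm, sub_add_cancel, show s - 1 - f₀ = s - f₀ - 1 by ring,
        show s - 1 - (f₁ - 1) = s - f₁ + 1 - 1 by ring, show s - 1 - (f₂ - 1) = s - f₂ by ring,
        show s - 1 - (f₃ - 1) = s - f₃ by ring, show g₁ - 1 - (s - 1) = g₁ - s by ring,
        show g₂ - 1 - (s - 1) = g₂ - s by ring, show g₃ - 1 - (s - 1) = g₃ - s by ring,
        e0, e1, zpow_sub_one₀ (by norm_num), hW]
      ring_nf
    have t4 : G s =
        -(qBr r (s - f₀) * qBr r (s - f₁ + 1) * qBr r (s - f₂) * qBr r (s - f₃) * W) := by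
      simp only [hG]
      rw [show s - f₁ = s - f₁ + 1 - 1 by ring, e0, e1, e2, e3, hW]
      ring_nf
    have t5 : G (s + 1) = qBr r (s + 1) * qBr r (g₁ - s) * qBr r (g₂ - s) * qBr r (g₃ - s) * W := by
      simp only [hG]
      rw [show s + 1 - f₀ - 1 = s - f₀ by ring, show s + 1 - f₁ = s - f₁ + 1 by ring,
        show s + 1 - f₂ - 1 = s - f₂ by ring, show s + 1 - f₃ - 1 = s - f₃ by ring,
        show g₁ - (s + 1) = g₁ - s - 1 by ring, show g₂ - (s + 1) = g₂ - s - 1 by ring,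
        show g₃ - (s + 1) = g₃ - s - 1 by ring, e4, e5, e6, e7,
        zpow_add_one₀ (by norm_num), hW]
      ring_nf
    rw [t1, t2, t3, t4, t5]
    linear_combination W * qBr_identity_up_up (r := r) f₀ f₁ f₂ f₃ g₁ g₂ g₃ s h
  -- Outside the joint range some argument of `qInvFact` is negative in each of the five terms.
  · rw [racahTerm_eq_zero r (by omega), racahTerm_eq_zero r (by omega),
      racahTerm_eq_zero r (by omega)]
    have z : ∀ t, t = s ∨ t = s + 1 → G t = 0 := by
      intro t ht
      have : t - f₀ - 1 < 0 ∨ t - f₁ < 0 ∨ t - f₂ - 1 < 0 ∨ t - f₃ - 1 < 0 ∨ g₁ - t < 0 ∨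
        g₂ - t < 0 ∨ g₃ - t < 0 := by omega
      rcases this with h | h | h | h | h | h | h <;> simp [hG, qInvFact_of_neg r h]
    rw [z s (Or.inl rfl), z (s + 1) (Or.inr rfl)]
    ring

/-- The relation for a step that lowers both `a` and `b`, again by telescoping. Now the bounds that
move up are those of the second term, which is reindexed. -/
theorem racahSum_down_down {r : ℕ} (hr : 3 ≤ r) {f₀ f₁ f₂ f₃ g₁ g₂ g₃ : ℤ}
    (h : g₁ + g₂ + g₃ = f₀ + f₁ + f₂ + f₃) (h0 : 0 ≤ f₀)
    (hb : ∀ s, f₀ - 1 ≤ s → f₁ ≤ s → f₂ ≤ s → f₃ ≤ s → s ≤ g₁ → s ≤ g₂ → s ≤ g₃ + 1 →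
      s - f₀ + 1 ≤ r - 1 ∧ s - f₁ ≤ r - 1 ∧ s - f₂ ≤ r - 1 ∧ s - f₃ ≤ r - 1 ∧
        g₁ - s ≤ r - 1 ∧ g₂ - s ≤ r - 1 ∧ g₃ - s + 1 ≤ r - 1) :
    -(qBr r (f₂ + f₃ - g₃ + 1) * qBr r (f₁ + 2)) * racahSum r f₀ f₁ f₂ f₃ g₁ g₂ g₃ =
      qBr r (g₂ - f₀ + 1) * qBr r (g₁ - f₀ + 1) *
        racahSum r f₀ (f₁ + 1) (f₂ + 1) (f₃ + 1) (g₁ + 1) (g₂ + 1) (g₃ + 1) -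
      qBr r (g₃ - f₃ + 1) * qBr r (g₃ - f₂ + 1) *
        racahSum r f₀ (f₁ + 1) f₂ f₃ g₁ g₂ (g₃ + 1) := by
  set G : ℤ → ℂ := fun s => ((-1) ^ s * qFact r (s + 1).toNat *
    (qInvFact r (s - f₀) * qInvFact r (s - f₁ - 1) * qInvFact r (s - f₂ - 1) *
      qInvFact r (s - f₃ - 1)) *
    (qInvFact r (g₁ - s) * qInvFact r (g₂ - s) * qInvFact r (g₃ - s + 1))) with hG
  have hshift : racahSum r f₀ (f₁ + 1) (f₂ + 1) (f₃ + 1) (g₁ + 1) (g₂ + 1) (g₃ + 1) =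
      ∑ᶠ s : ℤ, racahTerm r f₀ (f₁ + 1) (f₂ + 1) (f₃ + 1) (g₁ + 1) (g₂ + 1) (g₃ + 1) (s + 1) :=
    (finsum_comp_equiv (Equiv.addRight (1 : ℤ))).symm
  rw [hshift, racahSum, racahSum]
  refine three_term_of_telescope (G := G) (racahTerm_finite_support ..)
    (finite_support_of_Icc f₁ g₁ fun s hs => racahTerm_eq_zero r (by omega))
    (racahTerm_finite_support ..)
    (finite_support_of_Icc f₀ g₁ fun s hs => ?_) _ _ _ fun s => ?_
  · rcases hs with hs | hs
    · simp [hG, qInvFact_of_neg r (show s - f₀ < 0 by omega)]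
    · simp [hG, qInvFact_of_neg r (show g₁ - s < 0 by omega)]
  by_cases hs : f₀ - 1 ≤ s ∧ f₁ ≤ s ∧ f₂ ≤ s ∧ f₃ ≤ s ∧ s ≤ g₁ ∧ s ≤ g₂ ∧ s ≤ g₃ + 1
  · obtain ⟨s0, s1, s2, s3, s4, s5, s6⟩ := hs
    obtain ⟨b0, b1, b2, b3, b4, b5, b6⟩ := hb s s0 s1 s2 s3 s4 s5 s6
    have e0 := qInvFact_pred hr b0
    have e1 := qInvFact_pred hr b1
    have e2 := qInvFact_pred hr b2
    have e3 := qInvFact_pred hr b3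
    have e4 := qInvFact_pred hr b4
    have e5 := qInvFact_pred hr b5
    have e6 := qInvFact_pred hr b6
    have e7 := qFact_toNat_succ r (show 0 ≤ s + 1 by omega)
    rw [show s + 1 + 1 = s + 2 by ring] at e7
    set W : ℂ := (-1) ^ s * qFact r (s + 1).toNat *
      (qInvFact r (s - f₀ + 1) * qInvFact r (s - f₁) * qInvFact r (s - f₂) * qInvFact r (s - f₃)) *
      (qInvFact r (g₁ - s) * qInvFact r (g₂ - s) * qInvFact r (g₃ - s + 1)) with hW
    have t1 : racahTerm r f₀ f₁ f₂ f₃ g₁ g₂ g₃ s =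
        qBr r (s - f₀ + 1) * qBr r (g₃ - s + 1) * W := by
      rw [racahTerm, show s - f₀ = s - f₀ + 1 - 1 by ring, show g₃ - s = g₃ - s + 1 - 1 by ring,
        e0, e6, hW]
      ring_nf
    have t2 : racahTerm r f₀ (f₁ + 1) (f₂ + 1) (f₃ + 1) (g₁ + 1) (g₂ + 1) (g₃ + 1) (s + 1) =
        -(qBr r (s + 2) * qBr r (g₃ - s + 1) * W) := by
      rw [racahTerm, show s + 1 + 1 = s + 2 by ring, show s + 1 - f₀ = s - f₀ + 1 by ring,
        show s + 1 - (f₁ + 1) = s - f₁ by ring, show s + 1 - (f₂ + 1) = s - f₂ by ring,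
        show s + 1 - (f₃ + 1) = s - f₃ by ring, show g₁ + 1 - (s + 1) = g₁ - s by ring,
        show g₂ + 1 - (s + 1) = g₂ - s by ring,
        show g₃ + 1 - (s + 1) = g₃ - s + 1 - 1 by ring,
        e6, e7, zpow_add_one₀ (by norm_num), hW]
      ring_nf
    have t3 : racahTerm r f₀ (f₁ + 1) f₂ f₃ g₁ g₂ (g₃ + 1) s =
        qBr r (s - f₀ + 1) * qBr r (s - f₁) * W := by
      rw [racahTerm, show s - f₀ = s - f₀ + 1 - 1 by ring, show s - (f₁ + 1) = s - f₁ - 1 by ring,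
        show g₃ + 1 - s = g₃ - s + 1 by ring, e0, e1, hW]
      ring_nf
    have t4 : G s =
        qBr r (s - f₀ + 1) * qBr r (s - f₁) * qBr r (s - f₂) * qBr r (s - f₃) * W := by
      simp only [hG]
      rw [show s - f₀ = s - f₀ + 1 - 1 by ring, e0, e1, e2, e3, hW]
      ring_nf
    have t5 : G (s + 1) =
        -(qBr r (s + 2) * qBr r (g₁ - s) * qBr r (g₂ - s) * qBr r (g₃ - s + 1) * W) := by
      simp only [hG]
      rw [show s + 1 + 1 = s + 2 by ring, show s + 1 - f₀ = s - f₀ + 1 by ring,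
        show s + 1 - f₁ - 1 = s - f₁ by ring,
        show s + 1 - f₂ - 1 = s - f₂ by ring, show s + 1 - f₃ - 1 = s - f₃ by ring,
        show g₁ - (s + 1) = g₁ - s - 1 by ring, show g₂ - (s + 1) = g₂ - s - 1 by ring,
        show g₃ - (s + 1) + 1 = g₃ - s + 1 - 1 by ring, e4, e5, e6, e7,
        zpow_add_one₀ (by norm_num), hW]
      ring_nf
    rw [t1, t2, t3, t4, t5]
    linear_combination W * qBr_identity_down_down (r := r) f₀ f₁ f₂ f₃ g₁ g₂ g₃ s h
  · rw [racahTerm_eq_zero r (by omega), racahTerm_eq_zero r (by omega),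
      racahTerm_eq_zero r (by omega)]
    have z : ∀ t, t = s ∨ t = s + 1 → G t = 0 := by
      intro t ht
      have : t - f₀ < 0 ∨ t - f₁ - 1 < 0 ∨ t - f₂ - 1 < 0 ∨ t - f₃ - 1 < 0 ∨ g₁ - t < 0 ∨
        g₂ - t < 0 ∨ g₃ - t + 1 < 0 := by omega
      rcases this with h | h | h | h | h | h | h <;> simp [hG, qInvFact_of_neg r h]
    rw [z s (Or.inl rfl), z (s + 1) (Or.inr rfl)]
    ring

/-- The relation for a step that raises `a` and lowers `b`; the summands are already aligned. The
opposite mixed step follows from it by the reflection `racahSum_swap`. -/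
theorem racahSum_up_down {r : ℕ} (hr : 3 ≤ r) {f₀ f₁ f₂ f₃ g₁ g₂ g₃ : ℤ}
    (h : g₁ + g₂ + g₃ = f₀ + f₁ + f₂ + f₃) (h0 : 0 ≤ f₀)
    (hb : ∀ s, f₀ ≤ s → f₁ ≤ s → f₂ - 1 ≤ s → f₃ ≤ s → s ≤ g₁ + 1 → s ≤ g₂ → s ≤ g₃ →
      s - f₀ ≤ r - 1 ∧ s - f₁ ≤ r - 1 ∧ s - f₂ + 1 ≤ r - 1 ∧ s - f₃ ≤ r - 1 ∧
        g₁ - s + 1 ≤ r - 1 ∧ g₂ - s ≤ r - 1 ∧ g₃ - s ≤ r - 1) :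
    qBr r (f₂ + f₃ - g₃ + 1) * qBr r (g₂ - f₃) * racahSum r f₀ f₁ f₂ f₃ g₁ g₂ g₃ =
      qBr r (g₁ - f₁ + 1) * qBr r (g₁ - f₀ + 1) *
        racahSum r f₀ f₁ f₂ (f₃ + 1) (g₁ + 1) g₂ g₃ -
      -(qBr r (f₂ + 1) * qBr r (g₃ - f₂ + 1)) *
        racahSum r f₀ f₁ (f₂ - 1) f₃ g₁ (g₂ - 1) g₃ := by
  set G : ℤ → ℂ := fun s => -((-1) ^ s * qFact r (s + 1).toNat *
    (qInvFact r (s - f₀ - 1) * qInvFact r (s - f₁ - 1) * qInvFact r (s - f₂) *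
      qInvFact r (s - f₃ - 1)) *
    (qInvFact r (g₁ - s + 1) * qInvFact r (g₂ - s) * qInvFact r (g₃ - s))) with hG
  rw [racahSum, racahSum, racahSum]
  refine three_term_of_telescope (G := G) (racahTerm_finite_support ..)
    (racahTerm_finite_support ..) (racahTerm_finite_support ..)
    (finite_support_of_Icc f₀ g₂ fun s hs => ?_) _ _ _ fun s => ?_
  · rcases hs with hs | hs
    · simp [hG, qInvFact_of_neg r (show s - f₀ - 1 < 0 by omega)]
    · simp [hG, qInvFact_of_neg r (show g₂ - s < 0 by omega)]
  by_cases hs : f₀ ≤ s ∧ f₁ ≤ s ∧ f₂ - 1 ≤ s ∧ f₃ ≤ s ∧ s ≤ g₁ + 1 ∧ s ≤ g₂ ∧ s ≤ g₃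
  · obtain ⟨s0, s1, s2, s3, s4, s5, s6⟩ := hs
    obtain ⟨b0, b1, b2, b3, b4, b5, b6⟩ := hb s s0 s1 s2 s3 s4 s5 s6
    have e0 := qInvFact_pred hr b0
    have e1 := qInvFact_pred hr b1
    have e2 := qInvFact_pred hr b2
    have e3 := qInvFact_pred hr b3
    have e4 := qInvFact_pred hr b4
    have e5 := qInvFact_pred hr b5
    have e6 := qInvFact_pred hr b6
    have e7 := qFact_toNat_succ r (show 0 ≤ s + 1 by omega)
    rw [show s + 1 + 1 = s + 2 by ring] at e7
    set W : ℂ := (-1) ^ s * qFact r (s + 1).toNat *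
      (qInvFact r (s - f₀) * qInvFact r (s - f₁) * qInvFact r (s - f₂ + 1) * qInvFact r (s - f₃)) *
      (qInvFact r (g₁ - s + 1) * qInvFact r (g₂ - s) * qInvFact r (g₃ - s)) with hW
    have t1 : racahTerm r f₀ f₁ f₂ f₃ g₁ g₂ g₃ s =
        qBr r (s - f₂ + 1) * qBr r (g₁ - s + 1) * W := by
      rw [racahTerm, show s - f₂ = s - f₂ + 1 - 1 by ring, show g₁ - s = g₁ - s + 1 - 1 by ring,
        e2, e4, hW]
      ring_nf
    have t2 : racahTerm r f₀ f₁ f₂ (f₃ + 1) (g₁ + 1) g₂ g₃ s =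
        qBr r (s - f₂ + 1) * qBr r (s - f₃) * W := by
      rw [racahTerm, show s - f₂ = s - f₂ + 1 - 1 by ring, show s - (f₃ + 1) = s - f₃ - 1 by ring,
        show g₁ + 1 - s = g₁ - s + 1 by ring, e2, e3, hW]
      ring_nf
    have t3 : racahTerm r f₀ f₁ (f₂ - 1) f₃ g₁ (g₂ - 1) g₃ s =
        qBr r (g₁ - s + 1) * qBr r (g₂ - s) * W := by
      rw [racahTerm, show s - (f₂ - 1) = s - f₂ + 1 by ring, show g₁ - s = g₁ - s + 1 - 1 by ring,
        show g₂ - 1 - s = g₂ - s - 1 by ring, e4, e5, hW]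
      ring_nf
    have t4 : G s =
        -(qBr r (s - f₀) * qBr r (s - f₁) * qBr r (s - f₂ + 1) * qBr r (s - f₃) * W) := by
      simp only [hG]
      rw [show s - f₂ = s - f₂ + 1 - 1 by ring, e0, e1, e2, e3, hW]
      ring_nf
    have t5 : G (s + 1) =
        qBr r (s + 2) * qBr r (g₁ - s + 1) * qBr r (g₂ - s) * qBr r (g₃ - s) * W := by
      simp only [hG]
      rw [show s + 1 + 1 = s + 2 by ring, show s + 1 - f₀ - 1 = s - f₀ by ring,
        show s + 1 - f₁ - 1 = s - f₁ by ring,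
        show s + 1 - f₂ = s - f₂ + 1 by ring, show s + 1 - f₃ - 1 = s - f₃ by ring,
        show g₁ - (s + 1) + 1 = g₁ - s + 1 - 1 by ring,
        show g₂ - (s + 1) = g₂ - s - 1 by ring,
        show g₃ - (s + 1) = g₃ - s - 1 by ring, e4, e5, e6, e7,
        zpow_add_one₀ (by norm_num), hW]
      ring_nf
    rw [t1, t2, t3, t4, t5]
    linear_combination W * qBr_identity_up_down (r := r) f₀ f₁ f₂ f₃ g₁ g₂ g₃ s h
  · rw [racahTerm_eq_zero r (by omega), racahTerm_eq_zero r (by omega),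
      racahTerm_eq_zero r (by omega)]
    have z : ∀ t, t = s ∨ t = s + 1 → G t = 0 := by
      intro t ht
      have : t - f₀ - 1 < 0 ∨ t - f₁ - 1 < 0 ∨ t - f₂ < 0 ∨ t - f₃ - 1 < 0 ∨ g₁ - t + 1 < 0 ∨
        g₂ - t < 0 ∨ g₃ - t < 0 := by omega
      rcases this with h | h | h | h | h | h | h <;> simp [hG, qInvFact_of_neg r h]
    rw [z s (Or.inl rfl), z (s + 1) (Or.inr rfl)]
    ring

theorem racahSum_swap (r : ℕ) (f₀ f₁ f₂ f₃ g₁ g₂ g₃ : ℤ) :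
    racahSum r f₀ f₁ f₃ f₂ g₂ g₁ g₃ = racahSum r f₀ f₁ f₂ f₃ g₁ g₂ g₃ := by
  unfold racahSum
  congr 1
  ext s
  simp only [racahTerm]
  ring

/-! ### The tetrahedral network as a function of integers -/

/-- Admissibility of a triple of integers (doubled spins). -/
def AdmissibleZ (r : ℕ) (a b c : ℤ) : Prop :=
  a ≤ b + c ∧ b ≤ a + c ∧ c ≤ a + b ∧ Even (a + b + c) ∧ a + b + c ≤ 2 * ((r : ℤ) - 2)

theorem AdmissibleZ.exists_half {r : ℕ} {a b c : ℤ} (h : AdmissibleZ r a b c) :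
    ∃ s, a + b + c = 2 * s ∧ a ≤ s ∧ b ≤ s ∧ c ≤ s ∧ s ≤ r - 2 := by
  obtain ⟨h1, h2, h3, ⟨s, hs⟩, h5⟩ := h
  exact ⟨s, by omega, by omega, by omega, by omega, by omega⟩

theorem AdmissibleZ.swap {r : ℕ} {a b c : ℤ} (h : AdmissibleZ r a b c) : AdmissibleZ r b a c := by
  obtain ⟨h1, h2, h3, ⟨s, hs⟩, h5⟩ := h
  exact ⟨h2, h1, by omega, ⟨s, by omega⟩, by omega⟩

/-- The Racah sum of the tetrahedron with base edges `j`, `k`, `l` and with edges `a`, `b`, `c` from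
the apex, whose faces are `(j, k, l)`, `(a, b, j)`, `(a, c, l)` and `(b, c, k)`. -/
def racahTet (r : ℕ) (j k l a b c : ℤ) : ℂ :=
  racahSum r ((j + k + l) / 2) ((a + b + j) / 2) ((a + c + l) / 2) ((b + c + k) / 2)
    ((b + c + j + l) / 2) ((a + c + j + k) / 2) ((a + b + k + l) / 2)

theorem racahTet_eq (r : ℕ) {j k l a b c f₀ f₁ f₂ f₃ g₁ g₂ g₃ : ℤ} (h0 : j + k + l = 2 * f₀)
    (h1 : a + b + j = 2 * f₁) (h2 : a + c + l = 2 * f₂) (h3 : b + c + k = 2 * f₃)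
    (h4 : f₁ + f₂ - a = g₁) (h5 : f₁ + f₃ - b = g₂) (h6 : f₂ + f₃ - c = g₃) :
    racahTet r j k l a b c = racahSum r f₀ f₁ f₂ f₃ g₁ g₂ g₃ := by
  unfold racahTet
  congr 1 <;> omega

theorem racahTet_swap (r : ℕ) (j k l a b c : ℤ) :
    racahTet r j l k b a c = racahTet r j k l a b c := by
  unfold racahTet
  rw [← racahSum_swap]
  congr 1 <;> omega

/-- The coefficients of the moves `(a, b) → (a ± 1, b ± 1)`. -/
def stepCoeff (r : ℕ) (w a b a' b' : ℤ) : ℂ :=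
  if a' = a + 1 then
    if b' = b + 1 then -qBr r ((a + b + w) / 2 + 2) else qBr r ((b + w - a) / 2)
  else
    if b' = b + 1 then qBr r ((a + w - b) / 2) else qBr r ((a + b - w) / 2)

/-- The coefficients of the moves `(a, b) → (a ± 1, b ± 1)` in the dual normalization. -/
def stepCoeffDual (r : ℕ) (w a b a' b' : ℤ) : ℂ :=
  if a' = a + 1 then
    if b' = b + 1 then qBr r ((a + b - w) / 2 + 1) else qBr r ((a + w - b) / 2 + 1)
  else
    if b' = b + 1 then qBr r ((b + w - a) / 2 + 1) else -qBr r ((a + b + w) / 2 + 1)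

/-- The Biedenharn-Elliott identity with one label equal to spin 1/2. Admissibility is required only
of the faces common to all terms before or after the step; `(a', b', j)` and the faces containing `c
± 1` may fail it, where a coefficient or a Racah sum then vanishes. -/
theorem racahTet_relation {r : ℕ} (hr : 3 ≤ r) {j k l a b a' b' c : ℤ}
    (hjkl : AdmissibleZ r j k l) (habj : AdmissibleZ r a b j) (hacl : AdmissibleZ r a' c l)
    (hbck : AdmissibleZ r b' c k) (ha : a' = a + 1 ∨ a' = a - 1) (hb : b' = b + 1 ∨ b' = b - 1) :
    qBr r (c + 1) * stepCoeffDual r j a b a' b' * racahTet r j k l a' b' c =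
      stepCoeff r l a (c + 1) a' c * stepCoeff r k b (c + 1) b' c * racahTet r j k l a b (c + 1) -
      stepCoeff r l a (c - 1) a' c * stepCoeff r k b (c - 1) b' c *
        racahTet r j k l a b (c - 1) := by
  obtain ⟨f₀, e0, p01, p02, p03, p0⟩ := hjkl.exists_half
  obtain ⟨s₁, e1, p11, p12, p13, p1⟩ := habj.exists_half
  obtain ⟨f₂, e2, p21, p22, p23, p2⟩ := hacl.exists_half
  obtain ⟨f₃, e3, p31, p32, p33, p3⟩ := hbck.exists_half
  have br : ∀ x y : ℤ, x = y → qBr r x = qBr r y := fun x y h => by rw [h]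
  rcases ha with rfl | rfl <;> rcases hb with rfl | rfl
  -- The bounds are those of the target tetrahedron `(a', b', c)`; its face `(a', b', j)` has
  -- half-sum `s₁ + 1`. The other three cases are set up in the same way.
  · have key := racahSum_up_up hr (f₀ := f₀) (f₁ := s₁ + 1) (f₂ := f₂) (f₃ := f₃)
      (g₁ := s₁ + f₂ - a) (g₂ := s₁ + f₃ - b) (g₃ := f₂ + f₃ - c)
      (by omega) (by omega) (by intros; omega)
    rw [br (f₂ + f₃ - (f₂ + f₃ - c) + 1) (c + 1) (by omega), br (f₂ + f₃ - c - f₀) ((a + b - j) / 2 + 1) (by omega),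
      br (s₁ + f₂ - a - (s₁ + 1) + 1) ((c + 1 + l - a) / 2) (by omega), br (s₁ + f₃ - b - (s₁ + 1) + 1) ((c + 1 + k - b) / 2) (by omega),
      br (f₂ + 1) ((a + (c - 1) + l) / 2 + 2) (by omega),
      br (f₃ + 1) ((b + (c - 1) + k) / 2 + 2) (by omega),
      ← racahTet_eq (j := j) (k := k) (l := l) (a := a + 1) (b := b + 1) (c := c) r,
      ← racahTet_eq (j := j) (k := k) (l := l) (a := a) (b := b) (c := c + 1) r,
      ← racahTet_eq (j := j) (k := k) (l := l) (a := a) (b := b) (c := c - 1) r] at key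
    · simp only [stepCoeff, stepCoeffDual, if_true, show c ≠ c + 1 + 1 by omega, if_false,
        sub_add_cancel]
      linear_combination key
    all_goals omega
  · have key := racahSum_up_down hr (f₀ := f₀) (f₁ := s₁) (f₂ := f₂) (f₃ := f₃)
      (g₁ := s₁ + f₂ - (a + 1)) (g₂ := s₁ + f₃ - (b - 1)) (g₃ := f₂ + f₃ - c)
      (by omega) (by omega) (by intros; omega)
    rw [br (f₂ + f₃ - (f₂ + f₃ - c) + 1) (c + 1) (by omega), br (s₁ + f₃ - (b - 1) - f₃) ((a + j - b) / 2 + 1) (by omega),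
      br (s₁ + f₂ - (a + 1) - s₁ + 1) ((c + 1 + l - a) / 2) (by omega), br (s₁ + f₂ - (a + 1) - f₀ + 1) ((b + (c + 1) - k) / 2) (by omega),
      br (f₂ + 1) ((a + (c - 1) + l) / 2 + 2) (by omega),
      br (f₂ + f₃ - c - f₂ + 1) ((b + k - (c - 1)) / 2) (by omega),
      ← racahTet_eq (j := j) (k := k) (l := l) (a := a + 1) (b := b - 1) (c := c) r,
      ← racahTet_eq (j := j) (k := k) (l := l) (a := a) (b := b) (c := c + 1) r,
      ← racahTet_eq (j := j) (k := k) (l := l) (a := a) (b := b) (c := c - 1) r] at key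
    · simp only [stepCoeff, stepCoeffDual, if_true, show c ≠ c + 1 + 1 by omega, if_false,
        sub_add_cancel, show b - 1 ≠ b + 1 by omega]
      linear_combination key
    all_goals omega
  -- The tetrahedron is reflected, which exchanges `a` with `b` and `k` with `l`, hence `f₂` with
  -- `f₃`.
  · have key := racahSum_up_down hr (f₀ := f₀) (f₁ := s₁) (f₂ := f₃) (f₃ := f₂)
      (g₁ := s₁ + f₃ - (b + 1)) (g₂ := s₁ + f₂ - (a - 1)) (g₃ := f₃ + f₂ - c)
      (by omega) (by omega) (by intros; omega)
    rw [br (f₃ + f₂ - (f₃ + f₂ - c) + 1) (c + 1) (by omega), br (s₁ + f₂ - (a - 1) - f₂) ((b + j - a) / 2 + 1) (by omega),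
      br (s₁ + f₃ - (b + 1) - s₁ + 1) ((c + 1 + k - b) / 2) (by omega), br (s₁ + f₃ - (b + 1) - f₀ + 1) ((a + (c + 1) - l) / 2) (by omega),
      br (f₃ + 1) ((b + (c - 1) + k) / 2 + 2) (by omega),
      br (f₃ + f₂ - c - f₃ + 1) ((a + l - (c - 1)) / 2) (by omega),
      ← racahTet_eq (j := j) (k := l) (l := k) (a := b + 1) (b := a - 1) (c := c) r,
      ← racahTet_eq (j := j) (k := l) (l := k) (a := b) (b := a) (c := c + 1) r,
      ← racahTet_eq (j := j) (k := l) (l := k) (a := b) (b := a) (c := c - 1) r,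
      racahTet_swap r j k l (a - 1) (b + 1) c, racahTet_swap r j k l a b (c + 1),
      racahTet_swap r j k l a b (c - 1)] at key
    · simp only [stepCoeff, stepCoeffDual, if_true, show c ≠ c + 1 + 1 by omega, if_false,
        sub_add_cancel, show a - 1 ≠ a + 1 by omega]
      linear_combination key
    all_goals omega
  · have key := racahSum_down_down hr (f₀ := f₀) (f₁ := s₁ - 1) (f₂ := f₂) (f₃ := f₃)
      (g₁ := s₁ + f₂ - a) (g₂ := s₁ + f₃ - b) (g₃ := f₂ + f₃ - c)
      (by omega) (by omega) (by intros; omega)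
    rw [br (f₂ + f₃ - (f₂ + f₃ - c) + 1) (c + 1) (by omega), br (s₁ - 1 + 2) ((a + b + j) / 2 + 1) (by omega),
      br (s₁ + f₃ - b - f₀ + 1) ((a + (c + 1) - l) / 2) (by omega), br (s₁ + f₂ - a - f₀ + 1) ((b + (c + 1) - k) / 2) (by omega),
      br (f₂ + f₃ - c - f₃ + 1) ((a + l - (c - 1)) / 2) (by omega),
      br (f₂ + f₃ - c - f₂ + 1) ((b + k - (c - 1)) / 2) (by omega),
      ← racahTet_eq (j := j) (k := k) (l := l) (a := a - 1) (b := b - 1) (c := c) r,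
      ← racahTet_eq (j := j) (k := k) (l := l) (a := a) (b := b) (c := c + 1) r,
      ← racahTet_eq (j := j) (k := k) (l := l) (a := a) (b := b) (c := c - 1) r] at key
    · simp only [stepCoeff, stepCoeffDual, if_true, show c ≠ c + 1 + 1 by omega, if_false,
        sub_add_cancel, show b - 1 ≠ b + 1 by omega, show a - 1 ≠ a + 1 by omega]
      linear_combination key
    all_goals omega

/-- If a triangle inequality fails, some lower bound exceeds some upper bound and the sum is empty.
If the level bound fails, some half-sum exceeds `r - 2` and every term contains `[r] = 0`. This
makes the recursion close up at the edge of the admissible region. -/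
theorem racahTet_eq_zero {r : ℕ} (hr : 3 ≤ r) {j k l a b c : ℤ} (h0 : Even (j + k + l))
    (h1 : Even (a + b + j)) (h2 : Even (a + c + l)) (h3 : Even (b + c + k))
    (h : ¬AdmissibleZ r a b j ∨ ¬AdmissibleZ r a c l ∨ ¬AdmissibleZ r b c k) :
    racahTet r j k l a b c = 0 := by
  obtain ⟨f₀, e0⟩ := h0
  obtain ⟨f₁, e1⟩ := h1
  obtain ⟨f₂, e2⟩ := h2
  obtain ⟨f₃, e3⟩ := h3
  have hb : ∀ x y z s : ℤ, x + y + z = s + s → ¬AdmissibleZ r x y z →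
      x > y + z ∨ y > x + z ∨ z > x + y ∨ s > (r : ℤ) - 2 := by
    intro x y z s hs hn
    by_contra hc
    exact hn ⟨by omega, by omega, by omega, ⟨s, hs⟩, by omega⟩
  rw [racahTet_eq r (f₀ := f₀) (by omega) (f₁ := f₁) (by omega) (f₂ := f₂) (by omega) (f₃ := f₃)
    (by omega) rfl rfl rfl]
  by_cases hf : f₁ > (r : ℤ) - 2 ∨ f₂ > (r : ℤ) - 2 ∨ f₃ > (r : ℤ) - 2
  · exact racahSum_eq_zero_of_le hr (by intros; omega)
  · refine racahSum_eq_zero r fun s _ _ _ _ _ _ _ => ?_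
    rcases h with h | h | h
    · have := hb _ _ _ _ e1 h
      omega
    · have := hb _ _ _ _ e2 h
      omega
    · have := hb _ _ _ _ e3 h
      omega

theorem stepCoeff_symm (r : ℕ) (w a b a' b' : ℤ) :
    stepCoeff r w b a b' a' = stepCoeff r w a b a' b' := by
  unfold stepCoeff
  split_ifs <;> simp only [add_comm a b]

/-! ### The weights -/

/-- `[n]!` for an integer `n`. -/
def qFactZ (r : ℕ) (n : ℤ) : ℂ := qFact r n.toNat

/-- The product of the three factorials in the numerator of the theta network. -/
def triFact (r : ℕ) (w a b : ℤ) : ℂ :=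
  qFactZ r ((a + b - w) / 2) * (qFactZ r ((a + w - b) / 2) * qFactZ r ((b + w - a) / 2))

/-- The weight of a triangle with edges `a`, `b`, `w`: the inverse of the theta network, or zero. -/
def edgeWeight (r : ℕ) (w a b : ℤ) : ℂ :=
  if AdmissibleZ r a b w then
    ((-1) ^ ((a + b + w) / 2) * qFactZ r ((a + b + w) / 2 + 1) * triFact r w a b /
      (qFactZ r a * qFactZ r b * qFactZ r w))⁻¹
  else 0

/-- The weight of a tetrahedron, extended by zero. -/
def tetWeight (r : ℕ) (j k l a b c : ℤ) : ℂ :=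
  if AdmissibleZ r a b j ∧ AdmissibleZ r a c l ∧ AdmissibleZ r b c k then
    triFact r j k l * triFact r j a b * triFact r l a c * triFact r k b c /
      (qFactZ r a * qFactZ r b * qFactZ r c * (qFactZ r j * qFactZ r k * qFactZ r l)) *
      racahTet r j k l a b c
  else 0

/-- The weight of a vertex. -/
def vertexWeight (r : ℕ) (a : ℤ) : ℂ := (-1) ^ a * qBr r (a + 1)

/-- The kernel that relates the labels `(a, b)` and `(a ± 1, b ± 1)` of the two edges of a triangle
with base `w`. -/
def stepKernel (r : ℕ) (w a b a' b' : ℤ) : ℂ :=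
  if AdmissibleZ r a b w ∧ AdmissibleZ r a' b' w ∧ (a' = a + 1 ∨ a' = a - 1) ∧
      (b' = b + 1 ∨ b' = b - 1) then
    stepCoeff r w a b a' b' * (triFact r w a' b' / triFact r w a b) *
      ((if b' = b + 1 then -1 else 1) / qBr r (b' + 1)) * (qFactZ r b / qFactZ r b')
  else 0

theorem triFact_symm (r : ℕ) (w a b : ℤ) : triFact r w b a = triFact r w a b := by
  unfold triFact
  rw [add_comm b a]
  ring

theorem AdmissibleZ.bounds {r : ℕ} {a b w : ℤ} (h : AdmissibleZ r a b w) :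
    0 ≤ a ∧ a ≤ r - 2 ∧ 0 ≤ b ∧ b ≤ r - 2 ∧ 0 ≤ w ∧ w ≤ r - 2 := by
  obtain ⟨s, h1, h2, h3, h4, h5⟩ := h.exists_half
  omega

theorem qFactZ_ne_zero {r : ℕ} (hr : 3 ≤ r) {n : ℤ} (h : n < r) : qFactZ r n ≠ 0 :=
  qFact_ne_zero hr (by omega)

theorem qFactZ_succ (r : ℕ) {n : ℤ} (h : 0 ≤ n) : qFactZ r (n + 1) = qBr r (n + 1) * qFactZ r n :=
  qFact_toNat_succ r h

theorem triFact_ne_zero {r : ℕ} (hr : 3 ≤ r) {w a b : ℤ} (h : AdmissibleZ r a b w) :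
    triFact r w a b ≠ 0 := by
  obtain ⟨s, h1, h2, h3, h4, h5⟩ := h.exists_half
  have := h.bounds
  exact mul_ne_zero (qFactZ_ne_zero hr (by omega))
    (mul_ne_zero (qFactZ_ne_zero hr (by omega)) (qFactZ_ne_zero hr (by omega)))

/-- Lets sums over labels be treated as two-term sums even when `c + 1` or `c - 1` is no label:
there `F` vanishes by `hF`. -/
theorem sum_spin_adjacent {r : ℕ} (c : ℤ) (F : ℤ → ℂ) (h : ∀ x, x ≠ c + 1 → x ≠ c - 1 → F x = 0)
    (hF : ∀ x, F x ≠ 0 → 0 ≤ x ∧ x ≤ (r : ℤ) - 2) :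
    ∑ x : Spin r, F (x : ℕ) = F (c + 1) + F (c - 1) := by
  have key : ∀ m : ℤ, ∑ x : Spin r, (if ((x : ℕ) : ℤ) = m then F m else 0) = F m := by
    intro m
    by_cases hm : F m = 0
    · simp [hm]
    · have := hF m hm
      rw [Finset.sum_eq_single (⟨m.toNat, by omega⟩ : Spin r)]
      · rw [if_pos (by simp; omega)]
      · intro b _ hb
        rw [if_neg]
        rintro rfl
        exact hb (by ext; simp)
      · simp
  rw [← key (c + 1), ← key (c - 1), ← Finset.sum_add_distrib]
  refine Finset.sum_congr rfl fun x _ => ?_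
  by_cases h1 : ((x : ℕ) : ℤ) = c + 1
  · rw [if_pos h1, if_neg (by omega), h1, add_zero]
  · by_cases h2 : ((x : ℕ) : ℤ) = c - 1
    · rw [if_pos h2, if_neg (by omega), h2, zero_add]
    · rw [if_neg h1, if_neg h2, h _ h1 h2, add_zero]

/-- The two normalizations of the coefficients. -/
theorem stepCoeff_mul_triFact {r : ℕ} {w a b a' b' : ℤ} (h : AdmissibleZ r a b w)
    (h' : AdmissibleZ r a' b' w) (ha : a' = a + 1 ∨ a' = a - 1) (hb : b' = b + 1 ∨ b' = b - 1) :
    stepCoeff r w a b a' b' * ((-1) ^ ((a' + b' + w) / 2) * qFactZ r ((a + b + w) / 2 + 1) *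
      triFact r w a' b') =
    stepCoeffDual r w a b a' b' * ((-1) ^ ((a + b + w) / 2) * qFactZ r ((a' + b' + w) / 2 + 1) *
      triFact r w a b) := by
  obtain ⟨s, h1, h2, h3, h4, h5⟩ := h.exists_half
  obtain ⟨s', h1', h2', h3', h4', h5'⟩ := h'.exists_half
  have hh := h.bounds
  have hh' := h'.bounds
  have es : (a + b + w) / 2 = s := by omega
  have es' : (a' + b' + w) / 2 = s' := by omega
  have e1 : (a + b - w) / 2 = s - w := by omega
  have e2 : (a + w - b) / 2 = s - b := by omega
  have e3 : (b + w - a) / 2 = s - a := by omega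
  have e1' : (a' + b' - w) / 2 = s' - w := by omega
  have e2' : (a' + w - b') / 2 = s' - b' := by omega
  have e3' : (b' + w - a') / 2 = s' - a' := by omega
  simp only [triFact, stepCoeff, stepCoeffDual, es, es', e1, e2, e3, e1', e2', e3']
  rcases ha with rfl | rfl <;> rcases hb with rfl | rfl
  · obtain rfl : s' = s + 1 := by omega
    simp only [if_true]
    rw [show s + 1 - w = s - w + 1 by ring, show s + 1 - (b + 1) = s - b by ring,
      show s + 1 - (a + 1) = s - a by ring, qFactZ_succ r (show 0 ≤ s - w by omega),
      qFactZ_succ r (show 0 ≤ s + 1 by omega), zpow_add_one₀ (by norm_num),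
      show s + 1 + 1 = s + 2 by ring]
    ring
  · obtain rfl : s' = s := by omega
    simp only [if_true, show b - 1 ≠ b + 1 by omega, if_false]
    rw [show s' - a = s' - (a + 1) + 1 by ring, show s' - (b - 1) = s' - b + 1 by ring,
      qFactZ_succ r (show 0 ≤ s' - (a + 1) by omega), qFactZ_succ r (show 0 ≤ s' - b by omega)]
    ring
  · obtain rfl : s' = s := by omega
    simp only [if_true, show a - 1 ≠ a + 1 by omega, if_false]
    rw [show s' - b = s' - (b + 1) + 1 by ring, show s' - (a - 1) = s' - a + 1 by ring,
      qFactZ_succ r (show 0 ≤ s' - (b + 1) by omega), qFactZ_succ r (show 0 ≤ s' - a by omega)]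
    ring
  · obtain rfl : s' = s - 1 := by omega
    simp only [show b - 1 ≠ b + 1 by omega, show a - 1 ≠ a + 1 by omega, if_false]
    rw [show s - w = s - 1 - w + 1 by ring, show s - 1 - (b - 1) = s - b by ring,
      show s - 1 - (a - 1) = s - a by ring, qFactZ_succ r (show 0 ≤ s - 1 - w by omega),
      qFactZ_succ r (show 0 ≤ s by omega), zpow_sub_one₀ (by norm_num),
      show s - 1 + 1 = s by ring]
    ring

theorem stepKernel_eq {r : ℕ} {w a b a' b' : ℤ} (h : AdmissibleZ r a b w)
    (h' : AdmissibleZ r a' b' w) (ha : a' = a + 1 ∨ a' = a - 1) (hb : b' = b + 1 ∨ b' = b - 1) :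
    stepKernel r w a b a' b' =
      stepCoeff r w a b a' b' * (triFact r w a' b' / triFact r w a b) *
        ((if b' = b + 1 then -1 else 1) / qBr r (b' + 1)) * (qFactZ r b / qFactZ r b') :=
  if_pos ⟨h, h', ha, hb⟩

theorem edgeWeight_eq {r : ℕ} {w a b : ℤ} (h : AdmissibleZ r a b w) :
    edgeWeight r w a b =
      ((-1) ^ ((a + b + w) / 2) * qFactZ r ((a + b + w) / 2 + 1) * triFact r w a b /
        (qFactZ r a * qFactZ r b * qFactZ r w))⁻¹ :=
  if_pos h

theorem tetWeight_eq {r : ℕ} {j k l a b c : ℤ} (h₁ : AdmissibleZ r a b j)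
    (h₂ : AdmissibleZ r a c l) (h₃ : AdmissibleZ r b c k) :
    tetWeight r j k l a b c =
      triFact r j k l * triFact r j a b * triFact r l a c * triFact r k b c /
        (qFactZ r a * qFactZ r b * qFactZ r c * (qFactZ r j * qFactZ r k * qFactZ r l)) *
        racahTet r j k l a b c :=
  if_pos ⟨h₁, h₂, h₃⟩

/-- The kernel carries the ratio of the target factorials to the source factorials, so
multiplication by it trades the source factors of the tetrahedron for the target ones. -/
theorem kernel_product_eq {F : Type*} [Field F] {Dl Dk qb qc : F} (hDl : Dl ≠ 0) (hDk : Dk ≠ 0)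
    (hqb : qb ≠ 0) (hqc : qc ≠ 0) (S₁ S₂ D₀ Dj Dl' Dk' ε e qa qc' qb' Q X : F) :
    S₁ * (Dl' / Dl) * e * (qc / qc') * (S₂ * (Dk' / Dk) * ε * (qb / qb')) *
      (D₀ * Dj * Dl * Dk / (qa * qb * qc * Q) * X) =
    D₀ * Dj * Dl' * Dk' * ε / (qa * qb' * qc' * Q) * (S₁ * S₂ * e * X) := by
  have h : S₁ * (Dl' / Dl) * e * (qc / qc') * (S₂ * (Dk' / Dk) * ε * (qb / qb')) *
      (D₀ * Dj * Dl * Dk / (qa * qb * qc * Q) * X) =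
    D₀ * Dj * Dl' * Dk' * ε / (qa * qb' * qc' * Q) * (S₁ * S₂ * e * X) *
      ((Dl / Dl) * (Dk / Dk) * (qb / qb) * (qc / qc)) := by
    simp only [div_eq_mul_inv, mul_inv]
    ring
  rw [h, div_self hDl, div_self hDk, div_self hqb, div_self hqc]
  ring

/-- The conversion `h` between `stepCoeff` and `stepCoeffDual` is a ratio of theta evaluations, and
it is absorbed by the two edge weights. The signs `u`, `u'` are their own inverses. -/
theorem kernel_edge_eq {F : Type*} [Field F] {Dj Dj' qa qa' qb' qb qj n n' u u' : F} (hDj : Dj ≠ 0)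
    (hDj' : Dj' ≠ 0) (hqa : qa ≠ 0) (hqa' : qa' ≠ 0) (hqb' : qb' ≠ 0)
    (hn : n ≠ 0) (hn' : n' ≠ 0) (hu : u * u = 1) (hu' : u' * u' = 1) (S H D₀ Dl Dk ε qc Q X : F)
    (h : S * (u' * n * Dj') = H * (u * n' * Dj)) :
    D₀ * Dj * Dl * Dk * ε / (qa * qb' * qc * Q) * (H * X) * (u * n * Dj / (qa * qb * qj))⁻¹ =
      S * (Dj' / Dj) * ε * (qb / qb') * (u' * n' * Dj' / (qa' * qb' * qj))⁻¹ *
        (D₀ * Dj' * Dl * Dk / (qa' * qb' * qc * Q) * X) := by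
  have hu0 : u ≠ 0 := left_ne_zero_of_mul_eq_one hu
  have hu0' : u' ≠ 0 := left_ne_zero_of_mul_eq_one hu'
  have h' : H * u * n⁻¹ = S * Dj' * Dj⁻¹ * u' * n'⁻¹ := by
    field_simp
    linear_combination -h
  have iu : u⁻¹ = u := inv_eq_of_mul_eq_one_left hu
  have iu' : u'⁻¹ = u' := inv_eq_of_mul_eq_one_left hu'
  calc _ = D₀ * Dl * Dk * ε * qb'⁻¹ * qc⁻¹ * Q⁻¹ * X * qb * qj * (H * u * n⁻¹) *
        ((Dj / Dj) * (qa / qa)) := by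
        simp only [div_eq_mul_inv, mul_inv, inv_inv, iu]
        ring
    _ = D₀ * Dl * Dk * ε * qb'⁻¹ * qc⁻¹ * Q⁻¹ * X * qb * qj * (S * Dj' * Dj⁻¹ * u' * n'⁻¹) *
        ((Dj' / Dj') * (qa' / qa') * (qb' / qb')) := by
        rw [h', div_self hDj, div_self hDj', div_self hqa, div_self hqa', div_self hqb']
        ring
    _ = _ := by
        simp only [div_eq_mul_inv, mul_inv, inv_inv, iu']
        ring

theorem neg_one_zpow_mul_self (n : ℤ) : ((-1 : ℂ)) ^ n * (-1) ^ n = 1 := by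
  rw [← mul_zpow]
  norm_num

/-- `racahTet_relation` in the normalization of the state sum, valid for all integers. Two steps
along the walk `x, z, y`, taken past a tetrahedron, become a single step along `x, y`; this allows
the transfer operator to pass the insertion of a triangle. -/
theorem tetWeight_relation {r : ℕ} (hr : 3 ≤ r) {j k l : ℤ} (hjkl : AdmissibleZ r j k l)
    (a b a' b' c' : ℤ) :
    (∑ c : Spin r, stepKernel r l a (c : ℕ) a' c' * stepKernel r k (c : ℕ) b c' b' *
        tetWeight r j k l a b (c : ℕ)) * edgeWeight r j a b =
      stepKernel r j a b a' b' * edgeWeight r j a' b' * tetWeight r j k l a' b' c' := by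
  -- Each condition in `H` is forced by the support of some factor on either side, so both sides
  -- vanish when `H` fails. The triples `(a', b', j)`, `(a, c, l)` and `(b, c, k)` are not in `H`
  -- and are treated separately.
  by_cases H : AdmissibleZ r a b j ∧ AdmissibleZ r a' c' l ∧ AdmissibleZ r b' c' k ∧
      (a' = a + 1 ∨ a' = a - 1) ∧ (b' = b + 1 ∨ b' = b - 1)
  swap
  · have hL : (∑ c : Spin r, stepKernel r l a (c : ℕ) a' c' * stepKernel r k (c : ℕ) b c' b' *
        tetWeight r j k l a b (c : ℕ)) * edgeWeight r j a b = 0 := by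
      by_contra hc
      obtain ⟨h1, h2⟩ := mul_ne_zero_iff.1 hc
      obtain ⟨c, -, h3⟩ := Finset.exists_ne_zero_of_sum_ne_zero h1
      obtain ⟨h4, h5⟩ := mul_ne_zero_iff.1 h3
      obtain ⟨h6, h7⟩ := mul_ne_zero_iff.1 h4
      simp only [stepKernel, edgeWeight, ne_eq, ite_eq_right_iff, not_forall] at h2 h6 h7
      exact H ⟨h2.1, h6.1.2.1, h7.1.2.1.swap, h6.1.2.2.1, h7.1.2.2.2⟩
    have hR : stepKernel r j a b a' b' * edgeWeight r j a' b' * tetWeight r j k l a' b' c' = 0 := by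
      by_contra hc
      obtain ⟨h4, h5⟩ := mul_ne_zero_iff.1 hc
      obtain ⟨h6, h7⟩ := mul_ne_zero_iff.1 h4
      simp only [stepKernel, tetWeight, ne_eq, ite_eq_right_iff, not_forall] at h5 h6
      exact H ⟨h6.1.1, h5.1.2.1, h5.1.2.2, h6.1.2.2.1, h6.1.2.2.2⟩
    rw [hL, hR]
  obtain ⟨habj, hacl, hbck, ha, hb⟩ := H
  have bnd := hacl.bounds
  have bnd' := hbck.bounds
  have bnd2 := habj.bounds
  -- `K` is the factor common to the two terms `c = c' ± 1`.
  set K : ℂ := triFact r j k l * triFact r j a b * triFact r l a' c' * triFact r k b' c' *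
    ((if b' = b + 1 then -1 else 1) / qBr r (b' + 1)) /
    (qFactZ r a * qFactZ r b' * qFactZ r c' * (qFactZ r j * qFactZ r k * qFactZ r l)) with hK
  have hF : ∀ c : ℤ, c = c' + 1 ∨ c = c' - 1 →
      stepKernel r l a c a' c' * stepKernel r k c b c' b' * tetWeight r j k l a b c =
      K * (stepCoeff r l a c a' c' * stepCoeff r k b c b' c' *
        ((if c' = c + 1 then -1 else 1) / qBr r (c' + 1)) * racahTet r j k l a b c) := by
    intro c hc
    by_cases hA : AdmissibleZ r a c l ∧ AdmissibleZ r b c k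
    · have t1 := triFact_ne_zero hr hA.1
      have t2 := triFact_ne_zero hr hA.2
      have q1 := qFactZ_ne_zero hr (show b < r by omega)
      have q2 := qFactZ_ne_zero hr (show c < r by have := hA.1.bounds; omega)
      rw [stepKernel_eq hA.1 hacl ha (by omega), stepKernel_eq hA.2.swap hbck.swap (by omega) hb,
        tetWeight_eq habj hA.1 hA.2, hK,
        triFact_symm r k b c, triFact_symm r k b' c', stepCoeff_symm r k b c b' c']
      exact kernel_product_eq t1 t2 q1 q2 ..
    · rw [racahTet_eq_zero hr hjkl.2.2.2.1 habj.2.2.2.1]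
      · rw [tetWeight, if_neg (by tauto)]
        ring
      · obtain ⟨s, hs⟩ := hacl.2.2.2.1
        rcases ha with rfl | rfl <;> rcases hc with rfl | rfl
        exacts [⟨s, by omega⟩, ⟨s - 1, by omega⟩, ⟨s + 1, by omega⟩, ⟨s, by omega⟩]
      · obtain ⟨s, hs⟩ := hbck.2.2.2.1
        rcases hb with rfl | rfl <;> rcases hc with rfl | rfl
        exacts [⟨s, by omega⟩, ⟨s - 1, by omega⟩, ⟨s + 1, by omega⟩, ⟨s, by omega⟩]
      · tauto
  rw [sum_spin_adjacent c' (fun c => stepKernel r l a c a' c' * stepKernel r k c b c' b' *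
    tetWeight r j k l a b c)]
  rotate_left
  · intro x h1 h2
    rw [stepKernel, if_neg (by omega)]
    ring
  · intro x hx
    have h1 := (mul_ne_zero_iff.1 (mul_ne_zero_iff.1 hx).1).1
    simp only [stepKernel, ne_eq, ite_eq_right_iff, not_forall] at h1
    have := h1.1.1.bounds
    omega
  have hq : qBr r (c' + 1) ≠ 0 := qBr_ne_zero hr (by omega) (by omega)
  have hrel := racahTet_relation hr hjkl habj hacl hbck ha hb
  have hsum : stepKernel r l a (c' + 1) a' c' * stepKernel r k (c' + 1) b c' b' *
      tetWeight r j k l a b (c' + 1) + stepKernel r l a (c' - 1) a' c' *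
      stepKernel r k (c' - 1) b c' b' * tetWeight r j k l a b (c' - 1) =
      K * (stepCoeffDual r j a b a' b' * racahTet r j k l a' b' c') := by
    rw [hF _ (Or.inl rfl), hF _ (Or.inr rfl), if_neg (by omega), if_pos (by ring)]
    field_simp
    linear_combination -K * hrel
  rw [hsum]
  -- If the target face is inadmissible, the right side is zero by definition and the left side
  -- because the target Racah sum vanishes.
  by_cases hA : AdmissibleZ r a' b' j
  · have hmu := stepCoeff_mul_triFact habj hA ha hb
    rw [stepKernel_eq habj hA ha hb, tetWeight_eq hA hacl hbck, edgeWeight_eq habj,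
      edgeWeight_eq hA, hK]
    have t1 := triFact_ne_zero hr habj
    have t2 := triFact_ne_zero hr hA
    have q4 := qFactZ_ne_zero hr (show b' < r by omega)
    have q5 := qFactZ_ne_zero hr (show a < r by omega)
    have q6 := qFactZ_ne_zero hr (show a' < r by omega)
    have n1 : qFactZ r ((a + b + j) / 2 + 1) ≠ 0 := qFactZ_ne_zero hr (by
      obtain ⟨s, h1, _⟩ := habj.exists_half
      omega)
    have n2 : qFactZ r ((a' + b' + j) / 2 + 1) ≠ 0 := qFactZ_ne_zero hr (by
      obtain ⟨s, h1, _⟩ := hA.exists_half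
      omega)
    exact kernel_edge_eq t1 t2 q5 q6 q4 n1 n2 (neg_one_zpow_mul_self _)
      (neg_one_zpow_mul_self _) _ _ _ _ _ _ _ _ _ hmu
  · rw [racahTet_eq_zero hr hjkl.2.2.2.1 _ hacl.2.2.2.1 hbck.2.2.2.1 (Or.inl hA), stepKernel,
      if_neg (by tauto)]
    · ring
    · obtain ⟨s, hs⟩ := habj.2.2.2.1
      rcases ha with rfl | rfl <;> rcases hb with rfl | rfl
      exacts [⟨s + 1, by omega⟩, ⟨s, by omega⟩, ⟨s, by omega⟩, ⟨s - 1, by omega⟩]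

/-- A step out of the admissible region crosses a wall, and the coefficient of that step is there
`[0]` or `-[r]`. -/
theorem stepCoeff_eq_zero {r : ℕ} (hr : 3 ≤ r) {w a b a' b' : ℤ} (h : AdmissibleZ r a b w)
    (h' : ¬AdmissibleZ r a' b' w) (ha : a' = a + 1 ∨ a' = a - 1) (hb : b' = b + 1 ∨ b' = b - 1) :
    stepCoeff r w a b a' b' = 0 := by
  obtain ⟨s, h1, h2, h3, h4, h5⟩ := h.exists_half
  have key : ∀ s', a' + b' + w = s' + s' →
      a' > b' + w ∨ b' > a' + w ∨ w > a' + b' ∨ s' > (r : ℤ) - 2 := by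
    intro s' hs'
    by_contra hc
    exact h' ⟨by omega, by omega, by omega, ⟨s', hs'⟩, by omega⟩
  unfold stepCoeff
  rcases ha with rfl | rfl <;> rcases hb with rfl | rfl
  · have := key (s + 1) (by omega)
    rw [if_pos rfl, if_pos rfl, show (a + b + w) / 2 + 2 = r by omega, qBr_self hr, neg_zero]
  · have := key s (by omega)
    rw [if_pos rfl, if_neg (by omega), show (b + w - a) / 2 = 0 by omega, qBr_zero]
  · have := key s (by omega)
    rw [if_neg (by omega), if_pos rfl, show (a + w - b) / 2 = 0 by omega, qBr_zero]
  · have := key (s - 1) (by omega)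
    rw [if_neg (by omega), if_neg (by omega), show (a + b - w) / 2 = 0 by omega, qBr_zero]

theorem qBr_identity_add (r : ℕ) (s x y w : ℤ) (h : x + y + w = 2 * s) :
    qBr r (s + 2) * qBr r (s - w + 1) + qBr r (s - y) * qBr r (s - x + 1) =
      qBr r (x + 1) * qBr r (y + 2) := by
  obtain rfl : w = 2 * s - x - y := by omega
  have hq := q_ne_zero r
  rw [show s - (2 * s - x - y) + 1 = x + y - s + 1 by ring]
  simp only [qBr_eq_div, zpow_add₀ hq, zpow_sub₀ hq, zpow_ofNat]
  have h1 := zpow_ne_zero s hq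
  have h2 := zpow_ne_zero x hq
  have h3 := zpow_ne_zero y hq
  generalize q r ^ s = z at *
  generalize q r ^ x = x₁ at *
  generalize q r ^ y = y₁ at *
  simp only [div_mul_div_comm, ← add_div]
  congr 1
  field_simp
  ring

theorem kernel_fold_eq {F : Type*} [Field F] {D D₂ D' n₂ n' qx' qy' u₂ u' : F} (hD₂ : D₂ ≠ 0)
    (hD' : D' ≠ 0) (hn₂ : n₂ ≠ 0) (hn' : n' ≠ 0) (hqx' : qx' ≠ 0) (hqy' : qy' ≠ 0)
    (hu : u₂ * u₂ = 1) (hu' : u' * u' = 1) (S₁ S₂ H₂ d e ε qx qy qw : F)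
    (h : S₂ * (u' * n₂ * D') = H₂ * (u₂ * n' * D₂)) :
    d * (u' * n' * D' / (qy' * qx' * qw))⁻¹ * (S₁ * (D' / D) * e * (qx / qx')) *
      (S₂ * (D' / D₂) * ε * (qy / qy')) =
    ε * qx * qy * qw * u₂ / (n₂ * D) * (d * (S₁ * H₂ * e)) := by
  have hu0 : u₂ ≠ 0 := left_ne_zero_of_mul_eq_one hu
  have hu0' : u' ≠ 0 := left_ne_zero_of_mul_eq_one hu'
  have iu' : u'⁻¹ = u' := inv_eq_of_mul_eq_one_left hu'
  have h' : S₂ * D' * u' * n'⁻¹ * D₂⁻¹ = H₂ * u₂ * n₂⁻¹ := by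
    field_simp
    linear_combination h
  calc _ = d * ε * e * qx * qy * qw * S₁ * D⁻¹ * (S₂ * D' * u' * n'⁻¹ * D₂⁻¹) *
        ((D' / D') * (qx' / qx') * (qy' / qy')) := by
        simp only [div_eq_mul_inv, mul_inv, inv_inv, iu']
        ring
    _ = _ := by
        rw [h', div_self hD', div_self hqx', div_self hqy']
        simp only [div_eq_mul_inv, mul_inv]
        ring

/-- Both `y₁` and `y₂` are neighbours of `y'`, so they are equal or differ by two. If they differ,
the two products coincide factor by factor and cancel; if they are equal, the value is
`qBr_identity_add`. -/
theorem stepCoeff_bilinear {r : ℕ} {w x y₁ y₂ y' : ℤ} (h₁ : AdmissibleZ r y₁ x w)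
    (h₂ : AdmissibleZ r y₂ x w) (hy₁ : y' = y₁ + 1 ∨ y' = y₁ - 1)
    (hy₂ : y' = y₂ + 1 ∨ y' = y₂ - 1) :
    stepCoeff r w y₁ x y' (x + 1) * stepCoeffDual r w y₂ x y' (x + 1) -
      stepCoeff r w y₁ x y' (x - 1) * stepCoeffDual r w y₂ x y' (x - 1) =
    if y₁ = y₂ then (if y' = y₂ + 1 then -1 else 1) * qBr r (x + 1) * qBr r (y' + 1) else 0 := by
  obtain ⟨s, h1, -⟩ := h₁.exists_half
  obtain ⟨t, h2, -⟩ := h₂.exists_half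
  unfold stepCoeff stepCoeffDual
  simp only [if_true, show x - 1 ≠ x + 1 by omega, if_false]
  have br : ∀ x y : ℤ, x = y → qBr r x = qBr r y := fun x y h => by rw [h]
  rcases hy₁ with rfl | rfl <;> rcases hy₂ with hy | hy
  · obtain rfl : y₁ = y₂ := by omega
    simp only [if_true]
    have := qBr_identity_add r s x y₁ w (by omega)
    rw [br ((y₁ + x + w) / 2 + 2) (s + 2) (by omega),
      br ((y₁ + x - w) / 2 + 1) (s - w + 1) (by omega), br ((x + w - y₁) / 2) (s - y₁) (by omega),
      br ((y₁ + w - x) / 2 + 1) (s - x + 1) (by omega), br (y₁ + 1 + 1) (y₁ + 2) (by omega)]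
    linear_combination -this
  · obtain rfl : y₂ = y₁ + 2 := by omega
    simp only [if_true, show y₁ + 1 ≠ y₁ + 2 + 1 by omega, show y₁ ≠ y₁ + 2 by omega, if_false]
    rw [br ((y₁ + x + w) / 2 + 2) ((y₁ + 2 + x + w) / 2 + 1) (by omega),
      br ((x + w - (y₁ + 2)) / 2 + 1) ((x + w - y₁) / 2) (by omega)]
    ring
  · obtain rfl : y₂ = y₁ - 2 := by omega
    simp only [hy, if_true, show y₁ - 2 + 1 ≠ y₁ + 1 by omega, show y₁ ≠ y₁ - 2 by omega, if_false]
    rw [br ((y₁ - 2 + x - w) / 2 + 1) ((y₁ + x - w) / 2) (by omega),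
      br ((y₁ - 2 + w - x) / 2 + 1) ((y₁ + w - x) / 2) (by omega)]
    ring
  · obtain rfl : y₁ = y₂ := by omega
    simp only [if_true, show y₁ - 1 ≠ y₁ + 1 by omega, if_false]
    -- The same identity as for the upward step, with `y₁ - 2` for `y₁` and hence `s - 1` for `s`.
    have := qBr_identity_add r (s - 1) x (y₁ - 2) w (by omega)
    rw [br (s - 1 + 2) ((y₁ + x + w) / 2 + 1) (by omega),
      br (s - 1 - w + 1) ((y₁ + x - w) / 2) (by omega),
      br (s - 1 - (y₁ - 2)) ((x + w - y₁) / 2 + 1) (by omega),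
      br (s - 1 - x + 1) ((y₁ + w - x) / 2) (by omega),
      br (y₁ - 2 + 2) (y₁ - 1 + 1) (by omega)] at this
    linear_combination this

/-- The law for a walk `y, x, y`: here `y₁`, `y₂` are the old labels at the two visits of `y`, `y'`
is their common new label, and `x'` is the new label of `x`. Summation over `x'` forces the two old
labels to agree and returns the weight of the old configuration, which is what the folding of an
edge needs. -/
theorem stepKernel_orthogonality {r : ℕ} (hr : 3 ≤ r) (w x y₁ y₂ y' : ℤ)
    (hy' : 0 ≤ y' ∧ y' ≤ (r : ℤ) - 2) :
    ∑ x' : Spin r, vertexWeight r (x' : ℕ) * edgeWeight r w y' (x' : ℕ) *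
        stepKernel r w y₁ x y' (x' : ℕ) * stepKernel r w x y₂ (x' : ℕ) y' =
      if y₁ = y₂ ∧ (y' = y₂ + 1 ∨ y' = y₂ - 1) then
        vertexWeight r x * edgeWeight r w y₁ x else 0 := by
  by_cases H : AdmissibleZ r y₁ x w ∧ AdmissibleZ r y₂ x w ∧ (y' = y₁ + 1 ∨ y' = y₁ - 1) ∧
      (y' = y₂ + 1 ∨ y' = y₂ - 1)
  swap
  · have hL : ∑ x' : Spin r, vertexWeight r (x' : ℕ) * edgeWeight r w y' (x' : ℕ) *
        stepKernel r w y₁ x y' (x' : ℕ) * stepKernel r w x y₂ (x' : ℕ) y' = 0 := by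
      by_contra hc
      obtain ⟨c, -, h3⟩ := Finset.exists_ne_zero_of_sum_ne_zero hc
      obtain ⟨h4, h5⟩ := mul_ne_zero_iff.1 h3
      obtain ⟨h6, h7⟩ := mul_ne_zero_iff.1 h4
      simp only [stepKernel, ne_eq, ite_eq_right_iff, not_forall] at h5 h7
      exact H ⟨h7.1.1, h5.1.1.swap, h7.1.2.2.1, h5.1.2.2.2⟩
    rw [hL]
    split_ifs with h
    · obtain ⟨rfl, h⟩ := h
      rw [edgeWeight, if_neg (by tauto), mul_zero]
    · rfl
  obtain ⟨h₁, h₂, hy₁, hy₂⟩ := H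
  have b₁ := h₁.bounds
  have b₂ := h₂.bounds
  set K : ℂ := (if y' = y₂ + 1 then -1 else 1) / qBr r (y' + 1) * qFactZ r x * qFactZ r y₂ *
    qFactZ r w * (-1) ^ ((y₂ + x + w) / 2) / (qFactZ r ((y₂ + x + w) / 2 + 1) * triFact r w y₁ x)
    with hK
  have hF : ∀ x' : ℤ, x' = x + 1 ∨ x' = x - 1 →
      vertexWeight r x' * edgeWeight r w y' x' * stepKernel r w y₁ x y' x' *
        stepKernel r w x y₂ x' y' =
      K * ((-1) ^ x * (if x' = x + 1 then 1 else -1) *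
        (stepCoeff r w y₁ x y' x' * stepCoeffDual r w y₂ x y' x')) := by
    intro x' hx'
    by_cases hA : AdmissibleZ r y' x' w
    · have b' := hA.bounds
      have n2 : qFactZ r ((y₂ + x + w) / 2 + 1) ≠ 0 := qFactZ_ne_zero hr (by
        obtain ⟨s, h1, _⟩ := h₂.exists_half
        omega)
      have n' : qFactZ r ((y' + x' + w) / 2 + 1) ≠ 0 := qFactZ_ne_zero hr (by
        obtain ⟨s, h1, _⟩ := hA.exists_half
        omega)
      have hmu := stepCoeff_mul_triFact h₂ hA hy₂ hx'
      rw [edgeWeight_eq hA, stepKernel_eq h₁ hA hy₁ hx', stepKernel_eq h₂.swap hA.swap hx' hy₂,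
        triFact_symm r w y₂ x, triFact_symm r w y' x', stepCoeff_symm r w y₂ x y' x',
        kernel_fold_eq (triFact_ne_zero hr h₂) (triFact_ne_zero hr hA) n2 n'
          (qFactZ_ne_zero hr (by omega)) (qFactZ_ne_zero hr (by omega)) (neg_one_zpow_mul_self _)
          (neg_one_zpow_mul_self _) _ _ _ _ _ _ _ _ _ hmu, hK, vertexWeight]
      have hq : qBr r (x' + 1) ≠ 0 := qBr_ne_zero hr (by omega) (by omega)
      have hd : ∀ e : ℂ, (-1) ^ x' * qBr r (x' + 1) * (stepCoeff r w y₁ x y' x' *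
          stepCoeffDual r w y₂ x y' x' * (e / qBr r (x' + 1))) =
          (-1) ^ x' * e * (stepCoeff r w y₁ x y' x' * stepCoeffDual r w y₂ x y' x') := by
        intro e
        field_simp
      rw [hd]
      congr 2
      rcases hx' with rfl | rfl
      · rw [if_pos rfl, if_pos rfl, zpow_add_one₀ (by norm_num)]
        ring
      · rw [if_neg (by omega), if_neg (by omega), zpow_sub_one₀ (by norm_num)]
        ring
    -- For an inadmissible target the edge weight kills the left side and the vanishing coefficient
    -- kills the right side.
    · rw [edgeWeight, if_neg hA, stepCoeff_eq_zero hr h₁ hA hy₁ hx']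
      ring
  rw [sum_spin_adjacent x (fun x' => vertexWeight r x' * edgeWeight r w y' x' *
    stepKernel r w y₁ x y' x' * stepKernel r w x y₂ x' y')]
  rotate_left
  · intro x' h1 h2
    have : stepKernel r w y₁ x y' x' = 0 := if_neg (by omega)
    rw [this]
    ring
  · intro x' hx
    have h1 := (mul_ne_zero_iff.1 (mul_ne_zero_iff.1 hx).1).2
    simp only [stepKernel, ne_eq, ite_eq_right_iff, not_forall] at h1
    have := h1.1.2.1.bounds
    omega
  have hbil := stepCoeff_bilinear h₁ h₂ hy₁ hy₂
  rw [hF _ (Or.inl rfl), hF _ (Or.inr rfl), if_pos rfl, if_neg (by omega)]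
  have hsum : K * ((-1) ^ x * 1 * (stepCoeff r w y₁ x y' (x + 1) *
      stepCoeffDual r w y₂ x y' (x + 1))) + K * ((-1) ^ x * -1 * (stepCoeff r w y₁ x y' (x - 1) *
      stepCoeffDual r w y₂ x y' (x - 1))) = K * (-1) ^ x *
      (if y₁ = y₂ then (if y' = y₂ + 1 then -1 else 1) * qBr r (x + 1) * qBr r (y' + 1) else 0) := by
    linear_combination K * (-1) ^ x * hbil
  rw [hsum]
  by_cases hy : y₁ = y₂
  · subst hy
    have hq : qBr r (y' + 1) ≠ 0 := qBr_ne_zero hr (by omega) (by omega)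
    rw [if_pos rfl, if_pos (⟨rfl, hy₁⟩ : y₁ = y₁ ∧ (y' = y₁ + 1 ∨ y' = y₁ - 1)), edgeWeight_eq h₁, hK, vertexWeight]
    have iu := inv_eq_of_mul_eq_one_left (neg_one_zpow_mul_self ((y₁ + x + w) / 2))
    simp only [div_eq_mul_inv, mul_inv, inv_inv, iu]
    have hε : ((if y' = y₁ + 1 then -1 else 1) : ℂ) * (if y' = y₁ + 1 then -1 else 1) = 1 := by
      split_ifs <;> norm_num
    generalize ((if y' = y₁ + 1 then -1 else 1) : ℂ) = ε at *
    have hq' := inv_mul_cancel₀ hq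
    linear_combination (qFactZ r x * qFactZ r y₁ * qFactZ r w * (-1) ^ ((y₁ + x + w) / 2) *
      (qFactZ r ((y₁ + x + w) / 2 + 1))⁻¹ * (triFact r w y₁ x)⁻¹ * (-1) ^ x * qBr r (x + 1)) *
      (hε + ε * ε * hq')
  · rw [if_neg hy, if_neg (by tauto), mul_zero]

/-! ### Transfer operators along walks -/

section Transfer

variable {V ι : Type*} [Fintype ι]

/-- The transfer operator with kernel `R` along the walk `p`: a sum over all labellings of the
walk starting with `a`, the target being the labelling `h`. -/
def transfer (R : V → V → ι → ι → ι → ι → ℂ) : List V → List ι → (List ι → ℂ) → ι → ℂ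
  | x :: y :: p, a' :: b' :: h, Ψ, a =>
    ∑ b, R x y a b a' b' * transfer R (y :: p) (b' :: h) (fun l => Ψ (a :: l)) b
  | _, _, Ψ, a => Ψ [a]

/-- Insertion of a triangle with weight `t` across an edge with weight `e`, after `n` steps. -/
def growAt (e : ι → ι → ℂ) (t : ι → ι → ι → ℂ) : ℕ → (List ι → ℂ) → List ι → ℂ
  | 0, Ψ, a :: c :: b :: h => Ψ (a :: b :: h) * (e a b * t a c b)
  | n + 1, Ψ, a :: h => growAt e t n (fun l => Ψ (a :: l)) h
  | _, _, _ => 0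

/-- Folding of two consecutive edges, after `n` steps. -/
def foldAt (f : ι → ι → ℂ) : ℕ → (List ι → ℂ) → List ι → ℂ
  | 0, Ψ, a :: h => ∑ x, f a x * Ψ (a :: x :: a :: h)
  | n + 1, Ψ, a :: h => foldAt f n (fun l => Ψ (a :: l)) h
  | _, _, _ => 0

theorem growAt_append {ι : Type*} (e : ι → ι → ℂ) (t : ι → ι → ι → ℂ) (s : List ι) (a c b : ι) (h : List ι) :
    ∀ Ψ : List ι → ℂ, growAt e t s.length Ψ (s ++ a :: c :: b :: h) =
      Ψ (s ++ a :: b :: h) * (e a b * t a c b) := by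
  induction s with
  | nil => intro Ψ; rfl
  | cons v s ih => intro Ψ; exact ih fun l => Ψ (v :: l)

theorem foldAt_append (f : ι → ι → ℂ) (s : List ι) (a : ι) (h : List ι) :
    ∀ Ψ : List ι → ℂ, foldAt f s.length Ψ (s ++ a :: h) =
      ∑ x, f a x * Ψ (s ++ a :: x :: a :: h) := by
  induction s with
  | nil => intro Ψ; rfl
  | cons v s ih => intro Ψ; exact ih fun l => Ψ (v :: l)

variable (R : V → V → ι → ι → ι → ι → ℂ)

theorem transfer_cons_cons (x y : V) (p : List V) (a' b' : ι) (h : List ι) (Ψ : List ι → ℂ)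
    (a : ι) : transfer R (x :: y :: p) (a' :: b' :: h) Ψ a =
      ∑ b, R x y a b a' b' * transfer R (y :: p) (b' :: h) (fun l => Ψ (a :: l)) b := by
  rw [transfer]

theorem transfer_congr : ∀ (p : List V) (h : List ι) (Ψ Φ : List ι → ℂ) (a : ι),
    (∀ l, Ψ (a :: l) = Φ (a :: l)) → transfer R p h Ψ a = transfer R p h Φ a
  | x :: y :: p, a' :: b' :: h, Ψ, Φ, a, H => by
    rw [transfer_cons_cons, transfer_cons_cons]
    refine Finset.sum_congr rfl fun b _ => ?_
    rw [transfer_congr (y :: p) (b' :: h) _ (fun l => Φ (a :: l)) b fun l => H _]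
  | [], _, Ψ, Φ, a, H => by simpa [transfer] using H []
  | [_], _, Ψ, Φ, a, H => by simpa [transfer] using H []
  | _ :: _ :: _, [], Ψ, Φ, a, H => by simpa [transfer] using H []
  | _ :: _ :: _, [_], Ψ, Φ, a, H => by simpa [transfer] using H []

theorem transfer_sum {κ : Type*} (s : Finset κ) (k : κ → ℂ) :
    ∀ (p : List V) (h : List ι) (Ψ : κ → List ι → ℂ) (a : ι),
      transfer R p h (fun l => ∑ i ∈ s, k i * Ψ i l) a = ∑ i ∈ s, k i * transfer R p h (Ψ i) a
  | x :: y :: p, a' :: b' :: h, Ψ, a => by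
    simp only [transfer_cons_cons]
    simp only [transfer_sum s k (y :: p) (b' :: h) (fun i l => Ψ i (a :: l)), Finset.mul_sum]
    rw [Finset.sum_comm]
    exact Finset.sum_congr rfl fun i _ => Finset.sum_congr rfl fun b _ => by ring
  | [], _, Ψ, a => by simp [transfer]
  | [_], _, Ψ, a => by simp [transfer]
  | _ :: _ :: _, [], Ψ, a => by simp [transfer]
  | _ :: _ :: _, [_], Ψ, a => by simp [transfer]

theorem transfer_mul (k : ℂ) (p : List V) (h : List ι) (Ψ : List ι → ℂ) (a : ι) :
    transfer R p h (fun l => Ψ l * k) a = transfer R p h Ψ a * k := by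
  have := transfer_sum R (Finset.univ : Finset Unit) (fun _ => k) p h (fun _ => Ψ) a
  simpa [mul_comm] using this

/-- The label `c` of the inserted vertex enters only the two sides next to it and the triangle
weight, so `hT` carries out its sum on the spot; the remaining sides pass by induction on the prefix
`s`. -/
theorem transfer_growAt {x z y : V} {e : ι → ι → ℂ} {t : ι → ι → ι → ℂ}
    (hT : ∀ a b a' b' c', (∑ c, R x z a c a' c' * R z y c b c' b' * t a c b) * e a b =
      R x y a b a' b' * (e a' b' * t a' c' b')) (q : List V) (a' c' b' : ι) (q' : List ι) :
    ∀ (s : List V) (s' : List ι), s.length = s'.length → ∀ (Ψ : List ι → ℂ) (a : ι),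
      transfer R (s ++ x :: z :: y :: q) (s' ++ a' :: c' :: b' :: q')
          (growAt e t s.length Ψ) a =
        transfer R (s ++ x :: y :: q) (s' ++ a' :: b' :: q') Ψ a * (e a' b' * t a' c' b')
  | [], [], _, Ψ, a => by
    simp only [List.nil_append, transfer_cons_cons, List.length_nil, Finset.mul_sum, Finset.sum_mul]
    rw [Finset.sum_comm]
    refine Finset.sum_congr rfl fun b _ => ?_
    have h1 : ∀ c, transfer R (y :: q) (b' :: q') (fun l => growAt e t 0 Ψ (a :: c :: l)) b =
        transfer R (y :: q) (b' :: q') (fun l => Ψ (a :: l)) b * (e a b * t a c b) := by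
      intro c
      rw [← transfer_mul]
      exact transfer_congr R _ _ _ _ _ fun l => rfl
    simp only [h1]
    have h2 := hT a b a' b' c'
    rw [Finset.sum_mul] at h2
    have h3 : R x y a b a' b' * transfer R (y :: q) (b' :: q') (fun l => Ψ (a :: l)) b *
        (e a' b' * t a' c' b') = transfer R (y :: q) (b' :: q') (fun l => Ψ (a :: l)) b *
        (R x y a b a' b' * (e a' b' * t a' c' b')) := by ring
    rw [h3, ← h2, Finset.mul_sum]
    exact Finset.sum_congr rfl fun c _ => by ring
  | [v], [w], _, Ψ, a => by
    have ih := transfer_growAt hT q a' c' b' q' [] [] rfl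
    simp only [List.cons_append, List.nil_append] at ih ⊢
    rw [transfer_cons_cons, transfer_cons_cons, Finset.sum_mul]
    refine Finset.sum_congr rfl fun b _ => ?_
    rw [mul_assoc, ← ih]
    rfl
  | v :: u :: s, w :: w₂ :: s', hs, Ψ, a => by
    have ih := transfer_growAt hT q a' c' b' q' (u :: s) (w₂ :: s') (by simpa using hs)
    simp only [List.cons_append] at ih ⊢
    rw [transfer_cons_cons, transfer_cons_cons, Finset.sum_mul]
    refine Finset.sum_congr rfl fun b _ => ?_
    rw [mul_assoc, ← ih]
    rfl

/-- The law `hO` gives the identity only when the old and the new label at the folding point are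
adjacent. After at least one step this follows from the nonvanishing of the preceding kernel (`hR`);
at the start of the walk it must be assumed, since the initial label `a` is not summed over. -/
theorem transfer_foldAt {adj : ι → ι → Prop}
    (hR : ∀ x y a b a' b', R x y a b a' b' ≠ 0 → adj b b') {x y : V} {f : ι → ι → ℂ}
    (hO : ∀ a b c a', ∑ c', f a' c' * (R y x a c a' c' * R x y c b c' a') =
      if a = b ∧ adj b a' then f a c else 0) (q : List V) (a' : ι) (q' : List ι) :
    ∀ (s : List V) (s' : List ι), s.length = s'.length → ∀ (Ψ : List ι → ℂ) (a : ι),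
      (∀ u ∈ (s' ++ [a']).head?, adj a u) →
      ∑ c', f a' c' * transfer R (s ++ y :: x :: y :: q) (s' ++ a' :: c' :: a' :: q') Ψ a =
        transfer R (s ++ y :: q) (s' ++ a' :: q') (foldAt f s.length Ψ) a
  | [], [], _, Ψ, a, ha => by
    simp only [List.nil_append, transfer_cons_cons, List.length_nil, Finset.mul_sum]
    have ha : adj a a' := ha a' (by simp)
    rw [transfer_congr R _ _ (foldAt f 0 Ψ)
      (fun l => ∑ c, f a c * Ψ (a :: c :: l)) a fun l => rfl, transfer_sum, Finset.sum_comm]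
    refine Finset.sum_congr rfl fun c _ => ?_
    rw [Finset.sum_comm]
    have h1 : ∀ b, ∑ c', f a' c' * (R y x a c a' c' * (R x y c b c' a' *
        transfer R (y :: q) (a' :: q') (fun l => Ψ (a :: c :: l)) b)) =
        if b = a then f a c * transfer R (y :: q) (a' :: q') (fun l => Ψ (a :: c :: l)) b
        else 0 := by
      intro b
      have h2 := hO a b c a'
      by_cases hb : b = a
      · subst hb
        rw [if_pos ⟨rfl, ha⟩] at h2
        rw [if_pos rfl, ← h2, Finset.sum_mul]
        exact Finset.sum_congr rfl fun _ _ => by ring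
      · rw [if_neg (fun h => hb h.1.symm)] at h2
        rw [if_neg hb, ← zero_mul (transfer R (y :: q) (a' :: q') (fun l => Ψ (a :: c :: l)) b),
          ← h2, Finset.sum_mul]
        exact Finset.sum_congr rfl fun _ _ => by ring
    simp only [h1, Finset.sum_ite_eq', Finset.mem_univ, if_true]
  | [v], [w], _, Ψ, a, _ => by
    have ih := transfer_foldAt hR hO q a' q' [] [] rfl
    simp only [List.cons_append, List.nil_append] at ih ⊢
    simp only [transfer_cons_cons R v y, Finset.mul_sum]
    rw [Finset.sum_comm]
    refine Finset.sum_congr rfl fun b _ => ?_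
    by_cases h0 : R v y a b w a' = 0
    · simp [h0]
    · have h1 := ih (fun l => Ψ (a :: l)) b (by simpa using hR _ _ _ _ _ _ h0)
      change _ = R v y a b w a' * transfer R (y :: q) (a' :: q') (foldAt f 0 fun l => Ψ (a :: l)) b
      rw [List.length_nil] at h1
      rw [← h1, Finset.mul_sum]
      exact Finset.sum_congr rfl fun _ _ => by ring
  | v :: u :: s, w :: w₂ :: s', hs, Ψ, a, _ => by
    have ih := transfer_foldAt hR hO q a' q' (u :: s) (w₂ :: s') (by simpa using hs)
    simp only [List.cons_append] at ih ⊢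
    simp only [transfer_cons_cons R v u, Finset.mul_sum]
    rw [Finset.sum_comm]
    refine Finset.sum_congr rfl fun b _ => ?_
    by_cases h0 : R v u a b w w₂ = 0
    · simp [h0]
    · have h1 := ih (fun l => Ψ (a :: l)) b (by simpa using hR _ _ _ _ _ _ h0)
      change _ = R v u a b w w₂ * transfer R (u :: (s ++ y :: q)) (w₂ :: (s' ++ a' :: q'))
        (foldAt f (u :: s).length fun l => Ψ (a :: l)) b
      rw [← h1, Finset.mul_sum]
      exact Finset.sum_congr rfl fun _ _ => by ring

end Transfer

section Evolution

variable {V ι : Type*} [Fintype ι]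

/-- The walks and operators that arise from the walk `[x₀, x₁]` by insertion of triangles and by
folding. -/
inductive Evolves (E : V → V → ι → ι → ℂ) (T : V → V → V → ι → ι → ι → ℂ) (d : ι → ℂ)
    (edge : V → V → Prop) (tri : V → V → V → Prop) (x₀ x₁ : V) :
    List V → ((List ι → ℂ) → List ι → ℂ) → Prop
  | base : Evolves E T d edge tri x₀ x₁ [x₀, x₁] id
  | grow {s q : List V} {x z y : V} {L : (List ι → ℂ) → List ι → ℂ} (h : tri x z y)
      (hL : Evolves E T d edge tri x₀ x₁ (s ++ x :: y :: q) L) :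
      Evolves E T d edge tri x₀ x₁ (s ++ x :: z :: y :: q)
        (fun Ψ => growAt (E x y) (T x z y) s.length (L Ψ))
  | fold {s q : List V} {x y : V} {L : (List ι → ℂ) → List ι → ℂ} (h : edge y x)
      (hL : Evolves E T d edge tri x₀ x₁ (s ++ y :: x :: y :: q) L) :
      Evolves E T d edge tri x₀ x₁ (s ++ y :: q)
        (fun Ψ => foldAt (fun a c => d c * E y x a c) s.length (L Ψ))

variable {E : V → V → ι → ι → ℂ} {T : V → V → V → ι → ι → ι → ℂ} {d : ι → ℂ}
  {edge : V → V → Prop} {tri : V → V → V → Prop} {x₀ x₁ : V}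
  {R : V → V → ι → ι → ι → ι → ℂ} {adj : ι → ι → Prop}

/-- Transfer commutes with each growth and each fold, hence with `L`: a relation between `Ψ` and `Θ`
on the initial edge persists along the whole evolution. -/
theorem Evolves.transfer_eq
    (hR : ∀ x y a b a' b', R x y a b a' b' ≠ 0 → adj b b')
    (hT : ∀ x z y, tri x z y → ∀ a b a' b' c',
      (∑ c, R x z a c a' c' * R z y c b c' b' * T x z y a c b) * E x y a b =
        R x y a b a' b' * (E x y a' b' * T x z y a' c' b'))
    (hO : ∀ y x, edge y x → ∀ a b c a',
      ∑ c', d c' * E y x a' c' * (R y x a c a' c' * R x y c b c' a') =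
        if a = b ∧ adj b a' then d c * E y x a c else 0)
    {p : List V} {L : (List ι → ℂ) → List ι → ℂ} (h : Evolves E T d edge tri x₀ x₁ p L)
    (Ψ Θ : List ι → ℂ) (a : ι)
    (h0 : ∀ a' b', transfer R [x₀, x₁] [a', b'] Ψ a = Θ [a', b']) :
    ∀ l : List ι, l.length = p.length → (∀ u ∈ l.head?, adj a u) →
      transfer R p l (L Ψ) a = L Θ l := by
  induction h with
  | base =>
    intro l hl _
    obtain ⟨a', b', rfl⟩ := List.length_eq_two.1 hl
    exact h0 a' b'
  | @grow s q x z y L h hL ih =>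
    intro l hl ha
    obtain ⟨s', t, rfl, hs⟩ : ∃ s' t, l = s' ++ t ∧ s.length = s'.length :=
      ⟨l.take s.length, l.drop s.length, (List.take_append_drop _ _).symm, by
        simp only [List.length_append, List.length_cons] at hl
        simp only [List.length_take]
        omega⟩
    match t, hl, ha with
    | a' :: c' :: b' :: q', hl, ha =>
      rw [transfer_growAt R (hT x z y h) q a' c' b' q' s s' hs, hs]
      beta_reduce
      rw [growAt_append, ih]
      · simp only [List.length_append, List.length_cons] at hl ⊢
        omega
      · cases s' with
        | nil => simpa using ha
        | cons w s' => simpa using ha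
    | [], hl, ha => simp only [List.length_append, List.length_cons, List.length_nil] at hl; omega
    | [_], hl, ha =>
      simp only [List.length_append, List.length_cons, List.length_nil] at hl; omega
    | [_, _], hl, ha =>
      simp only [List.length_append, List.length_cons, List.length_nil] at hl; omega
  | @fold s q x y L h hL ih =>
    intro l hl ha
    obtain ⟨s', t, rfl, hs⟩ : ∃ s' t, l = s' ++ t ∧ s.length = s'.length :=
      ⟨l.take s.length, l.drop s.length, (List.take_append_drop _ _).symm, by
        simp only [List.length_append, List.length_cons] at hl
        simp only [List.length_take]
        omega⟩
    match t, hl, ha with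
    | a' :: q', hl, ha =>
      have hhead : ∀ u ∈ (s' ++ [a']).head?, adj a u := by
        cases s' with
        | nil => simpa using ha
        | cons w s' => simpa using ha
      rw [← transfer_foldAt R hR (hO y x h) q a' q' s s' hs _ a hhead, hs]
      beta_reduce
      rw [foldAt_append]
      refine Finset.sum_congr rfl fun c' _ => ?_
      rw [ih]
      · simp only [List.length_append, List.length_cons] at hl ⊢
        omega
      · cases s' with
        | nil => simpa using ha
        | cons w s' => simpa using ha
    | [], hl, ha => simp only [List.length_append, List.length_cons, List.length_nil] at hl; omega

theorem Evolves.eq_of_kernel_ne_zero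
    (hRl : ∀ x y a b a' b', R x y a b a' b' ≠ 0 → adj a a')
    (hR : ∀ x y a b a' b', R x y a b a' b' ≠ 0 → adj b b')
    (hT : ∀ x z y, tri x z y → ∀ a b a' b' c',
      (∑ c, R x z a c a' c' * R z y c b c' b' * T x z y a c b) * E x y a b =
        R x y a b a' b' * (E x y a' b' * T x z y a' c' b'))
    (hO : ∀ y x, edge y x → ∀ a b c a',
      ∑ c', d c' * E y x a' c' * (R y x a c a' c' * R x y c b c' a') =
        if a = b ∧ adj b a' then d c * E y x a c else 0)
    {L : (List ι → ℂ) → List ι → ℂ} (h : Evolves E T d edge tri x₀ x₁ [x₀, x₁] L)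
    {X : ι → ι → ℂ} (hL : ∀ Ψ a b, L Ψ [a, b] = Ψ [a, b] * X a b) {a b a' b' : ι}
    (hne : R x₀ x₁ a b a' b' ≠ 0) : X a b = X a' b' := by
  -- The transfer of the indicator function of `[a, b]` is the kernel itself as a function of the
  -- target labels. Since `L` is multiplication by `X`, the left side acquires `X a b` and the right
  -- side `X a' b'`.
  have key := h.transfer_eq hR hT hO (fun l => if l = [a, b] then 1 else 0)
    (fun l => R x₀ x₁ a b (l.getD 0 a) (l.getD 1 a)) a (by
      intro a' b'
      simp [transfer])
    [a', b'] rfl (by simpa using hRl _ _ _ _ _ _ hne)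
  rw [hL, transfer_cons_cons] at key
  simp only [transfer, hL] at key
  have h1 : ∑ c, R x₀ x₁ a c a' b' * ((if [a, c] = [a, b] then 1 else 0) * X a c) =
      R x₀ x₁ a b a' b' * X a b := by
    rw [Finset.sum_eq_single b]
    · simp
    · intro c _ hc
      rw [if_neg (by simpa using hc)]
      ring
    · simp
  rw [h1] at key
  exact mul_left_cancel₀ hne (by simpa using key)

end Evolution

/-! ### Walks and their sides -/

section Sides

variable {V : Type*} [DecidableEq V]

/-- The sides of a walk. -/
def sides : List V → List (Finset V)
  | x :: y :: p => {x, y} :: sides (y :: p)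
  | _ => []

theorem sides_cons_cons (x y : V) (p : List V) : sides (x :: y :: p) = {x, y} :: sides (y :: p) :=
  by rw [sides]

theorem sides_append (x : V) (q : List V) :
    ∀ s : List V, sides (s ++ x :: q) = sides (s ++ [x]) ++ sides (x :: q)
  | [] => by simp [sides]
  | [v] => by simp [sides]
  | v :: u :: s => by
    have := sides_append x q (u :: s)
    simp only [List.cons_append] at this ⊢
    rw [sides_cons_cons, sides_cons_cons, this, List.cons_append]

theorem mem_of_mem_sides : ∀ (p : List V) {e : Finset V}, e ∈ sides p → ∀ v ∈ e, v ∈ p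
  | x :: y :: p, e, he, v, hv => by
    rw [sides_cons_cons, List.mem_cons] at he
    rcases he with rfl | he
    · rcases Finset.mem_insert.1 hv with rfl | hv
      · simp
      · rw [Finset.mem_singleton] at hv
        simp [hv]
    · exact List.mem_cons_of_mem _ (mem_of_mem_sides (y :: p) he v hv)
  | [], e, he, v, hv => by simp [sides] at he
  | [_], e, he, v, hv => by simp [sides] at he

theorem exists_append_of_mem_sides : ∀ (p : List V) {e : Finset V}, e ∈ sides p →
    ∃ s x y q, p = s ++ x :: y :: q ∧ e = {x, y}
  | x :: y :: p, e, he => by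
    rw [sides_cons_cons, List.mem_cons] at he
    rcases he with rfl | he
    · exact ⟨[], x, y, p, rfl, rfl⟩
    · obtain ⟨s, u, v, q, h1, h2⟩ := exists_append_of_mem_sides (y :: p) he
      exact ⟨x :: s, u, v, q, by rw [h1]; rfl, h2⟩
  | [], e, he => by simp [sides] at he
  | [_], e, he => by simp [sides] at he

end Sides

end

end TuraevViro

namespace TuraevViro

noncomputable section

/-! ### Triangulated spheres as incidence data -/

section Surface

variable {V : Type*} [DecidableEq V]

/-- A combinatorial closed connected surface of Euler characteristic two. -/
structure IsSphereData (verts : Finset V) (edges tris : Finset (Finset V)) : Prop where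
  card_edge : ∀ e ∈ edges, e.card = 2
  card_tri : ∀ t ∈ tris, t.card = 3
  edge_of_subset : ∀ t ∈ tris, ∀ e ⊆ t, e.card = 2 → e ∈ edges
  two : ∀ e ∈ edges, (tris.filter fun t => e ⊆ t).card = 2
  tri_subset : ∀ t ∈ tris, t ⊆ verts
  cover : ∀ v ∈ verts, ∃ t ∈ tris, v ∈ t
  conn : ∀ A ⊆ tris, A.Nonempty →
    (∀ e ∈ edges, ∀ t ∈ A, ∀ t' ∈ tris, e ⊆ t → e ⊆ t' → t' ∈ A) → A = tris
  euler : verts.card + tris.card = edges.card + 2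

variable {verts : Finset V} {edges tris : Finset (Finset V)}

theorem IsSphereData.sum_card (h : IsSphereData verts edges tris) {A : Finset (Finset V)}
    (hA : A ⊆ tris) (P : Finset V → Prop) [DecidablePred P] (n : ℕ)
    (hP : ∀ t ∈ A, ((t.powersetCard 2).filter P).card = n ∨
      ((t.powersetCard 2).filter P).card = 0) :
    n ∣ ∑ e ∈ edges.filter P, (A.filter fun t => e ⊆ t).card := by
  have h1 : ∑ e ∈ edges.filter P, (A.filter fun t => e ⊆ t).card =
      ∑ t ∈ A, ((edges.filter P).filter fun e => e ⊆ t).card := by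
    simp only [Finset.card_filter]
    exact Finset.sum_comm
  rw [h1]
  refine Finset.dvd_sum fun t ht => ?_
  have h2 : (edges.filter P).filter (fun e => e ⊆ t) = (t.powersetCard 2).filter P := by
    ext e
    simp only [Finset.mem_filter, Finset.mem_powersetCard]
    exact ⟨fun ⟨⟨h1, h2⟩, h3⟩ => ⟨⟨h3, h.card_edge e h1⟩, h2⟩,
      fun ⟨⟨h1, h2⟩, h3⟩ => ⟨⟨h.edge_of_subset t (hA ht) e h1 h2, h3⟩, h1⟩⟩
  rw [h2]
  rcases hP t ht with h3 | h3 <;> rw [h3]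
  exact dvd_zero n

theorem IsSphereData.two_mul_card (h : IsSphereData verts edges tris) :
    2 * edges.card = 3 * tris.card := by
  have h1 : ∑ e ∈ edges, (tris.filter fun t => e ⊆ t).card =
      ∑ t ∈ tris, (edges.filter fun e => e ⊆ t).card := by
    simp only [Finset.card_filter]
    exact Finset.sum_comm
  rw [Finset.sum_congr rfl h.two, Finset.sum_const] at h1
  have h2 : ∀ t ∈ tris, (edges.filter fun e => e ⊆ t).card = 3 := by
    intro t ht
    have : edges.filter (fun e => e ⊆ t) = t.powersetCard 2 := by
      ext e
      simp only [Finset.mem_filter, Finset.mem_powersetCard]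
      exact ⟨fun ⟨h1, h3⟩ => ⟨h3, h.card_edge e h1⟩,
        fun ⟨h1, h2⟩ => ⟨h.edge_of_subset t ht e h1 h2, h1⟩⟩
    rw [this, Finset.card_powersetCard, h.card_tri t ht]
    rfl
  rw [Finset.sum_congr rfl h2, Finset.sum_const] at h1
  simp only [smul_eq_mul] at h1
  omega

/-- A proper nonempty set of triangles has a neighbour across an edge other than a given one. -/
theorem IsSphereData.exists_adjacent (h : IsSphereData verts edges tris) {A : Finset (Finset V)}
    (hA : A ⊆ tris) (hne : A ≠ tris) {x₀ x₁ : V} (h01 : {x₀, x₁} ∈ edges)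
    {t₁ : Finset V} (ht₁ : t₁ ∈ A) (h01t : {x₀, x₁} ⊆ t₁) :
    ∃ e ∈ edges, e ≠ {x₀, x₁} ∧ ∃ t ∈ A, ∃ t' ∈ tris, t' ∉ A ∧ e ⊆ t ∧ e ⊆ t' := by
  by_contra hc
  push Not at hc
  have hfull : ∀ e ∈ edges, ∀ t ∈ A, e ⊆ t →
      (∀ t' ∈ tris, e ⊆ t' → t' ∈ A) → (A.filter fun t => e ⊆ t).card = 2 := by
    intro e he t ht het hall
    rw [← h.two e he]
    congr 1
    ext t'
    simp only [Finset.mem_filter]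
    exact ⟨fun ⟨a, b⟩ => ⟨hA a, b⟩, fun ⟨a, b⟩ => ⟨hall t' a b, b⟩⟩
  have hother : ∀ e ∈ edges, e ≠ {x₀, x₁} → 2 ∣ (A.filter fun t => e ⊆ t).card := by
    intro e he hne
    rcases Finset.eq_empty_or_nonempty (A.filter fun t => e ⊆ t) with h0 | ⟨t, ht⟩
    · rw [h0]
      simp
    · rw [Finset.mem_filter] at ht
      rw [hfull e he t ht.1 ht.2 fun t' ht' het' => by
        by_contra hn
        exact hc e he hne t ht.1 t' ht' hn ht.2 het']
  -- Parity at `x₀`: a triangle has two or no edges through `x₀`, so the numbers of triangles of `A`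
  -- on the edges through `x₀` have an even sum.
  have hsum := h.sum_card hA (fun e => x₀ ∈ e) 2 (by
    intro t ht
    by_cases hx : x₀ ∈ t
    · left
      have : (t.powersetCard 2).filter (fun e => x₀ ∈ e) = (t.erase x₀).image fun y => {x₀, y} := by
        ext e
        simp only [Finset.mem_filter, Finset.mem_powersetCard, Finset.mem_image, Finset.mem_erase]
        constructor
        · rintro ⟨⟨h1, h2⟩, h3⟩
          obtain ⟨y, hy⟩ := Finset.card_eq_one.1
            (show (e.erase x₀).card = 1 by rw [Finset.card_erase_of_mem h3, h2])
          have hye : y ∈ e.erase x₀ := by rw [hy]; simp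
          rw [Finset.mem_erase] at hye
          exact ⟨y, ⟨hye.1, h1 hye.2⟩, by rw [← hy, Finset.insert_erase h3]⟩
        · rintro ⟨y, ⟨h1, h2⟩, rfl⟩
          refine ⟨⟨?_, Finset.card_pair (Ne.symm h1)⟩, by simp⟩
          intro u hu
          simp only [Finset.mem_insert, Finset.mem_singleton] at hu
          rcases hu with rfl | rfl <;> assumption
      rw [this, Finset.card_image_of_injOn, Finset.card_erase_of_mem hx, h.card_tri t (hA ht)]
      intro y hy z hz hyz
      simp only [Finset.coe_erase, Set.mem_sdiff, Set.mem_singleton_iff] at hy hz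
      have : y ∈ ({x₀, z} : Finset V) := by
        rw [← show ({x₀, y} : Finset V) = {x₀, z} from hyz]
        simp
      simp only [Finset.mem_insert, Finset.mem_singleton] at this
      tauto
    · right
      rw [Finset.card_eq_zero, Finset.filter_eq_empty_iff]
      intro e he hxe
      rw [Finset.mem_powersetCard] at he
      exact hx (he.1 hxe))
  have h01f : ({x₀, x₁} : Finset V) ∈ edges.filter fun e => x₀ ∈ e := by simp [h01]
  rw [← Finset.add_sum_erase _ _ h01f] at hsum
  have hrest : 2 ∣ ∑ e ∈ (edges.filter fun e => x₀ ∈ e).erase {x₀, x₁},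
      (A.filter fun t => e ⊆ t).card :=
    Finset.dvd_sum fun e he => by
      rw [Finset.mem_erase, Finset.mem_filter] at he
      exact hother e he.2.1 he.1
  -- All other edges have an even number of triangles in `A`, so `{x₀, x₁}` has too. As `t₁` is one
  -- of them, both its triangles are in `A`; then `A` is closed under adjacency across every edge,
  -- and connectedness gives `A = tris`.
  have heven : 2 ∣ (A.filter fun t => {x₀, x₁} ⊆ t).card := (Nat.dvd_add_left hrest).1 hsum
  have hpos : 0 < (A.filter fun t => {x₀, x₁} ⊆ t).card :=
    Finset.card_pos.2 ⟨t₁, Finset.mem_filter.2 ⟨ht₁, h01t⟩⟩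
  have hle : (A.filter fun t => {x₀, x₁} ⊆ t) ⊆ tris.filter fun t => {x₀, x₁} ⊆ t :=
    Finset.filter_subset_filter _ hA
  have heq : (A.filter fun t => {x₀, x₁} ⊆ t) = tris.filter fun t => {x₀, x₁} ⊆ t :=
    Finset.eq_of_subset_of_card_le hle (by
      rw [h.two _ h01]
      exact Nat.le_of_dvd hpos heven)
  refine hne (h.conn A hA ⟨t₁, ht₁⟩ fun e he t ht t' ht' het het' => ?_)
  by_cases h01e : e = {x₀, x₁}
  · subst h01e
    have : t' ∈ A.filter fun t => {x₀, x₁} ⊆ t := by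
      rw [heq]
      exact Finset.mem_filter.2 ⟨ht', het'⟩
    exact (Finset.mem_filter.1 this).1
  · by_contra hn
    exact hc e he h01e t ht t' ht' hn het het'

end Surface

/-! ### State sums with some vertex labels summed -/

section PartialSum

variable {V ι : Type*} [Fintype V] [DecidableEq V] [Fintype ι] [DecidableEq ι]

/-- The labellings that agree with `γ` outside `S`. -/
def agreeing (γ : V → ι) (S : Finset V) : Finset (V → ι) :=
  Finset.univ.filter fun g => ∀ u, u ∉ S → g u = γ u

/-- The sum over all labellings of the vertices in `S`, the other labels being given by `γ`, of
the product of the vertex weights of `S`, the edge weights of `C` and the triangle weights of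
`A`. -/
def partialSum (d : ι → ℂ) (Ew Tw : Finset V → (V → ι) → ℂ) (S : Finset V)
    (C A : Finset (Finset V)) (γ : V → ι) : ℂ :=
  ∑ g ∈ agreeing γ S, (∏ x ∈ S, d (g x)) * ((∏ e ∈ C, Ew e g) * ∏ t ∈ A, Tw t g)

theorem partialSum_empty (d : ι → ℂ) (Ew Tw : Finset V → (V → ι) → ℂ) (C A : Finset (Finset V))
    (γ : V → ι) : partialSum d Ew Tw ∅ C A γ = (∏ e ∈ C, Ew e γ) * ∏ t ∈ A, Tw t γ := by
  have : agreeing γ ∅ = {γ} := by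
    ext g
    simp [agreeing, funext_iff]
  rw [partialSum, this]
  simp

/-- The label `ξ` of `x` is summed last. Both ends of the edge have fixed labels in the inner sum,
since neither lies in `S`, so its weight comes out. -/
theorem partialSum_insert (d : ι → ℂ) (Ew Tw : Finset V → (V → ι) → ℂ) {S : Finset V}
    {C A : Finset (Finset V)} (γ : V → ι) {x y : V} (hx : x ∉ S) (hy : y ∉ S) (hxy : y ≠ x)
    {e : Finset V} (he : e ∉ C) (f : ι → ι → ℂ) (hf : ∀ g, Ew e g = f (g y) (g x)) :
    partialSum d Ew Tw (insert x S) (insert e C) A γ =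
      ∑ ξ, d ξ * f (γ y) ξ * partialSum d Ew Tw S C A (Function.update γ x ξ) := by
  rw [partialSum, ← Finset.sum_fiberwise _ fun g => g x]
  refine Finset.sum_congr rfl fun ξ _ => ?_
  have : (agreeing γ (insert x S)).filter (fun g => g x = ξ) =
      agreeing (Function.update γ x ξ) S := by
    ext g
    simp only [agreeing, Finset.mem_filter, Finset.mem_univ, true_and, Finset.mem_insert, not_or]
    constructor
    · rintro ⟨h1, h2⟩ u hu
      by_cases hux : u = x
      · subst hux
        rw [Function.update_self, h2]
      · rw [Function.update_of_ne hux]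
        exact h1 u ⟨hux, hu⟩
    · intro h
      refine ⟨fun u hu => ?_, ?_⟩
      · rw [h u hu.2, Function.update_of_ne hu.1]
      · rw [h x hx, Function.update_self]
  rw [this, partialSum, Finset.mul_sum]
  refine Finset.sum_congr rfl fun g hg => ?_
  simp only [agreeing, Finset.mem_filter, Finset.mem_univ, true_and] at hg
  have h1 : g x = ξ := by rw [hg x hx, Function.update_self]
  have h2 : g y = γ y := by rw [hg y hy, Function.update_of_ne hxy]
  rw [Finset.prod_insert hx, Finset.prod_insert he, hf, h1, h2]
  ring

end PartialSum

section Triple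

variable {V : Type*} [DecidableEq V]

theorem subset_triple_iff {x z y : V} {e : Finset V} (he : e.card = 2) :
    e ⊆ {x, z, y} → e = {x, y} ∨ e = {x, z} ∨ e = {z, y} := by
  obtain ⟨a, b, hab, rfl⟩ := Finset.card_eq_two.1 he
  intro h
  have ha : a ∈ ({x, z, y} : Finset V) := h (by simp)
  have hb : b ∈ ({x, z, y} : Finset V) := h (by simp)
  simp only [Finset.mem_insert, Finset.mem_singleton] at ha hb
  rcases ha with rfl | rfl | rfl <;> rcases hb with rfl | rfl | rfl <;>
    simp_all [Finset.pair_comm]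

theorem ne_of_card {x z y : V} (h : ({x, z, y} : Finset V).card = 3) :
    x ≠ z ∧ x ≠ y ∧ z ≠ y := by
  have hcard : ∀ a b : V, ({x, z, y} : Finset V) ≠ {a, b} := by
    intro a b hab
    rw [hab] at h
    exact absurd (Finset.card_le_two (a := a) (b := b)) (by omega)
  refine ⟨?_, ?_, ?_⟩
  · rintro rfl
    exact hcard x y (by simp)
  · rintro rfl
    exact hcard x z (by ext; simp; tauto)
  · rintro rfl
    exact hcard x z (by simp)

theorem ite_subset_triple {x z y : V} (h : ({x, z, y} : Finset V).card = 3) {e : Finset V}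
    (he : e.card = 2) :
    (if e ⊆ {x, z, y} then 1 else 0) = (if e = {x, y} then 1 else 0) +
      (if e = {x, z} then 1 else 0) + (if e = {z, y} then 1 else 0) := by
  obtain ⟨hxz, hxy, hzy⟩ := ne_of_card h
  have key : ∀ {a b c : V}, c ≠ a → c ≠ b → ∀ d : V, ({a, b} : Finset V) ≠ {c, d} := by
    intro a b c h1 h2 d h3
    have : c ∈ ({a, b} : Finset V) := by rw [h3]; simp
    simp only [Finset.mem_insert, Finset.mem_singleton] at this
    tauto
  by_cases hs : e ⊆ {x, z, y}
  · rw [if_pos hs]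
    rcases subset_triple_iff he hs with rfl | rfl | rfl
    · rw [if_pos rfl, if_neg, if_neg (key hxz.symm hzy _)]
      rw [Finset.pair_comm x z]
      exact key hxz.symm hzy _
    · rw [if_pos rfl, if_neg, if_neg]
      · rw [Finset.pair_comm z y]
        exact key hxy.symm hzy.symm _
      · rw [Finset.pair_comm x y]
        exact key hxy.symm hzy.symm _
    · rw [if_pos rfl, if_neg (key hxz hxy _), if_neg (key hxz hxy _)]
  · rw [if_neg hs, if_neg, if_neg, if_neg]
    all_goals
      rintro rfl
      refine hs fun u hu => ?_
      simp only [Finset.mem_insert, Finset.mem_singleton] at hu ⊢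
      tauto

theorem exists_eq_insert_pair {x y : V} {t : Finset V} (ht : t.card = 3) (hxy : x ≠ y)
    (h : {x, y} ⊆ t) : ∃ z, t = {x, z, y} := by
  obtain ⟨z, hz⟩ := Finset.card_eq_one.1 (show (t \ {x, y}).card = 1 by
    rw [Finset.card_sdiff_of_subset h, ht, Finset.card_pair hxy])
  refine ⟨z, ?_⟩
  rw [← Finset.sdiff_union_of_subset h, hz]
  ext u
  simp only [Finset.mem_union, Finset.mem_insert, Finset.mem_singleton]
  tauto

end Triple

/-! ### Growing a disc until it contains all triangles -/

section Growth

variable {V ι : Type*} [Fintype V] [DecidableEq V] [Fintype ι] [DecidableEq ι]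

variable (E : V → V → ι → ι → ℂ) (T : V → V → V → ι → ι → ι → ℂ) (d : ι → ℂ)
  (Ew Tw : Finset V → (V → ι) → ℂ) (verts : Finset V) (edges tris : Finset (Finset V)) (x₀ x₁ : V)

/-- A stage of the growth of a disc in a triangulated sphere. -/
structure GrowState (A C : Finset (Finset V)) (p : List V)
    (L : (List ι → ℂ) → List ι → ℂ) : Prop where
  evolves : Evolves E T d (fun x y => {x, y} ∈ edges) (fun x z y => {x, z, y} ∈ tris) x₀ x₁ p L
  -- No label has been summed yet, so `L` multiplies by the weights collected so far; `Φ` sees only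
  -- the two end labels.
  track : ∀ Φ γ, L Φ (p.map γ) = Φ [γ x₀, γ x₁] * partialSum d Ew Tw ∅ C A γ
  A_sub : A ⊆ tris
  C_sub : C ⊆ edges
  mem_C : {x₀, x₁} ∈ C
  head : p.head? = some x₀
  last : p.getLast? = some x₁
  length : p.length = A.card + 2
  sides_sub : ∀ e ∈ sides p, e ∈ edges
  -- Every incidence of an edge with a triangle of `A` is either still a side of the walk or used
  -- up: two incidences for an edge across which the disc has grown, one for `{x₀, x₁}`, from which
  -- it started.
  count : ∀ e ∈ edges, (sides p).count e + (if e = {x₀, x₁} then 1 else if e ∈ C then 2 else 0) =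
    (A.filter fun t => e ⊆ t).card
  cover : ∀ t ∈ A, ∀ v ∈ t, v ∈ p
  sub : ∀ v ∈ p, v ∈ verts

variable {E T d Ew Tw verts edges tris x₀ x₁}

theorem exists_growState_singleton (hS : IsSphereData verts edges tris)
    (hEw : ∀ x y, {x, y} ∈ edges → ∀ g, Ew {x, y} g = E x y (g x) (g y))
    (hTw : ∀ x z y, {x, z, y} ∈ tris → ∀ g, Tw {x, z, y} g = T x z y (g x) (g z) (g y))
    (h01 : {x₀, x₁} ∈ edges) :
    ∃ t ∈ tris, {x₀, x₁} ⊆ t ∧ ∃ C p L, GrowState E T d Ew Tw verts edges tris x₀ x₁ {t} C p L := by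
  have hne : x₀ ≠ x₁ := by
    rintro rfl
    have := hS.card_edge _ h01
    simp at this
  obtain ⟨t, ht⟩ := Finset.card_pos.1 (show 0 < (tris.filter fun t => {x₀, x₁} ⊆ t).card by
    rw [hS.two _ h01]; norm_num)
  rw [Finset.mem_filter] at ht
  obtain ⟨ht, hst⟩ := ht
  have h3 := hS.card_tri t ht
  obtain ⟨z, rfl⟩ := exists_eq_insert_pair h3 hne hst
  refine ⟨_, ht, hst, {{x₀, x₁}}, [x₀, z, x₁], _,
    Evolves.grow (s := []) (q := []) ht Evolves.base, ?_, by simpa using ht, by simpa using h01,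
    by simp, rfl, rfl, by simp, ?_, ?_, ?_, ?_⟩
  · intro Φ γ
    have := growAt_append (E x₀ x₁) (T x₀ z x₁) [] (γ x₀) (γ z) (γ x₁) [] Φ
    simp only [List.nil_append, List.length_nil] at this
    rw [partialSum_empty, Finset.prod_singleton, Finset.prod_singleton, hEw _ _ h01, hTw _ _ _ ht]
    exact this
  · intro e he
    simp only [sides, List.mem_cons, List.not_mem_nil, or_false] at he
    rcases he with rfl | rfl
    · exact hS.edge_of_subset _ ht _ (by intro u; simp; tauto) (Finset.card_pair (ne_of_card h3).1)
    · exact hS.edge_of_subset _ ht _ (by intro u; simp; tauto)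
        (Finset.card_pair (ne_of_card h3).2.2)
  · intro e he
    rw [Finset.card_filter, Finset.sum_singleton, ite_subset_triple h3 (hS.card_edge e he)]
    simp only [sides, List.count_cons, List.count_nil, beq_iff_eq, Finset.mem_singleton]
    simp only [eq_comm (b := e)]
    split_ifs <;> omega
  · intro t ht v hv
    rw [Finset.mem_singleton] at ht
    subst ht
    simpa using hv
  · intro v hv
    exact hS.tri_subset _ ht (by simpa using hv)

/-- The disc grows across the edge supplied by `exists_adjacent`. Avoiding `{x₀, x₁}` ensures that
this edge is not used a second time for growth. -/
theorem GrowState.exists_insert (hS : IsSphereData verts edges tris)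
    (hEw : ∀ x y, {x, y} ∈ edges → ∀ g, Ew {x, y} g = E x y (g x) (g y))
    (hTw : ∀ x z y, {x, z, y} ∈ tris → ∀ g, Tw {x, z, y} g = T x z y (g x) (g z) (g y))
    {A C : Finset (Finset V)} {p : List V} {L : (List ι → ℂ) → List ι → ℂ}
    (h : GrowState E T d Ew Tw verts edges tris x₀ x₁ A C p L) (hA : A ≠ tris)
    {t₁ : Finset V} (ht₁ : t₁ ∈ A) (h01t : {x₀, x₁} ⊆ t₁) :
    ∃ t ∈ tris, t ∉ A ∧ ∃ C p L,
      GrowState E T d Ew Tw verts edges tris x₀ x₁ (insert t A) C p L := by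
  obtain ⟨e, he, hne, t, ht, t', ht', htA, het, het'⟩ :=
    hS.exists_adjacent h.A_sub hA (h.C_sub h.mem_C) ht₁ h01t
  have h1 : 0 < (A.filter fun t => e ⊆ t).card :=
    Finset.card_pos.2 ⟨t, Finset.mem_filter.2 ⟨ht, het⟩⟩
  have h2 : (A.filter fun t => e ⊆ t).card < 2 := by
    rw [← hS.two e he]
    refine Finset.card_lt_card ⟨Finset.filter_subset_filter _ h.A_sub, fun hs => htA ?_⟩
    exact (Finset.mem_filter.1 (hs (Finset.mem_filter.2 ⟨ht', het'⟩))).1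
  have h3 := h.count e he
  rw [if_neg hne] at h3
  -- Exactly one triangle of `A` contains `e`, whereas an edge of `C` other than `{x₀, x₁}` would
  -- have two. So `e` is a side of the walk, and the new triangle can be inserted there.
  have heC : e ∉ C := by
    intro hC
    rw [if_pos hC] at h3
    omega
  rw [if_neg heC] at h3
  obtain ⟨s, x, y, q, rfl, rfl⟩ := exists_append_of_mem_sides p
    (List.count_pos_iff.1 (show 0 < (sides p).count e by omega))
  have hc3 := hS.card_tri t' ht'
  have hxy : x ≠ y := by
    rintro rfl
    have := hS.card_edge _ he
    simp at this
  obtain ⟨z, rfl⟩ := exists_eq_insert_pair hc3 hxy het'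
  refine ⟨_, ht', htA, insert {x, y} C, s ++ x :: z :: y :: q, _,
    Evolves.grow ht' h.evolves, ?_, ?_, ?_, ?_, ?_, ?_, ?_, ?_, ?_, ?_, ?_⟩
  · intro Φ γ
    have h4 := growAt_append (E x y) (T x z y) (s.map γ) (γ x) (γ z) (γ y) (q.map γ) (L Φ)
    have h5 := h.track Φ γ
    simp only [List.map_append, List.map_cons, List.length_map] at h4 h5 ⊢
    rw [h4, h5, partialSum_empty, partialSum_empty, Finset.prod_insert heC,
      Finset.prod_insert htA, hEw _ _ he, hTw _ _ _ ht']
    ring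
  · exact Finset.insert_subset ht' h.A_sub
  · exact Finset.insert_subset he h.C_sub
  · exact Finset.mem_insert_of_mem h.mem_C
  · have := h.head
    cases s <;> simpa using this
  · have := h.last
    simpa [List.getLast?_append, List.getLast?_cons_cons] using this
  · have := h.length
    rw [Finset.card_insert_of_notMem htA]
    simp only [List.length_append, List.length_cons] at this ⊢
    omega
  · intro e' he'
    have h4 := h.sides_sub
    rw [sides_append, sides_cons_cons] at h4
    rw [sides_append, sides_cons_cons, sides_cons_cons] at he'
    simp only [List.mem_append, List.mem_cons] at h4 he'
    rcases he' with he' | rfl | rfl | he'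
    · exact h4 _ (Or.inl he')
    · exact hS.edge_of_subset _ ht' _ (by intro u; simp; tauto) (Finset.card_pair (ne_of_card hc3).1)
    · exact hS.edge_of_subset _ ht' _ (by intro u; simp; tauto)
        (Finset.card_pair (ne_of_card hc3).2.2)
    · exact h4 _ (Or.inr (Or.inr he'))
  · intro e' he'
    have h4 := h.count e' he'
    rw [Finset.filter_insert]
    have h5 : ((if e' ⊆ {x, z, y} then insert {x, z, y} (A.filter fun t => e' ⊆ t)
        else A.filter fun t => e' ⊆ t).card) =
        (A.filter fun t => e' ⊆ t).card + if e' ⊆ {x, z, y} then 1 else 0 := by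
      split_ifs
      · rw [Finset.card_insert_of_notMem]
        simp [htA]
      · rfl
    rw [h5, ite_subset_triple hc3 (hS.card_edge e' he'), ← h4, sides_append, sides_cons_cons,
      sides_cons_cons, sides_append x (y :: q), sides_cons_cons]
    simp only [List.count_append, List.count_cons, beq_iff_eq, Finset.mem_insert]
    simp only [eq_comm (b := e')]
    by_cases hee : e' = {x, y}
    · subst hee
      simp only [hne, heC, if_true, if_false, true_or]
      omega
    · simp only [hee, false_or, if_false]
      omega
  · intro t ht v hv
    rcases Finset.mem_insert.1 ht with rfl | ht
    · simp only [Finset.mem_insert, Finset.mem_singleton] at hv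
      simp only [List.mem_append, List.mem_cons]
      tauto
    · have := h.cover t ht v hv
      simp only [List.mem_append, List.mem_cons] at this ⊢
      tauto
  · intro v hv
    have h4 := h.sub
    simp only [List.mem_append, List.mem_cons] at hv h4
    rcases hv with hv | rfl | rfl | rfl | hv
    · exact h4 _ (Or.inl hv)
    · exact h4 _ (Or.inr (Or.inl rfl))
    · exact hS.tri_subset _ ht' (by simp)
    · exact h4 _ (Or.inr (Or.inr (Or.inl rfl)))
    · exact h4 _ (Or.inr (Or.inr (Or.inr hv)))

theorem exists_growState (hS : IsSphereData verts edges tris)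
    (hEw : ∀ x y, {x, y} ∈ edges → ∀ g, Ew {x, y} g = E x y (g x) (g y))
    (hTw : ∀ x z y, {x, z, y} ∈ tris → ∀ g, Tw {x, z, y} g = T x z y (g x) (g z) (g y))
    (h01 : {x₀, x₁} ∈ edges) :
    ∃ C p L, GrowState E T d Ew Tw verts edges tris x₀ x₁ tris C p L := by
  obtain ⟨t₁, ht₁, h01t, C, p, L, h⟩ := exists_growState_singleton (d := d) hS hEw hTw h01
  have key : ∀ n, ∀ A C p L, GrowState E T d Ew Tw verts edges tris x₀ x₁ A C p L → t₁ ∈ A →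
      (tris \ A).card = n → ∃ C p L, GrowState E T d Ew Tw verts edges tris x₀ x₁ tris C p L := by
    intro n
    induction n with
    | zero =>
      intro A C p L h _ h0
      have : A = tris := h.A_sub.antisymm (Finset.sdiff_eq_empty_iff_subset.1
        (Finset.card_eq_zero.1 h0))
      subst this
      exact ⟨C, p, L, h⟩
    | succ n ih =>
      intro A C p L h htA hn
      have hne : A ≠ tris := by
        rintro rfl
        simp at hn
      obtain ⟨t, ht, htn, C', p', L', h'⟩ := h.exists_insert hS hEw hTw hne htA h01t
      refine ih _ C' p' L' h' (Finset.mem_insert_of_mem htA) ?_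
      rw [Finset.sdiff_insert, Finset.card_erase_of_mem (Finset.mem_sdiff.2 ⟨ht, htn⟩), hn]
      rfl
  exact key _ {t₁} C p L h (Finset.mem_singleton_self _) rfl

end Growth

/-! ### Vertices that a walk visits once -/

section Walks

variable {V : Type*} [DecidableEq V] {x₀ x₁ : V}

/-- The head `x₀` does not recur, so the side `{x₀, x₁}` is the first one; the last vertex `x₁` does
not recur, so the walk stops there. -/
theorem eq_pair_of_count_eq_one {p : List V} (hne : x₀ ≠ x₁) (hhead : p.head? = some x₀)
    (hlast : p.getLast? = some x₁) (h0 : p.count x₀ = 1) (h1 : p.count x₁ = 1)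
    (he : {x₀, x₁} ∈ sides p) : p = [x₀, x₁] := by
  match p, hhead with
  | [], hhead => simp at hhead
  | [x], hhead => simp [sides] at he
  | x :: y :: q, hhead =>
    obtain rfl : x = x₀ := by simpa using hhead
    rw [List.count_cons_self] at h0
    have hx : x ∉ y :: q := List.count_eq_zero.1 (by omega)
    rw [sides_cons_cons, List.mem_cons] at he
    have hy : x₁ = y := by
      rcases he with he | he
      · have : x₁ ∈ ({x, y} : Finset V) := by rw [← he]; simp
        simp only [Finset.mem_insert, Finset.mem_singleton] at this
        rcases this with h | h
        · exact absurd h.symm hne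
        · exact h
      · exact absurd (mem_of_mem_sides _ he x (by simp)) hx
    subst hy
    rw [List.count_cons_of_ne hne, List.count_cons_self] at h1
    have hy : x₁ ∉ q := List.count_eq_zero.1 (by omega)
    cases q with
    | nil => rfl
    | cons z q =>
      refine absurd (List.mem_of_getLast? ?_) hy
      simpa [List.getLast?_cons_cons] using hlast

theorem exists_append_of_count_eq_one {p : List V} (hhead : p.head? = some x₀)
    (hlast : p.getLast? = some x₁) {x : V} (hx0 : x ≠ x₀) (hx1 : x ≠ x₁) (hx : p.count x = 1) :
    ∃ s y z q, p = s ++ y :: x :: z :: q ∧ x ∉ s ∧ x ≠ y ∧ x ≠ z ∧ x ∉ q := by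
  obtain ⟨s, t, rfl⟩ := List.append_of_mem (List.count_pos_iff.1 (by omega : 0 < p.count x))
  rw [List.count_append, List.count_cons_self] at hx
  have hs : x ∉ s := List.count_eq_zero.1 (by omega)
  have ht : x ∉ t := List.count_eq_zero.1 (by omega)
  rcases s.eq_nil_or_concat with rfl | ⟨s, y, rfl⟩
  · simp at hhead
    exact absurd hhead hx0
  cases t with
  | nil =>
    simp at hlast
    exact absurd hlast hx1
  | cons z q =>
    simp only [List.concat_eq_append, List.mem_append, not_or,
      List.mem_cons] at hs ht
    exact ⟨s, y, z, q, by simp, hs.1, hs.2.1, ht.1, ht.2⟩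

end Walks

/-! ### Folding the boundary of the disc -/

section Folding

variable {V ι : Type*} [Fintype V] [DecidableEq V] [Fintype ι] [DecidableEq ι]

variable (E : V → V → ι → ι → ℂ) (T : V → V → V → ι → ι → ι → ℂ) (d : ι → ℂ)
  (Ew Tw : Finset V → (V → ι) → ℂ) (verts : Finset V) (edges tris : Finset (Finset V)) (x₀ x₁ : V)

/-- A stage of the folding of the boundary of the disc obtained by cutting a triangulated sphere
open. -/
structure FoldState (S : Finset V) (C : Finset (Finset V)) (p : List V)
    (L : (List ι → ℂ) → List ι → ℂ) : Prop where
  evolves : Evolves E T d (fun x y => {x, y} ∈ edges) (fun x z y => {x, z, y} ∈ tris) x₀ x₁ p L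
  track : ∀ Φ γ, L Φ (p.map γ) = Φ [γ x₀, γ x₁] * partialSum d Ew Tw S C tris γ
  C_sub : C ⊆ edges
  mem_C : {x₀, x₁} ∈ C
  head : p.head? = some x₀
  last : p.getLast? = some x₁
  -- The count for a walk around a tree on the vertices outside `S` that passes every edge twice,
  -- except that `{x₀, x₁}` is passed only once.
  length : p.length + 2 * S.card + 2 = 2 * verts.card
  sides_sub : ∀ e ∈ sides p, e ∈ edges
  count : ∀ e ∈ edges, (sides p).count e = if e = {x₀, x₁} then 1 else if e ∈ C then 0 else 2
  cover : ∀ v, v ∈ verts ↔ v ∈ p ∨ v ∈ S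
  disj : ∀ v ∈ S, v ∉ p

variable {E T d Ew Tw verts edges tris x₀ x₁}

/-- Here the Euler characteristic enters: `2E = 3F` and `V + F = E + 2` turn the length `F + 2` of
the walk into `2V - 2`. -/
theorem GrowState.foldState (hS : IsSphereData verts edges tris)
    {C : Finset (Finset V)} {p : List V} {L : (List ι → ℂ) → List ι → ℂ}
    (h : GrowState E T d Ew Tw verts edges tris x₀ x₁ tris C p L) :
    FoldState E T d Ew Tw verts edges tris x₀ x₁ ∅ C p L := by
  refine ⟨h.evolves, h.track, h.C_sub, h.mem_C, h.head, h.last, ?_, h.sides_sub, ?_, ?_, by simp⟩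
  · have h1 := h.length
    have h2 := hS.two_mul_card
    have h3 := hS.euler
    rw [Finset.card_empty]
    omega
  · intro e he
    have h1 := h.count e he
    rw [hS.two e he] at h1
    split_ifs at h1 ⊢ <;> omega
  · intro v
    constructor
    · intro hv
      obtain ⟨t, ht, hvt⟩ := hS.cover v hv
      exact Or.inl (h.cover t ht v hvt)
    · rintro (hv | hv)
      · exact h.sub v hv
      · simp at hv

/-- The walk on `k` distinct vertices has length `2k - 2`. If every vertex other than `x₀`, `x₁`
occurred at least twice, then `x₀` and `x₁` would occur once each, and the walk would be `[x₀, x₁]`.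
-/
theorem FoldState.exists_count_eq_one
    {S : Finset V} {C : Finset (Finset V)} {p : List V} {L : (List ι → ℂ) → List ι → ℂ}
    (h : FoldState E T d Ew Tw verts edges tris x₀ x₁ S C p L) (hne : x₀ ≠ x₁)
    (hp : 2 < p.length) : ∃ x, x ≠ x₀ ∧ x ≠ x₁ ∧ p.count x = 1 := by
  by_contra hc
  push Not at hc
  have hx0 : x₀ ∈ p := List.mem_of_head? h.head
  have hx1 : x₁ ∈ p := List.mem_of_getLast? h.last
  have hcard : verts.card = p.toFinset.card + S.card := by
    rw [← Finset.card_union_of_disjoint]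
    · congr 1
      ext v
      rw [h.cover v]
      simp
    · rw [Finset.disjoint_left]
      intro v hv hvS
      exact h.disj v hvS (by simpa using hv)
  have hsum := p.sum_toFinset_count_eq_length
  have hm1 : x₁ ∈ p.toFinset.erase x₀ := by simp [hx1, hne.symm]
  have hm0 : x₀ ∈ p.toFinset := by simpa using hx0
  rw [← Finset.add_sum_erase _ _ hm0, ← Finset.add_sum_erase _ _ hm1] at hsum
  have hle : ((p.toFinset.erase x₀).erase x₁).card • 2 ≤
      ∑ x ∈ (p.toFinset.erase x₀).erase x₁, p.count x := by
    refine Finset.card_nsmul_le_sum _ _ _ fun x hx => ?_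
    simp only [Finset.mem_erase, List.mem_toFinset] at hx
    have h1 := hc x hx.2.1 hx.1
    have h2 := List.count_pos_iff.2 hx.2.2
    omega
  rw [Finset.card_erase_of_mem hm1, Finset.card_erase_of_mem hm0, smul_eq_mul] at hle
  have h0 := List.count_pos_iff.2 hx0
  have h1 := List.count_pos_iff.2 hx1
  have hlen := h.length
  have hpos : 0 < (p.toFinset.erase x₀).card := Finset.card_pos.2 ⟨_, hm1⟩
  rw [Finset.card_erase_of_mem hm0] at hpos
  have hp2 := eq_pair_of_count_eq_one hne h.head h.last (by omega) (by omega) (by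
    rw [← List.count_pos_iff, h.count _ (h.C_sub h.mem_C), if_pos rfl]
    exact one_pos)
  rw [hp2] at hp
  simp at hp

/-- A vertex `x` visited once is a leaf: the side `{y, x}` is not yet in `C`, so it occurs twice,
and only the two sides next to `x` contain `x`. Hence the walk reads `y, x, y` there and can be
folded, which sums over the label of `x`. -/
theorem FoldState.exists_fold
    (hEw : ∀ x y, {x, y} ∈ edges → ∀ g, Ew {x, y} g = E x y (g x) (g y))
    {S : Finset V} {C : Finset (Finset V)} {p : List V} {L : (List ι → ℂ) → List ι → ℂ}
    (h : FoldState E T d Ew Tw verts edges tris x₀ x₁ S C p L) (hne : x₀ ≠ x₁)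
    (hp : 2 < p.length) : ∃ S C p' L,
      FoldState E T d Ew Tw verts edges tris x₀ x₁ S C p' L ∧ p'.length < p.length := by
  obtain ⟨x, hx0, hx1, hx⟩ := h.exists_count_eq_one hne hp
  obtain ⟨s, y, z, q, rfl, hxs, hxy, hxz, hxq⟩ :=
    exists_append_of_count_eq_one h.head h.last hx0 hx1 hx
  have hsides : sides (s ++ y :: x :: z :: q) =
      sides (s ++ [y]) ++ {y, x} :: {x, z} :: sides (z :: q) := by
    rw [sides_append, sides_cons_cons, sides_cons_cons]
  have hns : ∀ w, {w, x} ∉ sides (s ++ [y]) := fun w hw => by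
    have := mem_of_mem_sides _ hw x (by simp)
    simp [hxs, hxy] at this
  have hnq : ∀ w, {w, x} ∉ sides (z :: q) := fun w hw => by
    have := mem_of_mem_sides _ hw x (by simp)
    simp [hxq, hxz] at this
  have he : {y, x} ∈ edges := h.sides_sub _ (by rw [hsides]; simp)
  have hxe : ({y, x} : Finset V) ≠ {x₀, x₁} := fun h0 => by
    have : x ∈ ({x₀, x₁} : Finset V) := by rw [← h0]; simp
    simp [hx0, hx1] at this
  have hcount := h.count _ he
  rw [if_neg hxe, hsides, List.count_append, List.count_cons_self, List.count_cons,
    List.count_eq_zero.2 (hns y), List.count_eq_zero.2 (hnq y)] at hcount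
  have heC : {y, x} ∉ C := by
    intro hC
    rw [if_pos hC] at hcount
    omega
  rw [if_neg heC] at hcount
  have hyz : y = z := by
    split_ifs at hcount with h0
    · rw [beq_iff_eq] at h0
      have h1 : y ∈ ({x, z} : Finset V) := by rw [h0]; simp
      simp only [Finset.mem_insert, Finset.mem_singleton] at h1
      rcases h1 with h1 | h1
      · exact absurd h1.symm hxy
      · exact h1
    · omega
  subst hyz
  have hxS : x ∉ S := fun hxS => h.disj x hxS (by simp)
  have hyS : y ∉ S := fun hyS => h.disj y hyS (by simp)
  refine ⟨insert x S, insert {y, x} C, s ++ y :: q, _, ⟨Evolves.fold he h.evolves, ?_,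
    Finset.insert_subset he h.C_sub, Finset.mem_insert_of_mem h.mem_C, ?_, ?_, ?_, ?_, ?_, ?_, ?_⟩,
    ?_⟩
  · intro Φ γ
    have h4 := foldAt_append (fun a c => d c * E y x a c) (s.map γ) (γ y) (q.map γ) (L Φ)
    simp only [List.map_append, List.map_cons, List.length_map] at h4 ⊢
    rw [h4, partialSum_insert d Ew Tw γ hxS hyS (Ne.symm hxy) heC (E y x) (hEw _ _ he),
      Finset.mul_sum]
    refine Finset.sum_congr rfl fun ξ _ => ?_
    have h5 := h.track Φ (Function.update γ x ξ)
    have hm : ∀ l : List V, x ∉ l → l.map (Function.update γ x ξ) = l.map γ := fun l hl =>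
      List.map_congr_left fun u hu => Function.update_of_ne (ne_of_mem_of_not_mem hu hl) _ _
    simp only [List.map_append, List.map_cons, hm s hxs, hm q hxq, Function.update_self,
      Function.update_of_ne (Ne.symm hxy), Function.update_of_ne (Ne.symm hx0),
      Function.update_of_ne (Ne.symm hx1)] at h5
    rw [h5]
    ring
  · have := h.head
    cases s <;> simpa using this
  · have := h.last
    simpa [List.getLast?_append, List.getLast?_cons_cons] using this
  · have := h.length
    rw [Finset.card_insert_of_notMem hxS]
    simp only [List.length_append, List.length_cons] at this ⊢
    omega
  · intro e' he'
    refine h.sides_sub e' ?_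
    rw [hsides]
    rw [sides_append, List.mem_append] at he'
    simp only [List.mem_append, List.mem_cons]
    tauto
  · intro e' he'
    have h4 := h.count e' he'
    rw [hsides] at h4
    rw [sides_append]
    simp only [List.count_append, List.count_cons, beq_iff_eq, Finset.pair_comm x y] at h4 ⊢
    simp only [eq_comm (b := e'), Finset.mem_insert] at h4 ⊢
    by_cases hee : e' = {y, x}
    · subst hee
      simp only [hxe, heC, if_true, if_false, true_or] at h4 ⊢
      omega
    · simp only [hee, if_false, false_or] at h4 ⊢
      omega
  · intro v
    rw [h.cover v]
    simp only [List.mem_append, List.mem_cons, Finset.mem_insert]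
    tauto
  · intro v hv hvp
    have hmem : v ∈ s ++ y :: x :: y :: q := by
      simp only [List.mem_append, List.mem_cons] at hvp ⊢
      tauto
    rcases Finset.mem_insert.1 hv with rfl | hv
    · simp only [List.mem_append, List.mem_cons] at hvp
      tauto
    · exact h.disj v hv hmem
  · simp only [List.length_append, List.length_cons]
    omega

theorem exists_foldState (hS : IsSphereData verts edges tris)
    (hEw : ∀ x y, {x, y} ∈ edges → ∀ g, Ew {x, y} g = E x y (g x) (g y))
    (hTw : ∀ x z y, {x, z, y} ∈ tris → ∀ g, Tw {x, z, y} g = T x z y (g x) (g z) (g y))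
    (h01 : {x₀, x₁} ∈ edges) : ∃ L,
      FoldState E T d Ew Tw verts edges tris x₀ x₁ (verts \ {x₀, x₁}) edges [x₀, x₁] L := by
  have hne : x₀ ≠ x₁ := by
    rintro rfl
    have := hS.card_edge _ h01
    simp at this
  obtain ⟨C, p, L, h⟩ := exists_growState (d := d) hS hEw hTw h01
  have key : ∀ n S C p L, FoldState E T d Ew Tw verts edges tris x₀ x₁ S C p L → p.length ≤ n →
      ∃ L, FoldState E T d Ew Tw verts edges tris x₀ x₁ (verts \ {x₀, x₁}) edges [x₀, x₁] L := by
    intro n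
    induction n with
    | zero =>
      intro S C p L h hp
      have := h.head
      rw [List.length_eq_zero_iff.1 (Nat.le_zero.1 hp)] at this
      simp at this
    | succ n ih =>
      intro S C p L h hp
      by_cases hp2 : 2 < p.length
      · obtain ⟨S', C', p', L', h', hlt⟩ := h.exists_fold hEw hne hp2
        exact ih S' C' p' L' h' (by omega)
      · have hp' : p = [x₀, x₁] := by
          have h1 := h.head
          have h2 := h.last
          match p, hp2 with
          | [], _ => simp at h1
          | [x], _ =>
            simp only [List.head?_cons, List.getLast?_singleton, Option.some.injEq] at h1 h2
            exact absurd (h1.symm.trans h2) hne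
          | [x, y], _ =>
            simp only [List.head?_cons, List.getLast?_cons_cons, List.getLast?_singleton,
              Option.some.injEq] at h1 h2
            rw [h1, h2]
          | x :: y :: z :: q, hp2 => simp at hp2
        subst hp'
        -- An edge outside `C` would have to occur twice as a side, but the only side left is `{x₀,
        -- x₁}`.
        have hC : C = edges := h.C_sub.antisymm fun e he => by
          by_contra hc
          have h1 := h.count e he
          have h0 : e ≠ {x₀, x₁} := ne_of_mem_of_not_mem h.mem_C hc |>.symm
          rw [if_neg hc, if_neg h0] at h1
          have h2 : e ∉ sides [x₀, x₁] := by
            simp only [sides, List.mem_singleton]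
            exact h0
          rw [List.count_eq_zero.2 h2] at h1
          omega
        have hS' : S = verts \ {x₀, x₁} := by
          ext v
          have h1 := h.cover v
          have h2 := h.disj v
          simp only [List.mem_cons, List.not_mem_nil, or_false] at h1 h2
          simp only [Finset.mem_sdiff, Finset.mem_insert, Finset.mem_singleton]
          tauto
        subst hC hS'
        exact ⟨L, h⟩
  exact key _ ∅ C p L (h.foldState hS) le_rfl

/-- After complete folding, `L` is multiplication by the full state sum over the other vertices.
Thus `X` is `L` applied to the constant function `1`, and `Evolves.eq_of_kernel_ne_zero` applies to
it. -/
theorem exists_partialSum_eq (hS : IsSphereData verts edges tris)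
    (hEw : ∀ x y, {x, y} ∈ edges → ∀ g, Ew {x, y} g = E x y (g x) (g y))
    (hTw : ∀ x z y, {x, z, y} ∈ tris → ∀ g, Tw {x, z, y} g = T x z y (g x) (g z) (g y))
    (h01 : {x₀, x₁} ∈ edges) {R : V → V → ι → ι → ι → ι → ℂ} {adj : ι → ι → Prop}
    (hRl : ∀ x y a b a' b', R x y a b a' b' ≠ 0 → adj a a')
    (hR : ∀ x y a b a' b', R x y a b a' b' ≠ 0 → adj b b')
    (hT : ∀ x z y, {x, z, y} ∈ tris → ∀ a b a' b' c',
      (∑ c, R x z a c a' c' * R z y c b c' b' * T x z y a c b) * E x y a b =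
        R x y a b a' b' * (E x y a' b' * T x z y a' c' b'))
    (hO : ∀ y x, {y, x} ∈ edges → ∀ a b c a',
      ∑ c', d c' * E y x a' c' * (R y x a c a' c' * R x y c b c' a') =
        by classical exact if a = b ∧ adj b a' then d c * E y x a c else 0) :
    ∃ X : ι → ι → ℂ,
      (∀ γ, partialSum d Ew Tw (verts \ {x₀, x₁}) edges tris γ = X (γ x₀) (γ x₁)) ∧
      ∀ a b a' b', R x₀ x₁ a b a' b' ≠ 0 → X a b = X a' b' := by
  obtain ⟨L, h⟩ := exists_foldState (d := d) hS hEw hTw h01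
  have hx : x₀ ≠ x₁ := by
    rintro rfl
    have := hS.card_edge _ h01
    simp at this
  refine ⟨fun a b => L (fun _ => 1) [a, b], fun γ => ?_, fun a b a' b' hne =>
    h.evolves.eq_of_kernel_ne_zero (R := R) (adj := adj)
      (X := fun a b => L (fun _ => 1) [a, b]) hRl hR hT ?_ ?_ hne⟩
  · have := h.track (fun _ => 1) γ
    rw [one_mul] at this
    exact this.symm
  · intro y x he a b c a'
    rw [hO y x he a b c a']
    split_ifs <;> rfl
  · intro Ψ a b
    have h1 := h.track Ψ (Function.update (fun _ => a) x₁ b)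
    have h2 := h.track (fun _ => 1) (Function.update (fun _ => a) x₁ b)
    simp only [List.map_cons, List.map_nil, Function.update_self, Function.update_of_ne hx] at h1 h2
    rw [h1, h2, one_mul]

end Folding

/-! ### Links of interior vertices as sphere data -/

section SimplicialComplex

variable {V : Type*} [Fintype V] [DecidableEq V] {K : PreAbstractSimplicialComplex V}

theorem mem_simplices {V : Type*} [Fintype V] {K : PreAbstractSimplicialComplex V} 
    {k : ℕ} {s : Finset V} :
    s ∈ simplices K k ↔ s ∈ K.faces ∧ s.card = k + 1 := by
  simp [simplices]

theorem mem_link {V : Type*} [DecidableEq V] {K : PreAbstractSimplicialComplex V} 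
    {v : V} {s : Finset V} :
    s ∈ (link K v).faces ↔ s.Nonempty ∧ v ∉ s ∧ insert v s ∈ K.faces := Iff.rfl

theorem mem_faces_of_subset {V : Type*} {K : PreAbstractSimplicialComplex V} 
    {s t : Finset V} (hs : s ∈ K.faces) (hts : t ⊆ s)
    (ht : t.Nonempty) : t ∈ K.faces :=
  (K.isRelLowerSet_faces hs).2 hts ht

theorem mem_simplices_link {v : V} {k : ℕ} {s : Finset V} :
    s ∈ simplices (link K v) k ↔ v ∉ s ∧ insert v s ∈ simplices K (k + 1) := by
  rw [mem_simplices, mem_simplices, mem_link]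
  constructor
  · rintro ⟨⟨_, h1, h2⟩, h3⟩
    exact ⟨h1, h2, by rw [Finset.card_insert_of_notMem h1, h3]⟩
  · rintro ⟨h1, h2, h3⟩
    rw [Finset.card_insert_of_notMem h1] at h3
    exact ⟨⟨Finset.card_pos.1 (by omega), h1, h2⟩, by omega⟩

theorem filter_mem_simplices (K : PreAbstractSimplicialComplex V) (v : V) (k : ℕ) :
    (simplices K (k + 1)).filter (fun t => v ∈ t) = (simplices (link K v) k).image (insert v) := by
  ext t
  simp only [Finset.mem_filter, Finset.mem_image, mem_simplices_link]
  constructor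
  · rintro ⟨h1, h2⟩
    exact ⟨t.erase v, ⟨Finset.notMem_erase v t, by rwa [Finset.insert_erase h2]⟩,
      Finset.insert_erase h2⟩
  · rintro ⟨s, ⟨_, h2⟩, rfl⟩
    exact ⟨h2, Finset.mem_insert_self v s⟩

theorem insert_injOn_simplices_link (K : PreAbstractSimplicialComplex V) (v : V) (k : ℕ) :
    Set.InjOn (insert v) (simplices (link K v) k : Set (Finset V)) := by
  intro s hs t ht hst
  rw [Finset.mem_coe, mem_simplices_link] at hs ht
  rw [← Finset.erase_insert hs.1, ← Finset.erase_insert ht.1]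
  exact congrArg (fun u => Finset.erase u v) hst

theorem card_filter_simplices_link (v : V) (k : ℕ) (e : Finset V) (he : v ∉ e) :
    ((simplices (link K v) k).filter fun t => e ⊆ t).card =
      ((simplices K (k + 1)).filter fun t => insert v e ⊆ t).card := by
  have : (simplices K (k + 1)).filter (fun t => insert v e ⊆ t) =
      ((simplices (link K v) k).filter fun t => e ⊆ t).image (insert v) := by
    ext t
    simp only [Finset.mem_filter, Finset.mem_image, mem_simplices_link]
    constructor
    · rintro ⟨h1, h2⟩
      have hv : v ∈ t := h2 (Finset.mem_insert_self v e)
      refine ⟨t.erase v, ⟨⟨Finset.notMem_erase v t, by rwa [Finset.insert_erase hv]⟩, ?_⟩,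
        Finset.insert_erase hv⟩
      exact fun u hu => Finset.mem_erase.2
        ⟨ne_of_mem_of_not_mem hu he, h2 (Finset.mem_insert_of_mem hu)⟩
    · rintro ⟨s, ⟨⟨_, h2⟩, h3⟩, rfl⟩
      exact ⟨h2, Finset.insert_subset_insert v h3⟩
  rw [this, Finset.card_image_of_injOn]
  exact (insert_injOn_simplices_link K v k).mono fun t ht => (Finset.mem_filter.1 ht).1

theorem card_simplices_link (v : V) (k : ℕ) :
    (simplices (link K v) k).card = ((simplices K (k + 1)).filter fun t => {v} ⊆ t).card := by
  have := card_filter_simplices_link (K := K) v k ∅ (Finset.notMem_empty v)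
  simpa using this

/-- The vertices of a complex. -/
def vertices (K : PreAbstractSimplicialComplex V) : Finset V :=
  Finset.univ.filter fun v => {v} ∈ simplices K 0

theorem mem_vertices {v : V} : v ∈ vertices K ↔ {v} ∈ K.faces := by
  simp [vertices, mem_simplices]

theorem simplices_zero (K : PreAbstractSimplicialComplex V) :
    simplices K 0 = (vertices K).image fun v => {v} := by
  ext s
  simp only [Finset.mem_image, mem_vertices, mem_simplices]
  constructor
  · rintro ⟨h1, h2⟩
    obtain ⟨v, rfl⟩ := Finset.card_eq_one.1 h2
    exact ⟨v, h1, rfl⟩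
  · rintro ⟨v, h1, rfl⟩
    exact ⟨h1, by simp⟩

theorem singleton_mem_faces {V : Type*} {K : PreAbstractSimplicialComplex V}
    {s : Finset V} (hs : s ∈ K.faces) {v : V} (hv : v ∈ s) :
    {v} ∈ K.faces :=
  mem_faces_of_subset hs (Finset.singleton_subset_iff.2 hv) (Finset.singleton_nonempty v)

theorem isSphereData_of_isSphere (hK : IsSphere K) :
    IsSphereData (vertices K) (simplices K 1) (simplices K 2) := by
  obtain ⟨hconn, hpure, hlink, heuler⟩ := hK
  refine ⟨fun e he => (mem_simplices.1 he).2, fun t ht => (mem_simplices.1 ht).2, ?_, ?_, ?_, ?_,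
    ?_, ?_⟩
  · intro t ht e het he
    exact mem_simplices.2 ⟨mem_faces_of_subset (mem_simplices.1 ht).1 het
      (Finset.card_pos.1 (by omega)), he⟩
  · intro e he
    obtain ⟨hef, hec⟩ := mem_simplices.1 he
    obtain ⟨x, y, hxy, rfl⟩ := Finset.card_eq_two.1 hec
    have h1 := (hlink x (singleton_mem_faces hef (by simp))).2.2 y
      ⟨Finset.singleton_nonempty y, by simpa using hxy, hef⟩
    rw [card_simplices_link, card_filter_simplices_link x 1 {y} (by simpa using hxy)] at h1
    exact h1
  · intro t ht v hv
    exact mem_vertices.2 (singleton_mem_faces (mem_simplices.1 ht).1 hv)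
  · intro v hv
    obtain ⟨t, ht, hvt⟩ := hpure _ (mem_vertices.1 hv)
    exact ⟨t, ht, Finset.singleton_subset_iff.1 hvt⟩
  · intro A hA ⟨t₀, ht₀⟩ hcl
    -- Closure of `A` across edges gives closure at a vertex: the link of `v` is connected, so any
    -- two triangles at `v` are joined through triangles that successively share an edge at `v`. A
    -- path of vertices in `K` then reaches every triangle.
    have hstar : ∀ v, ∀ t ∈ A, v ∈ t → ∀ t' ∈ simplices K 2, v ∈ t' → t' ∈ A := by
      intro v t ht hvt
      have hlc := (hlink v (singleton_mem_faces (mem_simplices.1 (hA ht)).1 hvt)).1.2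
      have hex : ∀ t ∈ simplices K 2, v ∈ t → ∃ x ∈ t, x ≠ v := by
        intro t ht hv
        have := (mem_simplices.1 ht).2
        obtain ⟨x, hx⟩ := Finset.card_pos.1 (show 0 < (t.erase v).card by
          rw [Finset.card_erase_of_mem hv]; omega)
        exact ⟨x, Finset.mem_of_mem_erase hx, Finset.ne_of_mem_erase hx⟩
      have hvl : ∀ t ∈ simplices K 2, v ∈ t → ∀ x ∈ t, x ≠ v → {x} ∈ (link K v).faces := by
        intro t ht hv x hx hxv
        refine ⟨Finset.singleton_nonempty x, by simpa using hxv.symm, ?_⟩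
        refine mem_faces_of_subset (mem_simplices.1 ht).1 ?_ (Finset.insert_nonempty _ _)
        intro u hu
        simp only [Finset.mem_insert, Finset.mem_singleton] at hu
        rcases hu with rfl | rfl <;> assumption
      have hpair : ∀ x, x ≠ v → ∀ t ∈ A, v ∈ t → x ∈ t → ∀ t' ∈ simplices K 2, v ∈ t' → x ∈ t' →
          t' ∈ A := by
        intro x hxv t ht hv hx t' ht' hv' hx'
        have hsub : ∀ t : Finset V, v ∈ t → x ∈ t → {v, x} ⊆ t := by
          intro t hv hx u hu
          simp only [Finset.mem_insert, Finset.mem_singleton] at hu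
          rcases hu with rfl | rfl <;> assumption
        refine hcl {v, x} ?_ t ht t' ht' (hsub t hv hx) (hsub t' hv' hx')
        exact mem_simplices.2 ⟨mem_faces_of_subset (mem_simplices.1 ht').1 (hsub t' hv' hx')
          (Finset.insert_nonempty _ _), Finset.card_pair hxv.symm⟩
      obtain ⟨x, hx, hxv⟩ := hex t (hA ht) hvt
      intro t' ht' hvt'
      obtain ⟨x', hx', hxv'⟩ := hex t' ht' hvt'
      have hpath := hlc x x' (hvl t (hA ht) hvt x hx hxv) (hvl t' ht' hvt' x' hx' hxv')
      have key : ∀ u, Relation.ReflTransGen (fun a b : V => ({a, b} : Finset V) ∈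
          (link K v).faces) x u → ∀ t ∈ simplices K 2, v ∈ t → u ∈ t → u ≠ v → t ∈ A := by
        intro u hu
        induction hu with
        | refl => exact fun t'' ht'' hv'' hx'' _ => hpair x hxv t ht hvt hx t'' ht'' hv'' hx''
        | @tail u w _ huw ih =>
          intro t'' ht'' hv'' hw'' hwv
          by_cases huw' : u = w
          · subst huw'
            exact ih t'' ht'' hv'' hw'' hwv
          have huv : u ≠ v := by
            rintro rfl
            exact huw.2.1 (by simp)
          have h3 : insert v {u, w} ∈ simplices K 2 :=
            (mem_simplices_link.1 (mem_simplices.2 ⟨huw, Finset.card_pair huw'⟩)).2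
          have h4 := ih _ h3 (by simp) (by simp) huv
          exact hpair w hwv _ h4 (by simp) (by simp) t'' ht'' hv'' hw''
      exact key x' hpath t' ht' hvt' hx' hxv'
    refine hA.antisymm fun t ht => ?_
    have hne : ∀ t ∈ simplices K 2, ∃ v, v ∈ t := fun t ht =>
      (K.isRelLowerSet_faces (mem_simplices.1 ht).1).1
    obtain ⟨v₀, hv₀⟩ := hne t₀ (hA ht₀)
    obtain ⟨v, hv⟩ := hne t ht
    have hpath := hconn.2 v₀ v (singleton_mem_faces (mem_simplices.1 (hA ht₀)).1 hv₀)
      (singleton_mem_faces (mem_simplices.1 ht).1 hv)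
    have key : ∀ u, Relation.ReflTransGen (fun a b : V => ({a, b} : Finset V) ∈ K.faces) v₀ u →
        ∀ t ∈ simplices K 2, u ∈ t → t ∈ A := by
      intro u hu
      induction hu with
      | refl => exact fun t' ht' hvt' => hstar v₀ t₀ ht₀ hv₀ t' ht' hvt'
      | @tail u w _ huw ih =>
        intro t' ht' hw
        obtain ⟨t'', ht'', hsub⟩ := hpure _ huw
        exact hstar w t'' (ih t'' ht'' (hsub (by simp))) (hsub (by simp)) t' ht' hw
    exact key v hpath t ht hv
  · have h0 : (simplices K 0).card = (vertices K).card := by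
      rw [simplices_zero, Finset.card_image_of_injective _ Finset.singleton_injective]
    rw [eulerChar, h0] at heuler
    omega

theorem InBoundary.mono {s t : Finset V} (h : InBoundary K t) (hst : s ⊆ t) : InBoundary K s := by
  obtain ⟨f, hf, h1, h2⟩ := h
  exact ⟨f, hf, h1, hst.trans h2⟩

/-- If the link were a disc, it would have a vertex `u` whose link is an arc, with an end `w`. The
triangle `{v, u, w}` would lie in exactly one tetrahedron and put `v` on the boundary. -/
theorem isSphere_link_of_not_inBoundary (hK : IsThreeManifold K) {v : V} (hv : {v} ∈ K.faces)
    (hb : ¬ InBoundary K {v}) : IsSphere (link K v) := by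
  rcases hK.2 v hv with h | h
  · exact h
  obtain ⟨u, hu, harc⟩ := h.2.2.2.1
  obtain ⟨w, hw, hcard⟩ := harc.2.2.2
  rw [card_simplices_link] at hcard
  have hwu : u ∉ ({w} : Finset V) := hw.2.1
  have hvn : v ∉ insert u ({w} : Finset V) := hw.2.2.2.1
  rw [card_filter_simplices_link u _ {w} hwu, card_filter_simplices_link v _ _ hvn] at hcard
  refine absurd ⟨insert v (insert u {w}), ?_, hcard, by simp⟩ hb
  refine mem_simplices.2 ⟨hw.2.2.2.2, ?_⟩
  rw [Finset.card_insert_of_notMem hvn, Finset.card_insert_of_notMem hwu, Finset.card_singleton]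

end SimplicialComplex

/-! ### Independence of the two fixed labels -/

section Cone

variable {r : ℕ}

/-- When both pairs are admissible, all the quantum integers and factorials involved have arguments
below `r`, and the quantum integers positive ones. -/
theorem stepKernel_ne_zero (hr : 3 ≤ r) {w a b a' b' : ℤ} (h : AdmissibleZ r a b w)
    (h' : AdmissibleZ r a' b' w) (ha : a' = a + 1 ∨ a' = a - 1) (hb : b' = b + 1 ∨ b' = b - 1) :
    stepKernel r w a b a' b' ≠ 0 := by
  obtain ⟨s, h1, h2, h3, h4, h5⟩ := h.exists_half
  obtain ⟨s', h1', h2', h3', h4', h5'⟩ := h'.exists_half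
  have hb1 := h.bounds
  have hb2 := h'.bounds
  rw [stepKernel_eq h h' ha hb]
  refine mul_ne_zero (mul_ne_zero (mul_ne_zero ?_ (div_ne_zero (triFact_ne_zero hr h')
    (triFact_ne_zero hr h))) (div_ne_zero (by split_ifs <;> norm_num) (qBr_ne_zero hr
      (by omega) (by omega)))) (div_ne_zero (qFactZ_ne_zero hr (by omega))
        (qFactZ_ne_zero hr (by omega)))
  unfold stepCoeff
  rcases ha with rfl | rfl <;> rcases hb with rfl | rfl
  · rw [if_pos rfl, if_pos rfl, neg_ne_zero]
    exact qBr_ne_zero hr (by omega) (by omega)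
  · rw [if_pos rfl, if_neg (by omega)]
    exact qBr_ne_zero hr (by omega) (by omega)
  · rw [if_neg (by omega), if_pos rfl]
    exact qBr_ne_zero hr (by omega) (by omega)
  · rw [if_neg (by omega), if_neg (by omega)]
    exact qBr_ne_zero hr (by omega) (by omega)

/-- Admissible pairs of labels are connected by diagonal steps. -/
theorem eq_of_stepKernel_ne_zero (hr : 3 ≤ r) {w : ℤ} {X : Spin r → Spin r → ℂ}
    (hX : ∀ a b a' b' : Spin r, stepKernel r w (a : ℕ) (b : ℕ) (a' : ℕ) (b' : ℕ) ≠ 0 →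
      X a b = X a' b') {a b a' b' : Spin r} (h : AdmissibleZ r (a : ℕ) (b : ℕ) w)
    (h' : AdmissibleZ r (a' : ℕ) (b' : ℕ) w) : X a b = X a' b' := by
  obtain ⟨j, hj⟩ : ∃ j : Spin r, ((j : ℕ) : ℤ) = w := by
    have := h.bounds
    exact ⟨⟨w.toNat, by omega⟩, by simp; omega⟩
  have h0 : 0 < r - 1 := by omega
  -- Every pair is brought to `(w, 0)` by lowering `b`. On the wall `a + b = w`, which is `s = w`,
  -- the label `a` must go up; elsewhere it can go down.
  have key : ∀ n : ℕ, ∀ a b : Spin r, (b : ℕ) = n → AdmissibleZ r (a : ℕ) (b : ℕ) w →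
      X a b = X j ⟨0, h0⟩ := by
    intro n
    induction n with
    | zero =>
      intro a b hb h
      obtain ⟨s, h1, h2, h3, h4, h5⟩ := h.exists_half
      have hb' : b = ⟨0, h0⟩ := Fin.ext hb
      have ha' : a = j := Fin.ext (by omega)
      rw [ha', hb']
    | succ n ih =>
      intro a b hb h
      obtain ⟨s, h1, h2, h3, h4, h5⟩ := h.exists_half
      have hbd := h.bounds
      by_cases hs : (s : ℤ) = w
      · have h'' : AdmissibleZ r (((⟨(a : ℕ) + 1, by omega⟩ : Spin r) : ℕ) : ℤ)
            (((⟨n, by omega⟩ : Spin r) : ℕ) : ℤ) w := by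
          refine ⟨?_, ?_, ?_, ⟨s, ?_⟩, ?_⟩ <;> push_cast <;> omega
        rw [hX _ _ _ _ (stepKernel_ne_zero hr h h'' (by push_cast; omega) (by push_cast; omega))]
        exact ih _ _ rfl h''
      · have h'' : AdmissibleZ r (((⟨(a : ℕ) - 1, by omega⟩ : Spin r) : ℕ) : ℤ)
            (((⟨n, by omega⟩ : Spin r) : ℕ) : ℤ) w := by
          refine ⟨?_, ?_, ?_, ⟨s - 1, ?_⟩, ?_⟩ <;> push_cast <;> omega
        rw [hX _ _ _ _ (stepKernel_ne_zero hr h h'' (by push_cast; omega) (by push_cast; omega))]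
        exact ih _ _ rfl h''
  rw [key _ a b rfl h, key _ a' b' rfl h']

variable {V : Type*} [Fintype V] [DecidableEq V]

/-- The sum over the labels of all but two adjacent edges at an interior vertex does not depend on
the labels of these two edges. -/
theorem partialSum_eq_of_admissible (hr : 3 ≤ r) {verts : Finset V} {edges tris : Finset (Finset V)}
    (hS : IsSphereData verts edges tris) {w : V → V → ℤ} (hsymm : ∀ x y, w x y = w y x)
    (hw : ∀ x z y, {x, z, y} ∈ tris → AdmissibleZ r (w x y) (w z y) (w x z))
    {Ew Tw : Finset V → (V → Spin r) → ℂ}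
    (hEw : ∀ x y, {x, y} ∈ edges → ∀ g, Ew {x, y} g = edgeWeight r (w x y) (g x : ℕ) (g y : ℕ))
    (hTw : ∀ x z y, {x, z, y} ∈ tris → ∀ g, Tw {x, z, y} g =
      tetWeight r (w x y) (w z y) (w x z) (g x : ℕ) (g y : ℕ) (g z : ℕ))
    {x₀ x₁ : V} (h01 : {x₀, x₁} ∈ edges) {γ γ' : V → Spin r}
    (h : AdmissibleZ r (γ x₀ : ℕ) (γ x₁ : ℕ) (w x₀ x₁))
    (h' : AdmissibleZ r (γ' x₀ : ℕ) (γ' x₁ : ℕ) (w x₀ x₁)) :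
    partialSum (fun a : Spin r => vertexWeight r (a : ℕ)) Ew Tw (verts \ {x₀, x₁}) edges tris γ =
      partialSum (fun a : Spin r => vertexWeight r (a : ℕ)) Ew Tw (verts \ {x₀, x₁}) edges
        tris γ' := by
  obtain ⟨X, hX, hX'⟩ := exists_partialSum_eq
    (E := fun x y (a b : Spin r) => edgeWeight r (w x y) (a : ℕ) (b : ℕ))
    (T := fun x z y (a c b : Spin r) =>
      tetWeight r (w x y) (w z y) (w x z) (a : ℕ) (b : ℕ) (c : ℕ))
    (d := fun a : Spin r => vertexWeight r (a : ℕ)) hS hEw hTw h01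
    (R := fun x y (a b a' b' : Spin r) =>
      stepKernel r (w x y) (a : ℕ) (b : ℕ) (a' : ℕ) (b' : ℕ))
    (adj := fun b b' : Spin r => ((b' : ℕ) : ℤ) = (b : ℕ) + 1 ∨ ((b' : ℕ) : ℤ) = (b : ℕ) - 1)
    (fun x y a b a' b' hne => by
      by_contra hc
      exact hne (if_neg fun h => hc h.2.2.1))
    (fun x y a b a' b' hne => by
      by_contra hc
      exact hne (if_neg fun h => hc h.2.2.2))
    (fun x z y ht a b a' b' c' => by
      rw [← mul_assoc]
      exact tetWeight_relation hr (hw x z y ht) _ _ _ _ _)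
    (fun y x _ a b c a' => by
      have h1 := stepKernel_orthogonality hr (w y x) (c : ℕ) (a : ℕ) (b : ℕ) (a' : ℕ)
        ⟨by omega, by omega⟩
      simp only [hsymm x y]
      simp only [mul_assoc] at h1 ⊢
      rw [h1]
      simp only [Nat.cast_inj, Fin.val_inj]
      split_ifs <;> rfl)
  rw [hX, hX]
  exact eq_of_stepKernel_ne_zero hr (hX' · · · ·) h h'

end Cone

/-! ### Quantum dimensions and the fusion rule -/

section Fusion

variable {r : ℕ}

theorem conj_qInt (r n : ℕ) : (starRingEnd ℂ) (qInt r n) = qInt r n := by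
  have hq : (starRingEnd ℂ) (q r) = (q r)⁻¹ := by
    rw [q, ← Complex.exp_conj, ← Complex.exp_neg]
    congr 1
    simp [Complex.conj_I, neg_div]
  rw [qInt, map_div₀, map_sub, map_sub, map_pow, map_pow, map_inv₀, hq, inv_inv, ← neg_sub,
    ← neg_sub (q r), neg_div_neg_eq]

theorem qDim_ne_zero (hr : 3 ≤ r) (a : Spin r) : qDim r a ≠ 0 := by
  rw [qDim, qInt_eq_qBr]
  exact mul_ne_zero (pow_ne_zero _ (by norm_num)) (qBr_ne_zero hr (by omega) (by omega))

/-- Quantum integers are real because conjugation exchanges `q` and `q⁻¹`, so `N` is a sum of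
squares of nonzero real numbers. -/
theorem normN_ne_zero (hr : 3 ≤ r) : normN r ≠ 0 := by
  have h1 : ∀ a : Spin r, qDim r a ^ 2 = ((Complex.normSq (qDim r a) : ℝ) : ℂ) := by
    intro a
    rw [← Complex.mul_conj, qDim, map_mul, conj_qInt]
    simp [sq]
  have h0 : 0 < r - 1 := by omega
  rw [normN, Finset.sum_congr rfl fun a _ => h1 a, ← Complex.ofReal_sum, Complex.ofReal_ne_zero]
  refine (Finset.sum_pos (fun a _ => Complex.normSq_pos.2 (qDim_ne_zero hr a))
    ⟨⟨0, h0⟩, Finset.mem_univ _⟩).ne'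

theorem qDim_eq_vertexWeight (a : Spin r) : qDim r a = vertexWeight r (a : ℕ) := by
  rw [qDim, vertexWeight, qInt_eq_qBr, zpow_natCast]
  push_cast
  rfl

theorem admissible_iff {a b c : Spin r} (hr : 3 ≤ r) :
    Admissible r a b c ↔ AdmissibleZ r (a : ℕ) (b : ℕ) (c : ℕ) := by
  have : Even ((a : ℕ) + b + c) ↔ Even (((a : ℕ) : ℤ) + (b : ℕ) + (c : ℕ)) := by
    rw [← Int.even_coe_nat]
    push_cast
    rfl
  unfold Admissible AdmissibleZ
  rw [this]
  by_cases h : Even (((a : ℕ) : ℤ) + (b : ℕ) + (c : ℕ))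
  · simp only [h, true_and]
    omega
  · simp only [h, false_and, and_false]

/-- With `v n = q ^ n + q ^ (-n)` one has `[n+1] (q - q⁻¹)² = v (n+2) - v n`. The admissible `a` run
from `m` to `M` in steps of two, with constant sign, so the sum telescopes; `[b+1][c+1] (q - q⁻¹)²`
is the same difference of end values. -/
theorem sum_qDim_mul_intertwinerDim (hr : 3 ≤ r) (b c : Spin r) :
    ∑ a : Spin r, qDim r a * (intertwinerDim r a b c : ℂ) = qDim r b * qDim r c := by
  classical
  have hδ := q_sub_inv_ne_zero hr
  have hq := q_ne_zero r
  set v : ℤ → ℂ := fun n => q r ^ n + q r ^ (-n) with hv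
  have hmul : ∀ m n : ℤ, qBr r m * qBr r n * (q r - (q r)⁻¹) ^ 2 = v (m + n) - v (m - n) := by
    intro m n
    have : qBr r m * qBr r n * (q r - (q r)⁻¹) ^ 2 =
        (qBr r m * (q r - (q r)⁻¹)) * (qBr r n * (q r - (q r)⁻¹)) := by ring
    rw [this, qBr, qBr, div_mul_cancel₀ _ hδ, div_mul_cancel₀ _ hδ]
    simp only [hv, sub_eq_add_neg, neg_add, zpow_add₀ hq, neg_neg]
    ring
  have hstep : ∀ n : ℤ, qBr r (n + 1) * (q r - (q r)⁻¹) ^ 2 = v (n + 2) - v n := by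
    intro n
    have := hmul (n + 1) 1
    rw [qBr_one hr, mul_one] at this
    rw [this]
    congr 2 <;> ring
  have hneg : ∀ n, v (-n) = v n := fun n => by simp only [hv, neg_neg, add_comm]
  have hper : ∀ n, v (2 * r - n) = v n := by
    intro n
    have h1 : q r ^ (2 * (r : ℤ)) = 1 := by
      have h0 := qBr_self hr
      rw [qBr, div_eq_zero_iff, or_iff_left hδ, sub_eq_zero] at h0
      rw [two_mul, zpow_add₀ hq]
      nth_rewrite 2 [h0]
      rw [← zpow_add₀ hq, add_neg_cancel, zpow_zero]
    simp only [hv]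
    rw [neg_sub, zpow_sub₀ hq, zpow_sub₀ hq, h1, zpow_neg]
    simp [add_comm]
  obtain ⟨m, hm⟩ : ∃ m : ℕ, m = ((b : ℕ) - (c : ℕ)) + ((c : ℕ) - (b : ℕ)) := ⟨_, rfl⟩
  -- The second bound is the truncation of the fusion rule at the root of unity.
  obtain ⟨M, hM⟩ : ∃ M : ℕ, M = min ((b : ℕ) + c) (2 * (r - 2) - (b + c)) := ⟨_, rfl⟩
  have hparity : ∃ k, M = m + 2 * k := ⟨(M - m) / 2, by omega⟩
  obtain ⟨k, hk⟩ := hparity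
  have hadm : ∀ a : Spin r, Admissible r a b c ↔ ∃ i < k + 1, (a : ℕ) = m + 2 * i := by
    intro a
    unfold Admissible
    constructor
    · rintro ⟨h1, h2, h3, ⟨s, hs⟩, h5⟩
      exact ⟨(a - m) / 2, by omega, by omega⟩
    · rintro ⟨i, hi, ha⟩
      exact ⟨by omega, by omega, by omega, ⟨((a : ℕ) + b + c) / 2, by omega⟩, by omega⟩
  have hsum : ∀ F : ℕ → ℂ, ∑ a : Spin r, F a * (intertwinerDim r a b c : ℂ) =
      ∑ i ∈ Finset.range (k + 1), F (m + 2 * i) := by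
    intro F
    have h1 : ∀ a : Spin r, F a * (intertwinerDim r a b c : ℂ) =
        if Admissible r a b c then F a else 0 := by
      intro a
      rw [intertwinerDim]
      split_ifs <;> simp
    rw [Finset.sum_congr rfl fun a _ => h1 a, ← Finset.sum_filter]
    refine Finset.sum_nbij (fun a => ((a : ℕ) - m) / 2) ?_ ?_ ?_ ?_
    · intro a ha
      obtain ⟨i, hi, h⟩ := (hadm a).1 (Finset.mem_filter.1 ha).2
      rw [Finset.mem_range]
      omega
    · intro a ha a' ha' h
      obtain ⟨i, hi, h1⟩ := (hadm a).1 (Finset.mem_filter.1 ha).2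
      obtain ⟨i', hi', h1'⟩ := (hadm a').1 (Finset.mem_filter.1 ha').2
      dsimp only at h
      exact Fin.ext (by omega)
    · intro i hi
      rw [Finset.coe_range, Set.mem_Iio] at hi
      refine ⟨⟨m + 2 * i, by omega⟩, ?_, by simp⟩
      rw [Finset.mem_coe, Finset.mem_filter]
      exact ⟨Finset.mem_univ _, (hadm _).2 ⟨i, hi, rfl⟩⟩
    · intro a ha
      obtain ⟨i, hi, h⟩ := (hadm a).1 (Finset.mem_filter.1 ha).2
      rw [h]
      congr 2
      omega
  have key := hsum fun n => (-1) ^ n * qInt r (n + 1)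
  refine key.trans ?_
  refine mul_right_cancel₀ (pow_ne_zero 2 hδ) ?_
  have hterm : ∀ i, (-1 : ℂ) ^ (m + 2 * i) * qInt r (m + 2 * i + 1) * (q r - (q r)⁻¹) ^ 2 =
      (-1) ^ m * (v (m + 2 * (i + 1 : ℕ)) - v (m + 2 * (i : ℕ))) := by
    intro i
    rw [mul_assoc, qInt_eq_qBr]
    push_cast
    rw [hstep, pow_add, pow_mul]
    norm_num
    congr 1
  rw [Finset.sum_mul, Finset.sum_congr rfl fun i _ => hterm i, ← Finset.mul_sum,
    Finset.sum_range_sub fun i : ℕ => v (m + 2 * (i : ℕ))]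
  have hsign : (-1 : ℂ) ^ (b : ℕ) * (-1) ^ (c : ℕ) = (-1) ^ m := by
    rw [← pow_add, neg_one_pow_eq_pow_mod_two, neg_one_pow_eq_pow_mod_two m]
    congr 1
    omega
  have hrhs : qDim r b * qDim r c * (q r - (q r)⁻¹) ^ 2 =
      (-1) ^ m * (v ((b : ℕ) + 1 + ((c : ℕ) + 1)) - v ((b : ℕ) + 1 - ((c : ℕ) + 1))) := by
    rw [← hmul, ← hsign, qDim, qDim, qInt_eq_qBr, qInt_eq_qBr]
    push_cast
    ring
  rw [hrhs]
  congr 2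
  · rcases le_total ((b : ℕ) + c) (2 * (r - 2) - (b + c)) with h | h
    · congr 1
      push_cast
      omega
    -- In the truncated case the upper end is `2r - (b + c + 2)`, which the reflection `v (2r - n) =
    -- v n` takes to the untruncated one.
    · rw [← hper]
      congr 1
      push_cast
      omega
  · rcases le_total (b : ℕ) c with h | h
    · rw [← hneg]
      congr 1
      push_cast
      omega
    · congr 1
      push_cast
      omega

end Fusion

/-! ### Theta and tetrahedral networks in coordinates -/

section Embedding

variable {V : Type*} [DecidableEq V]

theorem exists_emb_three {x y z : V} (h : ({x, y, z} : Finset V).card = 3) :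
    ∃ φ : Fin 3 ↪ V, φ 0 = x ∧ φ 1 = y ∧ φ 2 = z ∧ Finset.univ.map φ = {x, y, z} := by
  obtain ⟨h1, h2, h3⟩ := ne_of_card h
  have hinj : Function.Injective ![x, y, z] := by
    intro i j
    fin_cases i <;> fin_cases j <;> simp [h1, h2, h3, h1.symm, h2.symm, h3.symm]
  refine ⟨⟨![x, y, z], hinj⟩, rfl, rfl, rfl, ?_⟩
  rw [show (Finset.univ : Finset (Fin 3)) = {0, 1, 2} by decide]
  simp

theorem exists_emb_four {v x z y : V} (h : ({v, x, z, y} : Finset V).card = 4) :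
    ∃ φ : Fin 4 ↪ V, φ 0 = v ∧ φ 1 = x ∧ φ 2 = z ∧ φ 3 = y ∧ Finset.univ.map φ = {v, x, z, y} := by
  have hv : v ∉ ({x, z, y} : Finset V) := by
    intro hv
    rw [Finset.insert_eq_of_mem hv] at h
    exact absurd (Finset.card_le_three (a := x) (b := z) (c := y)) (by omega)
  rw [Finset.card_insert_of_notMem hv] at h
  obtain ⟨h1, h2, h3⟩ := ne_of_card (show ({x, z, y} : Finset V).card = 3 by omega)
  simp only [Finset.mem_insert, Finset.mem_singleton, not_or] at hv
  obtain ⟨h4, h5, h6⟩ := hv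
  have hinj : Function.Injective ![v, x, z, y] := by
    intro i j
    fin_cases i <;> fin_cases j <;>
      simp [h1, h2, h3, h4, h5, h6, h1.symm, h2.symm, h3.symm, Ne.symm h4, Ne.symm h5, Ne.symm h6]
  refine ⟨⟨![v, x, z, y], hinj⟩, rfl, rfl, rfl, rfl, ?_⟩
  rw [show (Finset.univ : Finset (Fin 4)) = {0, 1, 2, 3} by decide]
  simp

end Embedding

section Networks

variable {V : Type*} [Fintype V] [DecidableEq V] {K : PreAbstractSimplicialComplex V} {r : ℕ}

/-- The label of an edge, extended by zero to all finite sets. -/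
def edgeLabel (S : Edge K → Spin r) (s : Finset V) : ℕ :=
  if h : s ∈ simplices K 1 then (S ⟨s, h⟩ : ℕ) else 0

theorem edgeLabel_val (S : Edge K → Spin r) (e : Edge K) : edgeLabel S e.1 = S e := dif_pos e.2

theorem mem_edgesOf {t : Finset V} {e : Edge K} : e ∈ edgesOf K t ↔ e.1 ⊆ t := by
  simp [edgesOf]

/-- The edge opposite to the `k`-th vertex of a triangle. -/
def triangleEdge (φ : Fin 3 ↪ V) (hf : Finset.univ.map φ ∈ K.faces) : Fin 3 ↪ Edge K where
  toFun k := ⟨(Finset.univ.erase k).map φ, mem_simplices.2 ⟨mem_faces_of_subset hf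
    (Finset.map_subset_map.2 (Finset.erase_subset _ _)) (by
      rw [Finset.map_nonempty, ← Finset.card_pos]
      simp), by simp⟩⟩
  inj' k l h := by
    have h1 : (Finset.univ.erase k : Finset (Fin 3)) = Finset.univ.erase l :=
      Finset.map_injective φ (congrArg Subtype.val h)
    have h2 : ∀ k l : Fin 3, (Finset.univ.erase k : Finset (Fin 3)) = Finset.univ.erase l → k = l :=
      by decide
    exact h2 k l h1

theorem edgesOf_triangle (φ : Fin 3 ↪ V) (hf : Finset.univ.map φ ∈ K.faces) :
    edgesOf K (Finset.univ.map φ) = Finset.univ.map (triangleEdge φ hf) := by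
  ext e
  rw [mem_edgesOf, Finset.mem_map]
  constructor
  · intro h
    obtain ⟨s, -, hs⟩ := Finset.subset_map_iff.1 h
    have h2 : s.card = 2 := by
      rw [← Finset.card_map φ, ← hs, (mem_simplices.1 e.2).2]
    have : ∀ s : Finset (Fin 3), s.card = 2 → ∃ k, Finset.univ.erase k = s := by decide
    obtain ⟨k, hk⟩ := this s h2
    exact ⟨k, Finset.mem_univ k, Subtype.ext (by rw [hs, ← hk]; rfl)⟩
  · rintro ⟨k, -, rfl⟩
    exact Finset.map_subset_map.2 (Finset.erase_subset _ _)

theorem one_div_theta (S : Edge K → Spin r) {v x y : V} (hf : {v, x, y} ∈ simplices K 2)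
    (hadm : AdmissibleZ r (edgeLabel S {v, x}) (edgeLabel S {v, y}) (edgeLabel S {x, y})) :
    1 / theta S {v, x, y} = edgeWeight r (edgeLabel S {x, y}) (edgeLabel S {v, x})
      (edgeLabel S {v, y}) := by
  obtain ⟨hfK, hc⟩ := mem_simplices.1 hf
  obtain ⟨φ, h0, h1, h2, hφ⟩ := exists_emb_three hc
  rw [← hφ] at hfK
  have e0 : (S (triangleEdge φ hfK 0) : ℕ) = edgeLabel S {x, y} := by
    rw [← edgeLabel_val]
    congr 1
    change (Finset.univ.erase 0).map φ = _
    rw [show (Finset.univ.erase 0 : Finset (Fin 3)) = {1, 2} by decide]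
    simp [h1, h2]
  have e1 : (S (triangleEdge φ hfK 1) : ℕ) = edgeLabel S {v, y} := by
    rw [← edgeLabel_val]
    congr 1
    change (Finset.univ.erase 1).map φ = _
    rw [show (Finset.univ.erase 1 : Finset (Fin 3)) = {0, 2} by decide]
    simp [h0, h2]
  have e2 : (S (triangleEdge φ hfK 2) : ℕ) = edgeLabel S {v, x} := by
    rw [← edgeLabel_val]
    congr 1
    change (Finset.univ.erase 2).map φ = _
    rw [show (Finset.univ.erase 2 : Finset (Fin 3)) = {0, 1} by decide]
    simp [h0, h1]
  rw [edgeWeight_eq hadm, theta, spinSum, ← hφ, edgesOf_triangle φ hfK]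
  simp only [Finset.sum_map, Finset.prod_map, Fin.sum_univ_three, Fin.prod_univ_three, e0, e1, e2]
  obtain ⟨s, hs, h3, h4, h5, h6⟩ := hadm.exists_half
  set a := edgeLabel S {v, x}
  set b := edgeLabel S {v, y}
  set w := edgeLabel S {x, y}
  obtain ⟨s, rfl⟩ := Int.eq_ofNat_of_zero_le (show 0 ≤ s by omega)
  rw [show (w + b + a) / 2 = s by omega, show ((a : ℤ) + b + w) / 2 = s by omega, zpow_natCast,
    triFact, qFactZ, qFactZ, qFactZ, qFactZ, qFactZ, qFactZ, qFactZ, one_div,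
    show (((a : ℤ) + b - w) / 2).toNat = s - w by omega,
    show (((a : ℤ) + w - b) / 2).toNat = s - b by omega,
    show (((b : ℤ) + w - a) / 2).toNat = s - a by omega]
  simp only [Int.toNat_natCast, show ((s : ℤ) + 1).toNat = s + 1 by omega]
  congr 1
  simp only [div_eq_mul_inv, mul_inv]
  ring

/-- The pairs of vertices of a tetrahedron, in such an order that `k` and `k + 3` are disjoint. -/
def pairs : Fin 6 → Finset (Fin 4) := ![{0, 1}, {0, 2}, {0, 3}, {2, 3}, {1, 3}, {1, 2}]

theorem card_pairs (k : Fin 6) : (pairs k).card = 2 := by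
  revert k
  decide

theorem pairs_injective : Function.Injective pairs := by decide

/-- The edges of a tetrahedron. -/
def tetEdge (φ : Fin 4 ↪ V) (ht : Finset.univ.map φ ∈ K.faces) : Fin 6 ↪ Edge K where
  toFun k := ⟨(pairs k).map φ, mem_simplices.2 ⟨mem_faces_of_subset ht
    (Finset.map_subset_map.2 (Finset.subset_univ _)) (by
      rw [Finset.map_nonempty, ← Finset.card_pos, card_pairs]
      norm_num), by rw [Finset.card_map, card_pairs]⟩⟩
  inj' k l h := pairs_injective (Finset.map_injective φ (congrArg Subtype.val h))

theorem edgesOf_map (φ : Fin 4 ↪ V) (ht : Finset.univ.map φ ∈ K.faces) (u : Finset (Fin 4)) :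
    edgesOf K (u.map φ) = (Finset.univ.filter fun k => pairs k ⊆ u).map (tetEdge φ ht) := by
  ext e
  rw [mem_edgesOf, Finset.mem_map]
  constructor
  · intro h
    obtain ⟨s, hsu, hs⟩ := Finset.subset_map_iff.1 h
    have h2 : s.card = 2 := by
      rw [← Finset.card_map φ, ← hs, (mem_simplices.1 e.2).2]
    have : ∀ s : Finset (Fin 4), s.card = 2 → ∃ k, pairs k = s := by decide
    obtain ⟨k, hk⟩ := this s h2
    exact ⟨k, Finset.mem_filter.2 ⟨Finset.mem_univ k, hk ▸ hsu⟩,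
      Subtype.ext (by rw [hs, ← hk]; rfl)⟩
  · rintro ⟨k, hk, rfl⟩
    exact Finset.map_subset_map.2 (Finset.mem_filter.1 hk).2

theorem trianglesOf_tetrahedron (φ : Fin 4 ↪ V) (ht : Finset.univ.map φ ∈ K.faces) :
    trianglesOf K (Finset.univ.map φ) =
      Finset.univ.image fun i : Fin 4 => (Finset.univ.erase i).map φ := by
  ext f
  simp only [trianglesOf, Finset.mem_filter, Finset.mem_image, Finset.mem_univ, true_and]
  constructor
  · rintro ⟨hf, h⟩
    obtain ⟨s, -, rfl⟩ := Finset.subset_map_iff.1 h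
    have h2 : s.card = 3 := by
      rw [← Finset.card_map φ, (mem_simplices.1 hf).2]
    have : ∀ s : Finset (Fin 4), s.card = 3 → ∃ i, Finset.univ.erase i = s := by decide
    obtain ⟨i, hi⟩ := this s h2
    exact ⟨i, by rw [hi]⟩
  · rintro ⟨i, rfl⟩
    have h : (Finset.univ.erase i).map φ ⊆ Finset.univ.map φ :=
      Finset.map_subset_map.2 (Finset.erase_subset i Finset.univ)
    exact ⟨mem_simplices.2 ⟨mem_faces_of_subset ht h (by
      rw [Finset.map_nonempty, ← Finset.card_pos]
      simp), by simp⟩, h⟩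

theorem quadsOf_tetrahedron (φ : Fin 4 ↪ V) (ht : Finset.univ.map φ ∈ K.faces) :
    quadsOf K (Finset.univ.map φ) =
      ({{1, 2, 4, 5}, {0, 2, 3, 5}, {0, 1, 3, 4}} : Finset (Finset (Fin 6))).image
        fun Q => Q.map (tetEdge φ ht) := by
  have h1 : ({{1, 2, 4, 5}, {0, 2, 3, 5}, {0, 1, 3, 4}} : Finset (Finset (Fin 6))) =
      Finset.univ.image fun k => Finset.univ.filter fun l => (pairs l ∩ pairs k).card = 1 := by
    decide
  have h2 : edgesOf K (Finset.univ.map φ) = Finset.univ.map (tetEdge φ ht) := by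
    rw [edgesOf_map φ ht]
    congr 1
  rw [h1, quadsOf, h2, Finset.image_image, Finset.map_eq_image, Finset.image_image]
  refine Finset.image_congr fun k _ => ?_
  simp only [Function.comp_apply]
  rw [← Finset.map_eq_image, Finset.filter_map]
  congr 1
  ext l
  simp only [Finset.mem_filter, Finset.mem_univ, true_and, Function.comp_apply]
  change ((pairs l).map φ ∩ (pairs k).map φ).card = 1 ↔ _
  rw [← Finset.map_inter, Finset.card_map]

theorem spinSum_map {V : Type*} [Fintype V] {K : PreAbstractSimplicialComplex V}
    (S : Edge K → Spin r) (φ : Fin 4 ↪ V) (ht : Finset.univ.map φ ∈ K.faces)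
    (Q : Finset (Fin 6)) :
    spinSum S (Q.map (tetEdge φ ht)) = (∑ k ∈ Q, (S (tetEdge φ ht k) : ℕ)) / 2 := by
  rw [spinSum, Finset.sum_map]

theorem prod_quadsOf (S : Edge K → Spin r) (φ : Fin 4 ↪ V) (ht : Finset.univ.map φ ∈ K.faces)
    {ℓ : Fin 6 → ℕ} (hℓ : ∀ k, (S (tetEdge φ ht k) : ℕ) = ℓ k) (F : ℕ → ℂ) :
    ∏ Q ∈ quadsOf K (Finset.univ.map φ), F (spinSum S Q) =
      F ((ℓ 1 + ℓ 2 + ℓ 4 + ℓ 5) / 2) * F ((ℓ 0 + ℓ 2 + ℓ 3 + ℓ 5) / 2) *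
        F ((ℓ 0 + ℓ 1 + ℓ 3 + ℓ 4) / 2) := by
  rw [quadsOf_tetrahedron φ ht, Finset.prod_image (fun _ _ _ _ h => Finset.map_injective _ h),
    Finset.prod_insert (by decide), Finset.prod_insert (by decide), Finset.prod_singleton,
    spinSum_map, spinSum_map, spinSum_map]
  simp only [hℓ]
  rw [Finset.sum_insert (by decide), Finset.sum_insert (by decide), Finset.sum_insert (by decide),
    Finset.sum_singleton, Finset.sum_insert (by decide), Finset.sum_insert (by decide),
    Finset.sum_insert (by decide), Finset.sum_singleton, Finset.sum_insert (by decide),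
    Finset.sum_insert (by decide), Finset.sum_insert (by decide), Finset.sum_singleton, ← mul_assoc]
  simp only [add_assoc]

theorem forall_quadsOf (S : Edge K → Spin r) (φ : Fin 4 ↪ V) (ht : Finset.univ.map φ ∈ K.faces)
    {ℓ : Fin 6 → ℕ} (hℓ : ∀ k, (S (tetEdge φ ht k) : ℕ) = ℓ k) (P : ℕ → Prop) :
    (∀ Q ∈ quadsOf K (Finset.univ.map φ), P (spinSum S Q)) ↔
      P ((ℓ 1 + ℓ 2 + ℓ 4 + ℓ 5) / 2) ∧ P ((ℓ 0 + ℓ 2 + ℓ 3 + ℓ 5) / 2) ∧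
        P ((ℓ 0 + ℓ 1 + ℓ 3 + ℓ 4) / 2) := by
  rw [quadsOf_tetrahedron φ ht, Finset.forall_mem_image, Finset.forall_mem_insert,
    Finset.forall_mem_insert]
  simp only [Finset.mem_singleton, forall_eq, spinSum_map, hℓ]
  rw [Finset.sum_insert (by decide), Finset.sum_insert (by decide), Finset.sum_insert (by decide),
    Finset.sum_singleton, Finset.sum_insert (by decide), Finset.sum_insert (by decide),
    Finset.sum_insert (by decide), Finset.sum_singleton, Finset.sum_insert (by decide),
    Finset.sum_insert (by decide), Finset.sum_insert (by decide), Finset.sum_singleton]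
  simp only [add_assoc]

theorem spinSum_face (S : Edge K → Spin r) (φ : Fin 4 ↪ V) (ht : Finset.univ.map φ ∈ K.faces)
    {ℓ : Fin 6 → ℕ} (hℓ : ∀ k, (S (tetEdge φ ht k) : ℕ) = ℓ k) (i : Fin 4) :
    spinSum S (edgesOf K ((Finset.univ.erase i).map φ)) =
      ![(ℓ 3 + ℓ 4 + ℓ 5) / 2, (ℓ 1 + ℓ 2 + ℓ 3) / 2, (ℓ 0 + ℓ 2 + ℓ 4) / 2,
        (ℓ 0 + ℓ 1 + ℓ 5) / 2] i := by
  rw [edgesOf_map φ ht, spinSum_map]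
  simp only [hℓ]
  have h : ∀ i : Fin 4, (Finset.univ.filter fun k => pairs k ⊆ Finset.univ.erase i) =
      (![{3, 4, 5}, {1, 2, 3}, {0, 2, 4}, {0, 1, 5}] : Fin 4 → Finset (Fin 6)) i := by decide
  rw [h]
  fin_cases i <;> simp [add_assoc]

theorem prod_trianglesOf (S : Edge K → Spin r) (φ : Fin 4 ↪ V) (ht : Finset.univ.map φ ∈ K.faces)
    {ℓ : Fin 6 → ℕ} (hℓ : ∀ k, (S (tetEdge φ ht k) : ℕ) = ℓ k) (F : ℕ → ℂ) :
    ∏ f ∈ trianglesOf K (Finset.univ.map φ), F (spinSum S (edgesOf K f)) =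
      F ((ℓ 3 + ℓ 4 + ℓ 5) / 2) * F ((ℓ 1 + ℓ 2 + ℓ 3) / 2) * F ((ℓ 0 + ℓ 2 + ℓ 4) / 2) *
        F ((ℓ 0 + ℓ 1 + ℓ 5) / 2) := by
  have hinj : ∀ i j : Fin 4, (Finset.univ.erase i : Finset (Fin 4)) = Finset.univ.erase j → i = j :=
    by decide
  rw [trianglesOf_tetrahedron φ ht, Finset.prod_image
    (fun _ _ _ _ h => hinj _ _ (Finset.map_injective φ h)), Fin.prod_univ_four]
  simp only [spinSum_face S φ ht hℓ]
  rfl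

theorem forall_trianglesOf (S : Edge K → Spin r) (φ : Fin 4 ↪ V)
    (ht : Finset.univ.map φ ∈ K.faces) {ℓ : Fin 6 → ℕ}
    (hℓ : ∀ k, (S (tetEdge φ ht k) : ℕ) = ℓ k) (P : ℕ → Prop) :
    (∀ f ∈ trianglesOf K (Finset.univ.map φ), P (spinSum S (edgesOf K f))) ↔
      P ((ℓ 3 + ℓ 4 + ℓ 5) / 2) ∧ P ((ℓ 1 + ℓ 2 + ℓ 3) / 2) ∧ P ((ℓ 0 + ℓ 2 + ℓ 4) / 2) ∧
        P ((ℓ 0 + ℓ 1 + ℓ 5) / 2) := by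
  rw [trianglesOf_tetrahedron φ ht, Finset.forall_mem_image]
  simp only [Finset.mem_univ, true_implies, spinSum_face S φ ht hℓ, Fin.forall_fin_succ]
  simp

theorem prod_edgesOf_tetrahedron (S : Edge K → Spin r) (φ : Fin 4 ↪ V)
    (ht : Finset.univ.map φ ∈ K.faces) {ℓ : Fin 6 → ℕ}
    (hℓ : ∀ k, (S (tetEdge φ ht k) : ℕ) = ℓ k) (F : ℕ → ℂ) :
    ∏ e ∈ edgesOf K (Finset.univ.map φ), F (S e) =
      F (ℓ 0) * F (ℓ 1) * F (ℓ 2) * F (ℓ 3) * F (ℓ 4) * F (ℓ 5) := by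
  rw [edgesOf_map φ ht, Finset.prod_map,
    show (Finset.univ.filter fun k => pairs k ⊆ Finset.univ) = Finset.univ by decide,
    Fin.prod_univ_six]
  simp only [hℓ]

theorem spinSum_tetrahedron (S : Edge K → Spin r) (φ : Fin 4 ↪ V)
    (ht : Finset.univ.map φ ∈ K.faces) {ℓ : Fin 6 → ℕ}
    (hℓ : ∀ k, (S (tetEdge φ ht k) : ℕ) = ℓ k) :
    spinSum S (edgesOf K (Finset.univ.map φ)) = (ℓ 0 + ℓ 1 + ℓ 2 + ℓ 3 + ℓ 4 + ℓ 5) / 2 := by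
  rw [edgesOf_map φ ht, spinSum_map,
    show (Finset.univ.filter fun k => pairs k ⊆ Finset.univ) = Finset.univ by decide,
    Fin.sum_univ_six]
  simp only [hℓ]

/-- Identifies the network of the state sum with `tetWeight`. The twelve differences `b_Q - a_f` are
exactly the half-sums occurring in the four `triFact`s, one face at a time. -/
theorem tet_eq (S : Edge K → Spin r) {v x z y : V} (ht : {v, x, z, y} ∈ simplices K 3)
    {a b c j k l : ℕ} (ha : edgeLabel S {v, x} = a) (hb : edgeLabel S {v, y} = b)
    (hc : edgeLabel S {v, z} = c) (hj : edgeLabel S {x, y} = j) (hk : edgeLabel S {z, y} = k)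
    (hl : edgeLabel S {x, z} = l) (h₀ : AdmissibleZ r j k l) (h₁ : AdmissibleZ r a b j)
    (h₂ : AdmissibleZ r a c l) (h₃ : AdmissibleZ r b c k) :
    tet S {v, x, z, y} = tetWeight r j k l a b c := by
  obtain ⟨htK, hcard⟩ := mem_simplices.1 ht
  obtain ⟨φ, hp0, hp1, hp2, hp3, hφ⟩ := exists_emb_four hcard
  rw [← hφ] at htK
  have hℓ : ∀ i, (S (tetEdge φ htK i) : ℕ) = ![a, c, b, k, j, l] i := by
    intro i
    rw [← edgeLabel_val]
    change edgeLabel S ((pairs i).map φ) = _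
    fin_cases i <;> simp [pairs, hp0, hp1, hp2, hp3, ha, hb, hc, hj, hk, hl]
  obtain ⟨f₀, e0, i01, i02, i03, i04⟩ := h₀.exists_half
  obtain ⟨f₁, e1, i11, i12, i13, i14⟩ := h₁.exists_half
  obtain ⟨f₂, e2, i21, i22, i23, i24⟩ := h₂.exists_half
  obtain ⟨f₃, e3, i31, i32, i33, i34⟩ := h₃.exists_half
  obtain ⟨f₀, rfl⟩ := Int.eq_ofNat_of_zero_le (show 0 ≤ f₀ by omega)
  obtain ⟨f₁, rfl⟩ := Int.eq_ofNat_of_zero_le (show 0 ≤ f₁ by omega)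
  obtain ⟨f₂, rfl⟩ := Int.eq_ofNat_of_zero_le (show 0 ≤ f₂ by omega)
  obtain ⟨f₃, rfl⟩ := Int.eq_ofNat_of_zero_le (show 0 ≤ f₃ by omega)
  -- A quadrilateral sum is the sum of two face sums minus their common edge. Admissibility makes
  -- all halves integral and keeps the natural number subtractions from truncating.
  obtain ⟨g₁, hg1⟩ : ∃ g, g = f₁ + f₂ - a := ⟨_, rfl⟩
  obtain ⟨g₂, hg2⟩ : ∃ g, g = f₁ + f₃ - b := ⟨_, rfl⟩
  obtain ⟨g₃, hg3⟩ : ∃ g, g = f₂ + f₃ - c := ⟨_, rfl⟩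
  have q1 : (c + b + j + l) / 2 = g₁ := by omega
  have q2 : (a + c + k + j) / 2 = g₂ := by omega
  have q3 : (a + b + k + l) / 2 = g₃ := by omega
  have t0 : (k + j + l) / 2 = f₀ := by omega
  have t1 : (a + b + j) / 2 = f₁ := by omega
  have t2 : (a + c + l) / 2 = f₂ := by omega
  have t3 : (c + b + k) / 2 = f₃ := by omega
  have hT : g₁ ≤ (a + c + b + k + j + l) / 2 := by omega
  have hquad : ∀ F : ℕ → ℂ, ∏ Q ∈ quadsOf K (Finset.univ.map φ), F (spinSum S Q) =
      F g₁ * F g₃ * F g₂ := by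
    intro F
    have := prod_quadsOf S φ htK hℓ F
    simpa [q1, q2, q3] using this
  have htri : ∀ F : ℕ → ℂ, ∏ f ∈ trianglesOf K (Finset.univ.map φ), F (spinSum S (edgesOf K f)) =
      F f₀ * F f₃ * F f₁ * F f₂ := by
    intro F
    have := prod_trianglesOf S φ htK hℓ F
    simpa [t0, t1, t2, t3] using this
  have hrange : ∀ s, s ∈ tetRange S (Finset.univ.map φ) ↔
      (f₀ ≤ s ∧ f₁ ≤ s ∧ f₂ ≤ s ∧ f₃ ≤ s) ∧ s ≤ g₁ ∧ s ≤ g₂ ∧ s ≤ g₃ := by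
    intro s
    rw [tetRange, Finset.mem_filter, Finset.mem_range, spinSum_tetrahedron S φ htK hℓ,
      forall_trianglesOf S φ htK hℓ (· ≤ s), forall_quadsOf S φ htK hℓ (s ≤ ·)]
    simp only [Matrix.cons_val, t0, t1, t2, t3, q1, q2, q3]
    refine ⟨fun ⟨_, ⟨m0, m3, m1, m2⟩, m4, m6, m5⟩ => ⟨⟨m0, m1, m2, m3⟩, m4, m5, m6⟩,
      fun ⟨⟨m0, m1, m2, m3⟩, m4, m5, m6⟩ => ⟨?_, ⟨m0, m3, m1, m2⟩, m4, m6, m5⟩⟩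
    exact Nat.lt_succ_of_le (m4.trans hT)
  clear q1 q2 q3 t0 t1 t2 t3 hT
  rw [tetWeight_eq h₁ h₂ h₃, racahTet_eq r e0 e1 e2 e3 (show _ = (g₁ : ℤ) by omega)
    (show _ = (g₂ : ℤ) by omega) (show _ = (g₃ : ℤ) by omega), tet, ← hφ]
  congr 1
  · congr 1
    · rw [Finset.prod_congr rfl fun f _ => hquad fun g => qFact r (g - spinSum S (edgesOf K f)),
        htri fun n => qFact r (g₁ - n) * qFact r (g₃ - n) * qFact r (g₂ - n)]
      unfold triFact qFactZ
      rw [show (((k : ℤ) + l - j) / 2).toNat = g₃ - f₁ by omega,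
        show (((k : ℤ) + j - l) / 2).toNat = g₂ - f₂ by omega,
        show (((l : ℤ) + j - k) / 2).toNat = g₁ - f₃ by omega,
        show (((a : ℤ) + b - j) / 2).toNat = g₃ - f₀ by omega,
        show (((a : ℤ) + j - b) / 2).toNat = g₂ - f₃ by omega,
        show (((b : ℤ) + j - a) / 2).toNat = g₁ - f₂ by omega,
        show (((a : ℤ) + c - l) / 2).toNat = g₂ - f₀ by omega,
        show (((a : ℤ) + l - c) / 2).toNat = g₃ - f₃ by omega,
        show (((c : ℤ) + l - a) / 2).toNat = g₁ - f₁ by omega,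
        show (((b : ℤ) + c - k) / 2).toNat = g₁ - f₀ by omega,
        show (((b : ℤ) + k - c) / 2).toNat = g₃ - f₂ by omega,
        show (((c : ℤ) + k - b) / 2).toNat = g₂ - f₁ by omega]
      ring
    · rw [prod_edgesOf_tetrahedron S φ htK hℓ (qFact r)]
      simp only [Matrix.cons_val, qFactZ, Int.toNat_natCast]
      ring
  -- The support of the Racah term lies in the image of the summation range `tetRange`, since the
  -- terms vanish outside the bounds.
  · rw [racahSum, finsum_eq_sum_of_support_subset (s := (tetRange S (Finset.univ.map φ)).map
      Nat.castEmbedding), Finset.sum_map]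
    · refine Finset.sum_congr rfl fun s hs => ?_
      obtain ⟨⟨m0, m1, m2, m3⟩, m4, m5, m6⟩ := (hrange s).1 hs
      rw [hquad fun g => qFact r (g - s), htri fun n => qFact r (s - n)]
      simp only [Nat.castEmbedding_apply, racahTerm, ← Nat.cast_sub m0, ← Nat.cast_sub m1,
        ← Nat.cast_sub m2, ← Nat.cast_sub m3, ← Nat.cast_sub m4, ← Nat.cast_sub m5,
        ← Nat.cast_sub m6, qInvFact_natCast, zpow_natCast,
        show ((s : ℤ) + 1).toNat = s + 1 by omega, div_eq_mul_inv, mul_inv]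
      ring
    · intro s hs
      rw [Function.mem_support] at hs
      have hs' : ¬(s < f₀ ∨ s < f₁ ∨ s < f₂ ∨ s < f₃ ∨ (g₁ : ℤ) < s ∨ (g₂ : ℤ) < s ∨ (g₃ : ℤ) < s) :=
        fun h => hs (racahTerm_eq_zero r h)
      obtain ⟨s, rfl⟩ := Int.eq_ofNat_of_zero_le (show 0 ≤ s by omega)
      rw [Finset.coe_map]
      exact ⟨s, Finset.mem_coe.2 ((hrange s).2 (by omega)), rfl⟩

end Networks

/-! ### Admissibility and locality of the weights -/

section Triangles

variable {V : Type*} [Fintype V] [DecidableEq V] {K : PreAbstractSimplicialComplex V} {r : ℕ}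

theorem powersetCard_two_triple {V : Type*} [DecidableEq V] {x y z : V}
    (h : ({x, y, z} : Finset V).card = 3) :
    ({x, y, z} : Finset V).powersetCard 2 = {{x, y}, {x, z}, {y, z}} := by
  obtain ⟨hxy, hxz, hyz⟩ := ne_of_card h
  ext e
  simp only [Finset.mem_powersetCard, Finset.mem_insert, Finset.mem_singleton]
  constructor
  · rintro ⟨h1, h2⟩
    have := subset_triple_iff h2 h1
    tauto
  · rintro (rfl | rfl | rfl)
    · exact ⟨by intro u; simp; tauto, Finset.card_pair hxy⟩
    · exact ⟨by intro u; simp; tauto, Finset.card_pair hxz⟩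
    · exact ⟨by intro u; simp; tauto, Finset.card_pair hyz⟩

theorem sum_powersetCard_two_triple {V : Type*} [DecidableEq V] {x y z : V}
    (h : ({x, y, z} : Finset V).card = 3)
    (F : Finset V → ℕ) : ∑ s ∈ ({x, y, z} : Finset V).powersetCard 2, F s =
      F {x, y} + F {x, z} + F {y, z} := by
  obtain ⟨hxy, hxz, hyz⟩ := ne_of_card h
  rw [powersetCard_two_triple h, Finset.sum_insert, Finset.sum_insert, Finset.sum_singleton,
    ← add_assoc]
  · rw [Finset.mem_singleton]
    intro h0
    have : x ∈ ({y, z} : Finset V) := by rw [← h0]; simp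
    simp [hxy, hxz] at this
  · rw [Finset.mem_insert, Finset.mem_singleton, not_or]
    constructor
    · intro h0
      have : y ∈ ({x, z} : Finset V) := by rw [← h0]; simp
      simp [hxy.symm, hyz] at this
    · intro h0
      have : x ∈ ({y, z} : Finset V) := by rw [← h0]; simp
      simp [hxy, hxz] at this

/-- The labels of the edges of the triangle `f` are admissible. -/
def AdmissibleAt (S : Edge K → Spin r) (f : Finset V) : Prop :=
  (∀ s ∈ f.powersetCard 2, 2 * edgeLabel S s ≤ ∑ s ∈ f.powersetCard 2, edgeLabel S s) ∧
    Even (∑ s ∈ f.powersetCard 2, edgeLabel S s) ∧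
    ∑ s ∈ f.powersetCard 2, edgeLabel S s ≤ 2 * (r - 2)

theorem admissibleAt_iff (hr : 3 ≤ r) (S : Edge K → Spin r) {x y z : V}
    (h : ({x, y, z} : Finset V).card = 3) :
    AdmissibleAt S {x, y, z} ↔
      AdmissibleZ r (edgeLabel S {x, y}) (edgeLabel S {x, z}) (edgeLabel S {y, z}) := by
  rw [AdmissibleAt, sum_powersetCard_two_triple h, powersetCard_two_triple h, AdmissibleZ]
  simp only [Finset.forall_mem_insert, Finset.mem_singleton, forall_eq]
  rw [← Int.even_coe_nat]
  push_cast
  by_cases he : Even ((edgeLabel S {x, y} : ℤ) + edgeLabel S {x, z} + edgeLabel S {y, z})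
  · simp only [he, true_and]
    omega
  · simp only [he, false_and, and_false]

theorem exists_eq_of_isTriangle {a b c : Edge K} (h : IsTriangle K a b c) :
    ∃ x y z, ({x, y, z} : Finset V) ∈ simplices K 2 ∧ a.1 = {x, y} ∧ b.1 = {x, z} ∧
      c.1 = {y, z} := by
  obtain ⟨hab, hbc, hac, f, hf, haf, hbf, hcf⟩ := h
  have ha := (mem_simplices.1 a.2).2
  have hb := (mem_simplices.1 b.2).2
  have hc := (mem_simplices.1 c.2).2
  have hf3 := (mem_simplices.1 hf).2
  obtain ⟨x, y, hxy, hxya⟩ := Finset.card_eq_two.1 ha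
  rw [hxya] at haf
  obtain ⟨z, hz⟩ := exists_eq_insert_pair hf3 hxy haf
  have hz' : f = {x, y, z} := by
    rw [hz]
    ext
    simp
    tauto
  subst hz'
  have hab' : b.1 ≠ {x, y} := fun h0 => hab (Subtype.ext (hxya.trans h0.symm))
  have hac' : c.1 ≠ {x, y} := fun h0 => hac (Subtype.ext (hxya.trans h0.symm))
  have hbc' : b.1 ≠ c.1 := fun h0 => hbc (Subtype.ext h0)
  have hyxz : ({y, x, z} : Finset V) = {x, y, z} := by
    ext
    simp
    tauto
  have h1 : b.1 ∈ ({x, y, z} : Finset V).powersetCard 2 := Finset.mem_powersetCard.2 ⟨hbf, hb⟩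
  have h2 : c.1 ∈ ({x, y, z} : Finset V).powersetCard 2 := Finset.mem_powersetCard.2 ⟨hcf, hc⟩
  rw [powersetCard_two_triple hf3] at h1 h2
  simp only [Finset.mem_insert, Finset.mem_singleton, hab', hac', false_or] at h1 h2
  rcases h1 with h1 | h1 <;> rcases h2 with h2 | h2
  · exact absurd (h1.trans h2.symm) hbc'
  · exact ⟨x, y, z, hf, hxya, h1, h2⟩
  · exact ⟨y, x, z, by rwa [hyxz], by rw [hxya, Finset.pair_comm], h1, h2⟩
  · exact absurd (h1.trans h2.symm) hbc'

theorem isTriangle_of_mem {x y z : V} (h : ({x, y, z} : Finset V) ∈ simplices K 2)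
    {a b c : Edge K} (ha : a.1 = {x, y}) (hb : b.1 = {x, z}) (hc : c.1 = {y, z}) :
    IsTriangle K a b c := by
  obtain ⟨hxy, hxz, hyz⟩ := ne_of_card (mem_simplices.1 h).2
  refine ⟨?_, ?_, ?_, _, h, ?_, ?_, ?_⟩
  · rintro rfl
    have : y ∈ ({x, z} : Finset V) := by rw [← hb, ha]; simp
    simp [hxy.symm, hyz] at this
  · rintro rfl
    have : x ∈ ({y, z} : Finset V) := by rw [← hc, hb]; simp
    simp [hxy, hxz] at this
  · rintro rfl
    have : x ∈ ({y, z} : Finset V) := by rw [← hc, ha]; simp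
    simp [hxy, hxz] at this
  · rw [ha]
    intro u
    simp
    tauto
  · rw [hb]
    intro u
    simp
    tauto
  · rw [hc]
    intro u
    simp
    tauto

theorem pair_mem_simplices {x y z : V} (h : ({x, y, z} : Finset V) ∈ simplices K 2) :
    ({x, y} : Finset V) ∈ simplices K 1 ∧ ({x, z} : Finset V) ∈ simplices K 1 ∧
      ({y, z} : Finset V) ∈ simplices K 1 := by
  obtain ⟨hK, hc⟩ := mem_simplices.1 h
  have key : ∀ s ∈ ({x, y, z} : Finset V).powersetCard 2, s ∈ simplices K 1 := by
    intro s hs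
    obtain ⟨h1, h2⟩ := Finset.mem_powersetCard.1 hs
    exact mem_simplices.2 ⟨mem_faces_of_subset hK h1 (Finset.card_pos.1 (by omega)), h2⟩
  rw [powersetCard_two_triple hc] at key
  exact ⟨key _ (by simp), key _ (by simp), key _ (by simp)⟩

/-- A condition on each triangle as a set, so that it can be split into triangles through a vertex
and triangles away from it. -/
theorem isState_iff (hr : 3 ≤ r) (β : BoundaryEdge K → Spin r) (S : Edge K → Spin r) :
    IsState β S ↔ (∀ f ∈ simplices K 2, AdmissibleAt S f) ∧ ∀ e : BoundaryEdge K, S e.1 = β e := by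
  refine and_congr_left fun _ => ⟨fun h f hf => ?_, fun h a b c habc => ?_⟩
  · have hc := (mem_simplices.1 hf).2
    obtain ⟨x, y, z, -, -, -, rfl⟩ := Finset.card_eq_three.1 hc
    obtain ⟨h1, h2, h3⟩ := pair_mem_simplices hf
    rw [admissibleAt_iff hr S hc]
    have := (admissible_iff hr).1 (h ⟨_, h1⟩ ⟨_, h2⟩ ⟨_, h3⟩ (isTriangle_of_mem hf rfl rfl rfl))
    rwa [← edgeLabel_val, ← edgeLabel_val, ← edgeLabel_val] at this
  · obtain ⟨x, y, z, hf, ha, hb, hc⟩ := exists_eq_of_isTriangle habc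
    have := (admissibleAt_iff hr S (mem_simplices.1 hf).2).1 (h _ hf)
    rw [admissible_iff hr, ← edgeLabel_val, ← edgeLabel_val, ← edgeLabel_val, ha, hb, hc]
    exact this

theorem spinSum_congr {V : Type*} [Fintype V] {K : PreAbstractSimplicialComplex V} 
    {S S' : Edge K → Spin r} {Q : Finset (Edge K)} (h : ∀ e ∈ Q, S e = S' e) :
    spinSum S Q = spinSum S' Q := by
  rw [spinSum, spinSum, Finset.sum_congr rfl fun e he => by rw [h e he]]

theorem theta_congr {S S' : Edge K → Spin r} {f : Finset V} (h : ∀ e ∈ edgesOf K f, S e = S' e) :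
    theta S f = theta S' f := by
  rw [theta, theta, spinSum_congr h, Finset.prod_congr rfl fun e he => by rw [h e he]]

theorem tet_congr {S S' : Edge K → Spin r} {t : Finset V} (h : ∀ e ∈ edgesOf K t, S e = S' e) :
    tet S t = tet S' t := by
  have hf : ∀ f ∈ trianglesOf K t, spinSum S (edgesOf K f) = spinSum S' (edgesOf K f) := by
    intro f hf
    refine spinSum_congr fun e he => h e ?_
    rw [mem_edgesOf] at he ⊢
    exact he.trans (Finset.mem_filter.1 hf).2
  have hQ : ∀ Q ∈ quadsOf K t, spinSum S Q = spinSum S' Q := by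
    intro Q hQ
    obtain ⟨e₀, -, rfl⟩ := Finset.mem_image.1 hQ
    exact spinSum_congr fun e he => h e (Finset.mem_filter.1 he).1
  have hr : tetRange S t = tetRange S' t := by
    ext s
    simp only [tetRange, Finset.mem_filter, Finset.mem_range, spinSum_congr h]
    refine and_congr_right fun _ => and_congr ?_ ?_
    · exact forall₂_congr fun f h => by rw [hf f h]
    · exact forall₂_congr fun Q h => by rw [hQ Q h]
  unfold tet
  refine congrArg₂ (· * ·) (congrArg₂ (· / ·) ?_ ?_) (Finset.sum_congr hr fun s _ =>
    congrArg₂ (· / ·) rfl (congrArg₂ (· * ·) ?_ ?_))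
  · exact Finset.prod_congr rfl fun f h => Finset.prod_congr rfl fun Q h' => by rw [hf f h, hQ Q h']
  · exact Finset.prod_congr rfl fun e he => by rw [h e he]
  · exact Finset.prod_congr rfl fun f h => by rw [hf f h]
  · exact Finset.prod_congr rfl fun Q h => by rw [hQ Q h]

theorem admissibleAt_congr {S S' : Edge K → Spin r} {f : Finset V}
    (h : ∀ s ⊆ f, edgeLabel S s = edgeLabel S' s) : AdmissibleAt S f ↔ AdmissibleAt S' f := by
  have h' : ∀ s ∈ f.powersetCard 2, edgeLabel S s = edgeLabel S' s := fun s hs =>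
    h s (Finset.mem_powersetCard.1 hs).1
  rw [AdmissibleAt, AdmissibleAt, Finset.sum_congr rfl h']
  refine and_congr_left fun _ => forall₂_congr fun s hs => by rw [h' s hs]

theorem prod_simplices_succ (v : V) (k : ℕ) (G : Finset V → ℂ) :
    ∏ s ∈ simplices K (k + 1), G s = (∏ s ∈ simplices K (k + 1) with v ∉ s, G s) *
      ∏ s ∈ simplices (link K v) k, G (insert v s) := by
  rw [← Finset.prod_filter_mul_prod_filter_not _ (fun s => v ∈ s), mul_comm, filter_mem_simplices,
    Finset.prod_image (insert_injOn_simplices_link K v k)]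

end Triangles

/-! ### Factorization of the weight at an interior vertex -/

section ConeState

variable {V : Type*} [Fintype V] [DecidableEq V] {K : PreAbstractSimplicialComplex V} {r : ℕ}

/-- A vertex of `e` other than `v`. -/
def otherEnd (v : V) (e : Finset V) : V :=
  if h : (e.erase v).Nonempty then h.choose else v

theorem otherEnd_pair {V : Type*} [DecidableEq V] {v x : V} (h : x ≠ v) : otherEnd v {v, x} = x := by
  have he : ({v, x} : Finset V).erase v = {x} := by
    rw [Finset.erase_insert]
    simpa using h.symm
  have hne : (({v, x} : Finset V).erase v).Nonempty := by
    rw [he]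
    exact Finset.singleton_nonempty x
  rw [otherEnd, dif_pos hne]
  have h1 : ∀ u ∈ ({v, x} : Finset V).erase v, u = x := by
    rw [he]
    simp
  exact h1 _ hne.choose_spec

/-- The state whose labels on the edges `{v, x}` are given by `g x` and whose other labels are
given by `S`. -/
def coneState (v : V) (S : Edge K → Spin r) (g : V → Spin r) : Edge K → Spin r := fun e =>
  if v ∈ e.1 then g (otherEnd v e.1) else S e

theorem coneState_of_notMem {v : V} (S : Edge K → Spin r) (g : V → Spin r) {e : Edge K}
    (h : v ∉ e.1) : coneState v S g e = S e := if_neg h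

theorem coneState_of_eq {v x : V} (hx : x ≠ v) (S : Edge K → Spin r) (g : V → Spin r) {e : Edge K}
    (h : e.1 = {v, x}) : coneState v S g e = g x := by
  rw [coneState, h, if_pos (by simp), otherEnd_pair hx]

theorem edgeLabel_coneState_of_notMem {v : V} (S : Edge K → Spin r) (g : V → Spin r) {s : Finset V}
    (h : v ∉ s) : edgeLabel (coneState v S g) s = edgeLabel S s := by
  unfold edgeLabel
  split_ifs with hs
  · rw [coneState_of_notMem S g h]
  · rfl

theorem edgeLabel_coneState_pair {v x : V} (hvx : {v, x} ∈ simplices K 1) (S : Edge K → Spin r)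
    (g : V → Spin r) : edgeLabel (coneState v S g) {v, x} = g x := by
  have hx : x ≠ v := by
    rintro rfl
    have := (mem_simplices.1 hvx).2
    simp at this
  rw [edgeLabel, dif_pos hvx, coneState_of_eq hx S g rfl]

/-- The weight of a labelling, which is zero if it is not a state. -/
def stateWeight (β : BoundaryEdge K → Spin r) (S : Edge K → Spin r) : ℂ :=
  by classical exact if IsState β S then weight S else 0

/-- The labelling `S` is admissible on the triangles without the vertex `v` and restricts to `β`. -/
def IsStateAway (v : V) (β : BoundaryEdge K → Spin r) (S : Edge K → Spin r) : Prop :=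
  (∀ f ∈ simplices K 2, v ∉ f → AdmissibleAt S f) ∧ ∀ e : BoundaryEdge K, S e.1 = β e

/-- The factor of the weight that comes from the vertices and from the simplices without the
vertex `v`. -/
def awayWeight (v : V) (β : BoundaryEdge K → Spin r) (S : Edge K → Spin r) : ℂ := by
  classical exact
    if IsStateAway v β S then
      (∏ v ∈ simplices K 0, halved K v (1 / normN r)) *
        (∏ s ∈ simplices K 1 with v ∉ s, halved K s (vertexWeight r (edgeLabel S s))) *
        (∏ f ∈ simplices K 2 with v ∉ f, halved K f (1 / theta S f)) *
        ∏ t ∈ simplices K 3 with v ∉ t, tet S t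
    else 0

/-- The weight of the triangle spanned by `v` and the edge `e` of the link of `v`. -/
def coneEdgeWeight (v : V) (S : Edge K → Spin r) (e : Finset V) (g : V → Spin r) : ℂ := by
  classical exact
    if AdmissibleAt (coneState v S g) (insert v e) then 1 / theta (coneState v S g) (insert v e)
    else 0

/-- The weight of the tetrahedron spanned by `v` and the triangle `t` of the link of `v`. -/
def coneTriangleWeight (v : V) (S : Edge K → Spin r) (t : Finset V) (g : V → Spin r) : ℂ := by
  classical exact
    if ∀ e ∈ simplices (link K v) 1, e ⊆ t → AdmissibleAt (coneState v S g) (insert v e)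
    then tet (coneState v S g) (insert v t) else 0

theorem prod_edge {V : Type*} [Fintype V] {K : PreAbstractSimplicialComplex V} 
    (G : Finset V → ℂ) : ∏ e : Edge K, G e.1 = ∏ s ∈ simplices K 1, G s :=
  Finset.prod_coe_sort (simplices K 1) G

theorem not_inBoundary_of_mem {v : V} (hb : ¬ InBoundary K {v}) {s : Finset V} (hs : v ∈ s) :
    ¬ InBoundary K s := fun h => hb (h.mono (Finset.singleton_subset_iff.2 hs))

/-- The simplices through `v` are cones over those of its link. None of them is in the boundary, so
no square roots occur there and the boundary labels do not change. The admissibility conditions are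
distributed over the factors, so the formula holds for every `g`. -/
theorem stateWeight_coneState (hr : 3 ≤ r) {v : V} (hb : ¬ InBoundary K {v})
    (β : BoundaryEdge K → Spin r) (S : Edge K → Spin r) (g : V → Spin r) :
    stateWeight β (coneState v S g) = awayWeight v β S *
      ((∏ x ∈ vertices (link K v), vertexWeight r (g x : ℕ)) *
        ((∏ e ∈ simplices (link K v) 1, coneEdgeWeight v S e g) *
          ∏ t ∈ simplices (link K v) 2, coneTriangleWeight v S t g)) := by
  classical
  have hboundary : (∀ e : BoundaryEdge K, coneState v S g e.1 = β e) ↔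
      ∀ e : BoundaryEdge K, S e.1 = β e :=
    forall_congr' fun e => by
      rw [coneState_of_notMem S g fun h => not_inBoundary_of_mem hb h e.2]
  have haway : ∀ f, v ∉ f → (AdmissibleAt (coneState v S g) f ↔ AdmissibleAt S f) := fun f hf =>
    admissibleAt_congr fun s hs => edgeLabel_coneState_of_notMem S g fun h => hf (hs h)
  have hcongr : ∀ f, v ∉ f → ∀ e ∈ edgesOf K f, coneState v S g e = S e := fun f hf e he =>
    coneState_of_notMem S g fun h => hf (mem_edgesOf.1 he h)
  have hstate : IsState β (coneState v S g) ↔ IsStateAway v β S ∧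
      ∀ e ∈ simplices (link K v) 1, AdmissibleAt (coneState v S g) (insert v e) := by
    rw [isState_iff hr, hboundary, IsStateAway]
    constructor
    · rintro ⟨h1, h2⟩
      exact ⟨⟨fun f hf hvf => (haway f hvf).1 (h1 f hf), h2⟩, fun e he =>
        h1 _ (mem_simplices_link.1 he).2⟩
    · rintro ⟨⟨h1, h2⟩, h3⟩
      refine ⟨fun f hf => ?_, h2⟩
      by_cases hvf : v ∈ f
      · have : f ∈ (simplices K 2).filter fun t => v ∈ t := Finset.mem_filter.2 ⟨hf, hvf⟩
        rw [filter_mem_simplices] at this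
        obtain ⟨e, he, rfl⟩ := Finset.mem_image.1 this
        exact h3 e he
      · exact (haway f hvf).2 (h1 f hf hvf)
  by_cases h : IsStateAway v β S
  swap
  · rw [stateWeight, if_neg fun h' => h (hstate.1 h').1, awayWeight, if_neg h, zero_mul]
  by_cases h' : ∀ e ∈ simplices (link K v) 1, AdmissibleAt (coneState v S g) (insert v e)
  swap
  · rw [stateWeight, if_neg fun h0 => h' (hstate.1 h0).2]
    push Not at h'
    obtain ⟨e, he, hne⟩ := h'
    rw [Finset.prod_eq_zero he (if_neg hne), zero_mul, mul_zero, mul_zero]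
  rw [stateWeight, if_pos (hstate.2 ⟨h, h'⟩), awayWeight, if_pos h, weight]
  have he : ∏ e : Edge K, halved K e.1 (qDim r (coneState v S g e)) =
      (∏ s ∈ simplices K 1 with v ∉ s, halved K s (vertexWeight r (edgeLabel S s))) *
        ∏ x ∈ vertices (link K v), vertexWeight r (g x : ℕ) := by
    have h1 : ∀ e : Edge K, halved K e.1 (qDim r (coneState v S g e)) =
        halved K e.1 (vertexWeight r (edgeLabel (coneState v S g) e.1)) := fun e => by
      rw [edgeLabel_val, qDim_eq_vertexWeight]
    rw [Finset.prod_congr rfl fun e _ => h1 e,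
      prod_edge fun s => halved K s (vertexWeight r (edgeLabel (coneState v S g) s)),
      prod_simplices_succ v 0, simplices_zero,
      Finset.prod_image fun _ _ _ _ h => Finset.singleton_injective h]
    refine congrArg₂ (· * ·) ?_ ?_
    · refine Finset.prod_congr rfl fun s hs => ?_
      rw [edgeLabel_coneState_of_notMem S g (Finset.mem_filter.1 hs).2]
    · refine Finset.prod_congr rfl fun x hx => ?_
      have hx1 : {v, x} ∈ simplices K 1 := by
        have : ({x} : Finset V) ∈ simplices (link K v) 0 :=
          mem_simplices.2 ⟨mem_vertices.1 hx, by simp⟩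
        exact (mem_simplices_link.1 this).2
      rw [halved, if_neg (not_inBoundary_of_mem hb (by simp)), edgeLabel_coneState_pair hx1]
  have hf : ∏ f ∈ simplices K 2, halved K f (1 / theta (coneState v S g) f) =
      (∏ f ∈ simplices K 2 with v ∉ f, halved K f (1 / theta S f)) *
        ∏ e ∈ simplices (link K v) 1, coneEdgeWeight v S e g := by
    rw [prod_simplices_succ v 1]
    refine congrArg₂ (· * ·) ?_ ?_
    · refine Finset.prod_congr rfl fun f hf => ?_
      rw [theta_congr (hcongr f (Finset.mem_filter.1 hf).2)]
    · refine Finset.prod_congr rfl fun e he => ?_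
      rw [halved, if_neg (not_inBoundary_of_mem hb (by simp)), coneEdgeWeight, if_pos (h' e he)]
  have ht : ∏ t ∈ simplices K 3, tet (coneState v S g) t =
      (∏ t ∈ simplices K 3 with v ∉ t, tet S t) *
        ∏ t ∈ simplices (link K v) 2, coneTriangleWeight v S t g := by
    rw [prod_simplices_succ v 2]
    refine congrArg₂ (· * ·) ?_ ?_
    · refine Finset.prod_congr rfl fun t ht => ?_
      rw [tet_congr (hcongr t (Finset.mem_filter.1 ht).2)]
    · refine Finset.prod_congr rfl fun t ht => ?_
      rw [coneTriangleWeight, if_pos fun e he _ => h' e he]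
  rw [he, hf, ht]
  ring

theorem coneEdgeWeight_pair (hr : 3 ≤ r) {v x y : V} (h : {x, y} ∈ simplices (link K v) 1)
    (S : Edge K → Spin r) (g : V → Spin r) :
    coneEdgeWeight v S {x, y} g = edgeWeight r (edgeLabel S {x, y}) (g x : ℕ) (g y : ℕ) := by
  obtain ⟨h1, h2⟩ := mem_simplices_link.1 h
  obtain ⟨h3, h4, -⟩ := pair_mem_simplices h2
  have hadm := admissibleAt_iff hr (coneState v S g) (mem_simplices.1 h2).2
  have hθ := one_div_theta (coneState v S g) h2
  rw [edgeLabel_coneState_pair h3, edgeLabel_coneState_pair h4,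
    edgeLabel_coneState_of_notMem S g h1] at hadm hθ
  rw [coneEdgeWeight]
  split_ifs with h0
  · exact hθ (hadm.1 h0)
  · exact (if_neg fun h5 => h0 (hadm.2 h5)).symm

/-- The cutoff of the cone weight concerns the three faces through `v`, which is the cutoff of
`tetWeight`; the base face is covered by `hS`. -/
theorem coneTriangleWeight_triple (hr : 3 ≤ r) {v x z y : V}
    (h : {x, z, y} ∈ simplices (link K v) 2) (S : Edge K → Spin r) (g : V → Spin r)
    (hS : AdmissibleZ r (edgeLabel S {x, y}) (edgeLabel S {z, y}) (edgeLabel S {x, z})) :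
    coneTriangleWeight v S {x, z, y} g = tetWeight r (edgeLabel S {x, y}) (edgeLabel S {z, y})
      (edgeLabel S {x, z}) (g x : ℕ) (g y : ℕ) (g z : ℕ) := by
  obtain ⟨hv, ht⟩ := mem_simplices_link.1 h
  obtain ⟨hxz, hxy, hzy⟩ := pair_mem_simplices h
  have hside : ∀ {x y : V}, {x, y} ∈ simplices (link K v) 1 →
      (AdmissibleAt (coneState v S g) (insert v {x, y}) ↔
        AdmissibleZ r (g x : ℕ) (g y : ℕ) (edgeLabel S {x, y})) := by
    intro x y h
    obtain ⟨h1, h2⟩ := mem_simplices_link.1 h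
    obtain ⟨h3, h4, -⟩ := pair_mem_simplices h2
    have hadm := admissibleAt_iff hr (coneState v S g) (mem_simplices.1 h2).2
    rwa [edgeLabel_coneState_pair h3, edgeLabel_coneState_pair h4,
      edgeLabel_coneState_of_notMem S g h1] at hadm
  have hlab : ∀ {x y : V}, {x, y} ∈ simplices (link K v) 1 →
      edgeLabel (coneState v S g) {v, x} = g x ∧ edgeLabel (coneState v S g) {v, y} = g y ∧
        edgeLabel (coneState v S g) {x, y} = edgeLabel S {x, y} := by
    intro x y h
    obtain ⟨h1, h2⟩ := mem_simplices_link.1 h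
    obtain ⟨h3, h4, -⟩ := pair_mem_simplices h2
    exact ⟨edgeLabel_coneState_pair h3 S g, edgeLabel_coneState_pair h4 S g,
      edgeLabel_coneState_of_notMem S g h1⟩
  have hiff : (∀ e ∈ simplices (link K v) 1, e ⊆ {x, z, y} →
      AdmissibleAt (coneState v S g) (insert v e)) ↔
      AdmissibleZ r (g x : ℕ) (g y : ℕ) (edgeLabel S {x, y}) ∧
        AdmissibleZ r (g x : ℕ) (g z : ℕ) (edgeLabel S {x, z}) ∧
        AdmissibleZ r (g y : ℕ) (g z : ℕ) (edgeLabel S {z, y}) := by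
    constructor
    · intro h0
      exact ⟨(hside hxy).1 (h0 _ hxy (by intro u; simp; tauto)),
        (hside hxz).1 (h0 _ hxz (by intro u; simp; tauto)),
        ((hside hzy).1 (h0 _ hzy (by intro u; simp; tauto))).swap⟩
    · rintro ⟨h1, h2, h3⟩ e he hsub
      rcases subset_triple_iff (mem_simplices.1 he).2 hsub with rfl | rfl | rfl
      · exact (hside hxy).2 h1
      · exact (hside hxz).2 h2
      · exact (hside hzy).2 h3.swap
  rw [coneTriangleWeight]
  split_ifs with h0
  · obtain ⟨h1, h2, h3⟩ := hiff.1 h0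
    exact tet_eq (coneState v S g) ht (hlab hxy).1 (hlab hxy).2.1 (hlab hzy).1 (hlab hxy).2.2
      (hlab hzy).2.2 (hlab hxz).2.2 hS h1 h2 h3
  · exact (if_neg fun h5 => h0 (hiff.2 h5)).symm

end ConeState

/-! ### Sums with fixed labels and the triangle observable -/

section TriangleSum

variable {V : Type*} [Fintype V] [DecidableEq V] {K : PreAbstractSimplicialComplex V} {r : ℕ}

/-- The state sum with the labels of three edges kept fixed. -/
def triangleSum (β : BoundaryEdge K → Spin r) (a b c : Edge K) (x y z : Spin r) : ℂ :=
  ∑ S : Edge K → Spin r with S a = x ∧ S b = y ∧ S c = z, stateWeight β S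

/-- The state sum with the label of an edge kept fixed. -/
def edgeSum (β : BoundaryEdge K → Spin r) (c : Edge K) (z : Spin r) : ℂ :=
  ∑ S : Edge K → Spin r with S c = z, stateWeight β S

theorem sum_edgeSum (β : BoundaryEdge K → Spin r) (c : Edge K) :
    ∑ z, edgeSum β c z = partitionFunction K r β := by
  classical
  unfold edgeSum partitionFunction
  rw [Finset.sum_fiberwise Finset.univ (fun S : Edge K → Spin r => S c), Finset.sum_filter]
  refine Finset.sum_congr rfl fun S _ => ?_
  rw [stateWeight]

theorem sum_triangleSum (β : BoundaryEdge K → Spin r) (a b c : Edge K) (z : Spin r) :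
    ∑ x, ∑ y, triangleSum β a b c x y z = edgeSum β c z := by
  unfold edgeSum triangleSum
  rw [← Finset.sum_fiberwise _ fun S : Edge K → Spin r => S a]
  refine Finset.sum_congr rfl fun x _ => ?_
  rw [← Finset.sum_fiberwise _ fun S : Edge K → Spin r => S b]
  refine Finset.sum_congr rfl fun y _ => Finset.sum_congr ?_ fun _ _ => rfl
  ext S
  simp only [Finset.mem_filter, Finset.mem_univ, true_and]
  tauto

theorem triangleSum_rotate (β : BoundaryEdge K → Spin r) (a b c : Edge K) (x y z : Spin r) :
    triangleSum β a b c x y z = triangleSum β c a b z x y := by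
  refine Finset.sum_congr ?_ fun _ _ => rfl
  ext S
  simp only [Finset.mem_filter, Finset.mem_univ, true_and]
  tauto

theorem triangleSum_swap (β : BoundaryEdge K → Spin r) (a b c : Edge K) (x y z : Spin r) :
    triangleSum β a b c x y z = triangleSum β b a c y x z := by
  refine Finset.sum_congr ?_ fun _ _ => rfl
  ext S
  simp only [Finset.mem_filter, Finset.mem_univ, true_and]
  tauto

theorem triangleSum_eq_zero (β : BoundaryEdge K → Spin r) {a b c : Edge K}
    (h : IsTriangle K a b c) {x y z : Spin r} (hn : ¬ Admissible r x y z) :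
    triangleSum β a b c x y z = 0 := by
  refine Finset.sum_eq_zero fun S hS => ?_
  obtain ⟨-, rfl, rfl, rfl⟩ := Finset.mem_filter.1 hS
  exact if_neg fun h0 => hn (h0.1 a b c h)

theorem mem_vertices_link {v u : V} :
    u ∈ vertices (link K v) ↔ ({v, u} : Finset V) ∈ simplices K 1 := by
  rw [mem_vertices, mem_link, mem_simplices]
  constructor
  · rintro ⟨-, h1, h2⟩
    exact ⟨h2, Finset.card_pair (by simpa using h1)⟩
  · rintro ⟨h1, h2⟩
    refine ⟨Finset.singleton_nonempty u, ?_, h1⟩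
    rw [Finset.mem_singleton]
    rintro rfl
    simp at h2

/-- The labels of the edges at `v`, extended by `x₀`. -/
def starLabel (v : V) (x₀ : Spin r) (S : Edge K → Spin r) (u : V) : Spin r :=
  if h : {v, u} ∈ simplices K 1 then S ⟨{v, u}, h⟩ else x₀

/-- The labelling with the values `x` at `p`, `y` at `s` and `x₀` elsewhere. -/
def pairLabel (p s : V) (x y x₀ : Spin r) (u : V) : Spin r :=
  if u = p then x else if u = s then y else x₀

theorem pairLabel_left {V : Type*} [DecidableEq V] (p s : V) (x y x₀ : Spin r) : pairLabel p s x y x₀ p = x :=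
  if_pos rfl

theorem pairLabel_right {V : Type*} [DecidableEq V] {p s : V} (h : p ≠ s) (x y x₀ : Spin r) :
    pairLabel p s x y x₀ s = y := by
  rw [pairLabel, if_neg h.symm, if_pos rfl]

/-- `S₀` records the labels away from `v`, made canonical by the constant `x₀` on the star. The
labellings over `S₀` correspond to the labels on the vertices of the link; elsewhere `g` is pinned
to `x₀` to make this a bijection. -/
theorem sum_coneState {v p s : V} {a b c : Edge K} (hp : p ≠ v) (hs : s ≠ v) (hps : p ≠ s)
    (ha : a.1 = {v, p}) (hb : b.1 = {v, s}) (hc : c.1 = {p, s}) (x y z x₀ : Spin r)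
    (F : (Edge K → Spin r) → ℂ) {S₀ : Edge K → Spin r} (hS₀ : coneState v S₀ (fun _ => x₀) = S₀)
    (hz : S₀ c = z) :
    ∑ S : Edge K → Spin r with (S a = x ∧ S b = y ∧ S c = z) ∧ coneState v S (fun _ => x₀) = S₀,
        F S =
      ∑ g ∈ agreeing (pairLabel p s x y x₀)
        (vertices (link K v) \ {p, s}), F (coneState v S₀ g) := by
  have hend : ∀ e : Edge K, v ∈ e.1 → ∃ u, u ≠ v ∧ e.1 = {v, u} := by
    intro e he
    obtain ⟨u, hu⟩ := Finset.card_eq_one.1 (show (e.1.erase v).card = 1 by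
      rw [Finset.card_erase_of_mem he, (mem_simplices.1 e.2).2])
    have hu' : u ∈ e.1.erase v := by
      rw [hu]
      exact Finset.mem_singleton_self u
    exact ⟨u, Finset.ne_of_mem_erase hu', by rw [← hu, Finset.insert_erase he]⟩
  have hstar : ∀ (S : Edge K → Spin r) (e : Edge K) u, e.1 = {v, u} → starLabel v x₀ S u = S e := by
    intro S e u he
    rw [starLabel, dif_pos (he ▸ e.2)]
    exact congrArg S (Subtype.ext he.symm)
  have hvc : v ∉ c.1 := by
    rw [hc, Finset.mem_insert, Finset.mem_singleton, not_or]
    exact ⟨hp.symm, hs.symm⟩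
  refine Finset.sum_nbij' (starLabel v x₀) (coneState v S₀) ?_ ?_ ?_ ?_ ?_
  · intro S hS
    obtain ⟨-, ⟨rfl, rfl, h3⟩, rfl⟩ := Finset.mem_filter.1 hS
    refine Finset.mem_filter.2 ⟨Finset.mem_univ _, fun u hu => ?_⟩
    rw [Finset.mem_sdiff, not_and_not_right] at hu
    rw [pairLabel]
    split_ifs with h1 h2
    · rw [h1]
      exact hstar S a p ha
    · rw [h2]
      exact hstar S b s hb
    · rw [starLabel, dif_neg]
      intro h
      have := hu (mem_vertices_link.2 h)
      simp [h1, h2] at this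
  · intro g hg
    have hg := (Finset.mem_filter.1 hg).2
    refine Finset.mem_filter.2 ⟨Finset.mem_univ _, ⟨?_, ?_, ?_⟩, ?_⟩
    · rw [coneState_of_eq hp S₀ g ha, hg p (by simp), pairLabel_left]
    · rw [coneState_of_eq hs S₀ g hb, hg s (by simp), pairLabel_right hps]
    · rw [coneState_of_notMem S₀ g hvc, hz]
    · funext e
      by_cases he : v ∈ e.1
      · rw [← congrFun hS₀ e]
        simp only [coneState, if_pos he]
      · rw [coneState_of_notMem _ _ he, coneState_of_notMem _ _ he]
  · intro S hS
    obtain ⟨-, -, rfl⟩ := Finset.mem_filter.1 hS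
    funext e
    by_cases he : v ∈ e.1
    · obtain ⟨u, hu, heu⟩ := hend e he
      rw [coneState_of_eq hu _ _ heu]
      exact hstar S e u heu
    · rw [coneState_of_notMem _ _ he, coneState_of_notMem _ _ he]
  · intro g hg
    have hg := (Finset.mem_filter.1 hg).2
    funext u
    by_cases hu : u ∈ vertices (link K v)
    · have hu' := mem_vertices_link.1 hu
      have huv : u ≠ v := by
        rintro rfl
        have := (mem_simplices.1 hu').2
        simp at this
      rw [hstar _ ⟨{v, u}, hu'⟩ u rfl, coneState_of_eq huv S₀ g rfl]
    · have hup : u ≠ p := by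
        rintro rfl
        exact hu (mem_vertices_link.2 (ha ▸ a.2))
      have hus : u ≠ s := by
        rintro rfl
        exact hu (mem_vertices_link.2 (hb ▸ b.2))
      rw [starLabel, dif_neg fun h => hu (mem_vertices_link.2 h),
        hg u fun h => hu (Finset.mem_sdiff.1 h).1, pairLabel, if_neg hup, if_neg hus]
  · intro S hS
    obtain ⟨-, -, rfl⟩ := Finset.mem_filter.1 hS
    congr 1
    funext e
    by_cases he : v ∈ e.1
    · obtain ⟨u, hu, heu⟩ := hend e he
      rw [coneState_of_eq hu _ _ heu]
      exact (hstar S e u heu).symm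
    · rw [coneState_of_notMem _ _ he, coneState_of_notMem _ _ he]

theorem sum_stateWeight_coneState (hr : 3 ≤ r) {v p s : V} (hb : ¬ InBoundary K {v}) (hps : p ≠ s)
    (hp : p ∈ vertices (link K v)) (hs : s ∈ vertices (link K v))
    (β : BoundaryEdge K → Spin r) (S₀ : Edge K → Spin r) (x y x₀ : Spin r) :
    ∑ g ∈ agreeing (pairLabel p s x y x₀)
        (vertices (link K v) \ {p, s}), stateWeight β (coneState v S₀ g) =
      awayWeight v β S₀ * (vertexWeight r (x : ℕ) * vertexWeight r (y : ℕ)) *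
        partialSum (fun a : Spin r => vertexWeight r (a : ℕ)) (coneEdgeWeight v S₀)
          (coneTriangleWeight v S₀) (vertices (link K v) \ {p, s}) (simplices (link K v) 1)
          (simplices (link K v) 2) (pairLabel p s x y x₀) := by
  rw [partialSum, Finset.mul_sum]
  refine Finset.sum_congr rfl fun g hg => ?_
  have hg := (Finset.mem_filter.1 hg).2
  have hsub : ({p, s} : Finset V) ⊆ vertices (link K v) := by
    intro u hu
    simp only [Finset.mem_insert, Finset.mem_singleton] at hu
    rcases hu with rfl | rfl <;> assumption
  rw [stateWeight_coneState hr hb, ← Finset.prod_sdiff hsub, Finset.prod_pair hps, hg p (by simp),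
    hg s (by simp), pairLabel_left, pairLabel_right hps]
  ring

/-- Compare both sides for each fixed labelling away from `v`. The sum over the star contains
`dim_q(x) dim_q(y)` explicitly, and the rest is the state sum of the link, the same for both
admissible pairs. -/
theorem triangleSum_mul_eq (hr : 3 ≤ r) (hK : IsThreeManifold K) {v p s : V}
    (hb : ¬ InBoundary K {v}) (hf : {v, p, s} ∈ simplices K 2) {a b c : Edge K}
    (ha : a.1 = {v, p}) (hb' : b.1 = {v, s}) (hc : c.1 = {p, s}) (β : BoundaryEdge K → Spin r)
    {x y x' y' z : Spin r} (h : Admissible r x y z) (h' : Admissible r x' y' z) :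
    triangleSum β a b c x y z * (qDim r x' * qDim r y') =
      triangleSum β a b c x' y' z * (qDim r x * qDim r y) := by
  obtain ⟨hvp, hvs, hps⟩ := ne_of_card (mem_simplices.1 hf).2
  have hsphere := isSphereData_of_isSphere (isSphere_link_of_not_inBoundary hK
    (singleton_mem_faces (mem_simplices.1 hf).1 (by simp)) hb)
  have hlink : {p, s} ∈ simplices (link K v) 1 :=
    mem_simplices_link.2 ⟨by simp [hvp, hvs], hf⟩
  have hpv : p ∈ vertices (link K v) := mem_vertices_link.2 (ha ▸ a.2)
  have hsv : s ∈ vertices (link K v) := mem_vertices_link.2 (hb' ▸ b.2)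
  unfold triangleSum
  -- The states are sorted by their labels away from `v`; the label `z` only serves as a constant
  -- filling for the star.
  rw [← Finset.sum_fiberwise (s := Finset.univ.filter fun S : Edge K → Spin r => S a = x ∧
    S b = y ∧ S c = z) (fun S => coneState v S fun _ => z), ← Finset.sum_fiberwise
    (s := Finset.univ.filter fun S : Edge K → Spin r => S a = x' ∧ S b = y' ∧ S c = z)
    (fun S => coneState v S fun _ => z), Finset.sum_mul, Finset.sum_mul]
  refine Finset.sum_congr rfl fun S₀ _ => ?_
  simp only [Finset.filter_filter]
  by_cases hS₀ : coneState v S₀ (fun _ => z) = S₀ ∧ S₀ c = z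
  swap
  · have hempty : ∀ x y : Spin r, ∑ S : Edge K → Spin r with (S a = x ∧ S b = y ∧ S c = z) ∧
        coneState v S (fun _ => z) = S₀, stateWeight β S = 0 := by
      intro x y
      refine Finset.sum_eq_zero fun S hS => absurd ?_ hS₀
      obtain ⟨-, ⟨-, -, h3⟩, rfl⟩ := Finset.mem_filter.1 hS
      have hvc : v ∉ c.1 := by
        rw [hc, Finset.mem_insert, Finset.mem_singleton, not_or]
        exact ⟨hvp, hvs⟩
      refine ⟨?_, by rw [coneState_of_notMem _ _ hvc, h3]⟩
      funext e
      by_cases he : v ∈ e.1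
      · simp only [coneState, if_pos he]
      · rw [coneState_of_notMem _ _ he]
    rw [hempty, hempty, zero_mul, zero_mul]
  rw [sum_coneState hvp.symm hvs.symm hps ha hb' hc x y z z _ hS₀.1 hS₀.2,
    sum_coneState hvp.symm hvs.symm hps ha hb' hc x' y' z z _ hS₀.1 hS₀.2,
    sum_stateWeight_coneState hr hb hps hpv hsv, sum_stateWeight_coneState hr hb hps hpv hsv]
  by_cases haway : IsStateAway v β S₀
  swap
  · rw [awayWeight, if_neg haway]
    ring
  -- A triangle of the link is the face opposite to `v` of a tetrahedron, hence a triangle of `K`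
  -- without `v`, admissible by `haway`.
  have hw : ∀ x z y, {x, z, y} ∈ simplices (link K v) 2 →
      AdmissibleZ r (edgeLabel S₀ {x, y}) (edgeLabel S₀ {z, y}) (edgeLabel S₀ {x, z}) := by
    intro x z y hxzy
    obtain ⟨h1, h2⟩ := mem_simplices_link.1 hxzy
    have h3 : {x, z, y} ∈ simplices K 2 := by
      refine mem_simplices.2 ⟨mem_faces_of_subset (mem_simplices.1 h2).1
        (Finset.subset_insert _ _) (Finset.insert_nonempty _ _), (mem_simplices.1 hxzy).2⟩
    have h4 := (admissibleAt_iff hr S₀ (mem_simplices.1 h3).2).1 (haway.1 _ h3 h1)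
    obtain ⟨n, h5, h6, h7, h8, h9⟩ := h4.exists_half
    exact ⟨by omega, by omega, by omega, ⟨n, by omega⟩, by omega⟩
  have hz : (edgeLabel S₀ {p, s} : ℤ) = (z : ℕ) := by
    rw [← hc, edgeLabel_val, hS₀.2]
  have key := partialSum_eq_of_admissible hr hsphere
    (w := fun x y => (edgeLabel S₀ {x, y} : ℤ)) (fun x y => by simp only [Finset.pair_comm x y]) hw
    (Ew := coneEdgeWeight v S₀) (Tw := coneTriangleWeight v S₀)
    (fun x y he g => coneEdgeWeight_pair hr he S₀ g)
    (fun x z y ht g => coneTriangleWeight_triple hr ht S₀ g (hw x z y ht)) hlink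
    (γ := pairLabel p s x y z)
    (γ' := pairLabel p s x' y' z)
    (by simpa only [pairLabel_left, pairLabel_right hps, hz] using (admissible_iff hr).1 h)
    (by simpa only [pairLabel_left, pairLabel_right hps, hz] using (admissible_iff hr).1 h')
  rw [key, qDim_eq_vertexWeight, qDim_eq_vertexWeight, qDim_eq_vertexWeight, qDim_eq_vertexWeight]
  ring

/-- Sum the proportionality over all `x'`, `y'`. The fusion rule turns the sum over `x'` into
`dim_q(y') dim_q(z)`, and the sum over `y'` is then `N dim_q(z)`. -/
theorem triangleSum_mul_normN (hr : 3 ≤ r) (hK : IsThreeManifold K) {v p s : V}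
    (hb : ¬ InBoundary K {v}) (hf : {v, p, s} ∈ simplices K 2) {a b c : Edge K}
    (ha : a.1 = {v, p}) (hb' : b.1 = {v, s}) (hc : c.1 = {p, s}) (β : BoundaryEdge K → Spin r)
    (x y z : Spin r) :
    triangleSum β a b c x y z * (normN r * qDim r z) =
      qDim r x * qDim r y * (intertwinerDim r x y z : ℂ) * edgeSum β c z := by
  have htri := isTriangle_of_mem hf ha hb' hc
  by_cases h : Admissible r x y z
  swap
  · rw [triangleSum_eq_zero β htri h, intertwinerDim, if_neg h]
    simp
  have h1 : ∀ x' y', triangleSum β a b c x' y' z * (qDim r x * qDim r y) =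
      triangleSum β a b c x y z * (qDim r y' * (qDim r x' * (intertwinerDim r x' y' z : ℂ))) := by
    intro x' y'
    by_cases h' : Admissible r x' y' z
    · rw [triangleSum_mul_eq hr hK hb hf ha hb' hc β h' h, intertwinerDim, if_pos h']
      push_cast
      ring
    · rw [triangleSum_eq_zero β htri h', intertwinerDim, if_neg h']
      simp
  have h2 : edgeSum β c z * (qDim r x * qDim r y) =
      triangleSum β a b c x y z * (normN r * qDim r z) := by
    rw [← sum_triangleSum β a b c z, Finset.sum_comm, Finset.sum_mul, normN, Finset.sum_mul,
      Finset.mul_sum]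
    refine Finset.sum_congr rfl fun y' _ => ?_
    rw [Finset.sum_mul, Finset.sum_congr rfl fun x' _ => h1 x' y', ← Finset.mul_sum,
      ← Finset.mul_sum, sum_qDim_mul_intertwinerDim hr]
    ring
  rw [← h2, intertwinerDim, if_pos h]
  push_cast
  ring

/-- The previous formula is used at the end `p` of `c`, so that `c` is now one of the two edges at
the interior vertex and `{v, s}` is opposite. Summing over the label of `{v, p}` by the fusion rule
and cancelling `dim_q(y)`, then summing over the label `y` of `{v, s}`, leaves `Z`. -/
theorem edgeSum_mul_normN (hr : 3 ≤ r) (hK : IsThreeManifold K) {v p s : V}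
    (hb : ¬ InBoundary K {p}) (hf : {v, p, s} ∈ simplices K 2) (c : Edge K) (hc : c.1 = {p, s})
    (β : BoundaryEdge K → Spin r) (z : Spin r) :
    edgeSum β c z * normN r = qDim r z ^ 2 * partitionFunction K r β := by
  obtain ⟨h1, h2, h3⟩ := pair_mem_simplices hf
  have hf' : ({p, v, s} : Finset V) ∈ simplices K 2 := by
    rwa [Finset.insert_comm]
  have key := fun x y => triangleSum_mul_normN hr hK hb hf' (a := ⟨{v, p}, h1⟩) (b := c)
    (c := ⟨{v, s}, h2⟩) (Finset.pair_comm v p) hc rfl β x z y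
  rw [← sum_triangleSum β ⟨{v, p}, h1⟩ ⟨{v, s}, h2⟩ c z, Finset.sum_comm, Finset.sum_mul,
    ← sum_edgeSum β ⟨{v, s}, h2⟩, Finset.mul_sum]
  refine Finset.sum_congr rfl fun y _ => mul_right_cancel₀ (qDim_ne_zero hr y) ?_
  have h4 : ∀ x, triangleSum β ⟨{v, p}, h1⟩ ⟨{v, s}, h2⟩ c x y z * (normN r * qDim r y) =
      qDim r x * (intertwinerDim r x z y : ℂ) *
        (qDim r z * edgeSum β ⟨{v, s}, h2⟩ y) := by
    intro x
    rw [triangleSum_rotate, triangleSum_swap, key]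
    ring
  rw [mul_assoc, Finset.sum_mul, Finset.sum_congr rfl fun x _ => h4 x, ← Finset.sum_mul,
    sum_qDim_mul_intertwinerDim hr]
  ring

/-- The triangle observable, when two vertices of the triangle are interior. -/
theorem triangleSum_eq (hr : 3 ≤ r) (hK : IsThreeManifold K) {v p s : V}
    (hv : ¬ InBoundary K {v}) (hp : ¬ InBoundary K {p}) (hf : {v, p, s} ∈ simplices K 2)
    {a b c : Edge K} (ha : a.1 = {v, p}) (hb : b.1 = {v, s}) (hc : c.1 = {p, s})
    (β : BoundaryEdge K → Spin r) (x y z : Spin r) :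
    triangleSum β a b c x y z * normN r ^ 2 =
      qDim r x * qDim r y * qDim r z * (intertwinerDim r x y z : ℂ) * partitionFunction K r β := by
  have h1 := triangleSum_mul_normN hr hK hv hf ha hb hc β x y z
  have h2 := edgeSum_mul_normN hr hK hp hf c hc β z
  refine mul_right_cancel₀ (qDim_ne_zero hr z) ?_
  linear_combination normN r * h1 + qDim r x * qDim r y * (intertwinerDim r x y z : ℂ) * h2

theorem Admissible.swap {x y z : Spin r} (h : Admissible r x y z) : Admissible r y x z := by
  obtain ⟨h1, h2, h3, ⟨n, h4⟩, h5⟩ := h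
  exact ⟨h2, h1, by omega, ⟨n, by omega⟩, by omega⟩

theorem Admissible.rotate {x y z : Spin r} (h : Admissible r x y z) : Admissible r z x y := by
  obtain ⟨h1, h2, h3, ⟨n, h4⟩, h5⟩ := h
  exact ⟨by omega, by omega, by omega, ⟨n, by omega⟩, by omega⟩

theorem intertwinerDim_swap (x y z : Spin r) : intertwinerDim r y x z = intertwinerDim r x y z := by
  classical exact if_congr ⟨Admissible.swap, Admissible.swap⟩ rfl rfl

theorem intertwinerDim_rotate (x y z : Spin r) : intertwinerDim r z x y = intertwinerDim r x y z := by
  classical exact if_congr ⟨fun h => h.rotate.rotate, Admissible.rotate⟩ rfl rfl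

theorem observableSum_eq_triangleSum (β : BoundaryEdge K → Spin r) (a b c : Edge K)
    (x y z : Spin r) : observableSum K r β ![a, b, c] ![x, y, z] = triangleSum β a b c x y z := by
  classical
  rw [observableSum, triangleSum, Finset.sum_filter, Finset.sum_filter]
  refine Finset.sum_congr rfl fun S _ => ?_
  have h : (∀ k, S (![a, b, c] k) = ![x, y, z] k) ↔ S a = x ∧ S b = y ∧ S c = z := by
    simp [Fin.forall_fin_succ]
  rw [stateWeight]
  by_cases h1 : IsState β S <;> by_cases h2 : S a = x ∧ S b = y ∧ S c = z <;> simp [h, h1, h2]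

end TriangleSum

end

end TuraevViro

theorem mainTheorem2 (r : ℕ) (hr : 3 ≤ r) (i j c : TuraevViro.Spin r)
    {V : Type*} [Fintype V] [DecidableEq V] (M : PreAbstractSimplicialComplex V)
    (hM : TuraevViro.IsThreeManifold M)
    (β : TuraevViro.BoundaryEdge M → TuraevViro.Spin r)
    (hZ : TuraevViro.partitionFunction M r β ≠ 0)
    (e₁ e₂ e₃ : TuraevViro.Edge M) (hT : TuraevViro.IsTriangle M e₁ e₂ e₃)
    (hO : TuraevViro.IsObservable M ![e₁, e₂, e₃]) :
    TuraevViro.expectation M r β ![e₁, e₂, e₃] ![i, j, c] =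
      1 / TuraevViro.normN r ^ 2 *
        (TuraevViro.qDim r i * TuraevViro.qDim r j * TuraevViro.qDim r c) *
        (TuraevViro.intertwinerDim r i j c : ℂ) := by
  open TuraevViro in
  obtain ⟨x, y, z, hf, h1, h2, h3⟩ := exists_eq_of_isTriangle hT
  obtain ⟨hxy, hxz, hyz⟩ := ne_of_card (mem_simplices.1 hf).2
  -- Two boundary vertices of the triangle would be two boundary points of one edge of the
  -- observable, so at least two of `x`, `y`, `z` are interior.
  have hO1 : InBoundary M {x} → InBoundary M {y} → x = y :=
    (hO.2 0).2 x (by simp [h1]) y (by simp [h1])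
  have hO2 : InBoundary M {x} → InBoundary M {z} → x = z :=
    (hO.2 1).2 x (by simp [h2]) z (by simp [h2])
  have hO3 : InBoundary M {y} → InBoundary M {z} → y = z :=
    (hO.2 2).2 y (by simp [h3]) z (by simp [h3])
  have key : triangleSum β e₁ e₂ e₃ i j c * normN r ^ 2 =
      qDim r i * qDim r j * qDim r c * (intertwinerDim r i j c : ℂ) *
        partitionFunction M r β := by
    -- The triangle is relabelled so that the vertex which may lie on the boundary comes last, as
    -- `triangleSum_eq` requires.
    by_cases hx : InBoundary M {x}
    · have hy : ¬ InBoundary M {y} := fun hy => hxy (hO1 hx hy)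
      have hz : ¬ InBoundary M {z} := fun hz => hxz (hO2 hx hz)
      have hf' : ({y, z, x} : Finset V) ∈ simplices M 2 := by
        rwa [Finset.pair_comm z x, Finset.insert_comm]
      rw [triangleSum_rotate, triangleSum_eq hr hM hy hz hf' h3 (h1.trans (Finset.pair_comm x y))
        (h2.trans (Finset.pair_comm x z)), intertwinerDim_rotate]
      ring
    · by_cases hy : InBoundary M {y}
      · have hz : ¬ InBoundary M {z} := fun hz => hyz (hO3 hy hz)
        have hf' : ({x, z, y} : Finset V) ∈ simplices M 2 := by
          rwa [Finset.pair_comm z y]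
        rw [triangleSum_swap, triangleSum_eq hr hM hx hz hf' h2 h1 (h3.trans (Finset.pair_comm y z)),
          intertwinerDim_swap]
        ring
      · exact triangleSum_eq hr hM hx hy hf h1 h2 h3 β i j c
  rw [expectation, observableSum_eq_triangleSum, div_eq_iff hZ]
  refine mul_right_cancel₀ (pow_ne_zero 2 (normN_ne_zero hr)) ?_
  rw [key]
  field_simp [normN_ne_zero hr]
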